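/- **Setting.** Let $M$ be a smooth (Hausdorff) manifold of dimension $n$. A $G$-structure on $M$ consists of a smooth principal bundle $\pi:P\to M$ with structure group a Lie group $G$, a smooth representation $\rho:G\to GL(V)$ on a real vector space $V$ with $\dim V=n$, and a $V$-valued 1-form $\theta\in\Omega^1(P;V)$, the displacement form, which is $G$-equivariant, $(r^g)^*\theta=\rho(g^{-1})\theta$, and whose kernel is exactly the vertical bundle $\ker T\pi$. For a principal connection $\omega\in\Omega^1(P;\mathfrak g)$ with horizontal projection $\chi$, its torsion is $d_\omega\theta=\chi^*d\theta$; the $G$-structure is called 1-integrable if it admits a principal connection with vanishing torsion. Let $\Lambda(V^*)^G$ be the algebra of alternating forms $f$ on $V$ with $f\circ(\rho(g)\times\dots\times\rho(g))=f$ for all $g\in G$. For alternating $f\in\Lambda^k(V^*)$ let $f(\theta,\dots,\theta)\in\Omega^k(P)$ be the form $(X_1,\dots,X_k)\mapsto f(\theta(X_1),\dots,\theta(X_k))$. Wedge products are normalized by $(f\wedge g)(v_1,\dots,v_{p+q})=\frac1{p!\,q!}\sum_{\sigma}\operatorname{sign}(\sigma)f(v_{\sigma1},\dots,v_{\sigma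 p})\,g(v_{\sigma(p+1)},\dots,v_{\sigma(p+q)})$. **Corollary 2.2.** 1. For every $G$-structure on $M$ there is a unique map $\nu:\Lambda(V^*)^G\to\Omega(M)$ with $\pi^*(\nu(f)_k)=f_k(\theta,\dots,\theta)$ for every $f\in\Lambda(V^*)^G$ and every degree $k$, where the index $k$ denotes the component of degree $k$; and $\nu$ is a homomorphism of (unital, associative) real algebras. 2. If the $G$-structure is 1-integrable, then $d\,\nu(f)=0$ for all $f\in\Lambda(V^*)^G$, and $f\mapsto[\nu(f)]$ is an algebra homomorphism $\nu^*:\Lambda(V^*)^G\to H^*(M)$ into the de Rham cohomology algebra. If moreover $M$ is non-empty and $M$ and $G$ are compact, then $\nu^*$ is injective. -/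

import Mathlib

open scoped Manifold ContDiff Nat DirectSum

noncomputable section

namespace GStr

section Alternating

variable {T : Type*} [AddCommGroup T] [Module ℝ T] [TopologicalSpace T]

/-- The space `Λᵏ(T*)` of real-valued alternating `k`-forms on `T`. -/
abbrev AltForm (T : Type*) [AddCommGroup T] [Module ℝ T] [TopologicalSpace T] (k : ℕ) : Type _ :=
  T [⋀^Fin k]→L[ℝ] ℝ

/-- The (not yet alternating) product `(v₁,…,v_{p+q}) ↦ f(v₁,…,v_p) g(v_{p+1},…,v_{p+q})`. -/
def tensorMul {p q : ℕ} (f : AltForm T p) (g : AltForm T q) :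
    ContinuousMultilinearMap ℝ (fun _ : Fin (p + q) => T) ℝ where
  toFun v := f (v ∘ Fin.castAdd q) * g (v ∘ Fin.natAdd p)
  map_update_add' {inst} v i x y := by
    obtain rfl := Subsingleton.elim inst (instDecidableEqFin _)
    refine Fin.addCases (fun i => ?_) (fun i => ?_) i
    · have h (z : T) : Function.update v (Fin.castAdd q i) z ∘ Fin.natAdd p = v ∘ Fin.natAdd p :=
        Function.update_comp_eq_of_forall_ne _ _ (fun j => by simp [Fin.ext_iff]; omega)
      simp only [h, Function.update_comp_eq_of_injective _ (Fin.castAdd_injective p q),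
        ContinuousAlternatingMap.map_update_add, add_mul]
    · have h (z : T) : Function.update v (Fin.natAdd p i) z ∘ Fin.castAdd q = v ∘ Fin.castAdd q :=
        Function.update_comp_eq_of_forall_ne _ _ (fun j => by simp [Fin.ext_iff]; omega)
      simp only [h, Function.update_comp_eq_of_injective _ (Fin.natAdd_injective q p),
        ContinuousAlternatingMap.map_update_add, mul_add]
  map_update_smul' {inst} v i c x := by
    obtain rfl := Subsingleton.elim inst (instDecidableEqFin _)
    refine Fin.addCases (fun i => ?_) (fun i => ?_) i
    · have h (z : T) : Function.update v (Fin.castAdd q i) z ∘ Fin.natAdd p = v ∘ Fin.natAdd p :=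
        Function.update_comp_eq_of_forall_ne _ _ (fun j => by simp [Fin.ext_iff]; omega)
      simp only [h, Function.update_comp_eq_of_injective _ (Fin.castAdd_injective p q),
        ContinuousAlternatingMap.map_update_smul, smul_eq_mul, mul_assoc]
    · have h (z : T) : Function.update v (Fin.natAdd p i) z ∘ Fin.castAdd q = v ∘ Fin.castAdd q :=
        Function.update_comp_eq_of_forall_ne _ _ (fun j => by simp [Fin.ext_iff]; omega)
      simp only [h, Function.update_comp_eq_of_injective _ (Fin.natAdd_injective q p),
        ContinuousAlternatingMap.map_update_smul, smul_eq_mul, mul_left_comm]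
  cont := by
    refine (f.cont.comp ?_).mul (g.cont.comp ?_) <;>
    exact continuous_pi fun i => continuous_apply _

/-- The wedge product
`(f ∧ g)(v₁,…,v_{p+q}) = 1/(p! q!) ∑_σ sign σ f(v_{σ1},…,v_{σp}) g(v_{σ(p+1)},…,v_{σ(p+q)})`. -/
def wedge {p q : ℕ} (f : AltForm T p) (g : AltForm T q) : AltForm T (p + q) :=
  ((p ! * q ! : ℝ))⁻¹ • ContinuousMultilinearMap.alternatization (tensorMul f g)

theorem wedge_apply {p q : ℕ} (f : AltForm T p) (g : AltForm T q) (v : Fin (p + q) → T) :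
    wedge f g v = ((p ! * q ! : ℝ))⁻¹ * ∑ σ : Equiv.Perm (Fin (p + q)),
      ((Equiv.Perm.sign σ : ℤ) : ℝ) * (f (v ∘ σ ∘ Fin.castAdd q) * g (v ∘ σ ∘ Fin.natAdd p)) := by
  simp only [wedge, ContinuousAlternatingMap.smul_apply,
    ContinuousMultilinearMap.alternatization_apply_apply, smul_eq_mul]
  congr 1
  refine Finset.sum_congr rfl fun σ _ => ?_
  rw [Units.smul_def, zsmul_eq_mul]
  rfl

/-- The constant `1` as a `0`-form. -/
def oneForm : AltForm T 0 := ContinuousAlternatingMap.constOfIsEmpty ℝ T (Fin 0) 1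

/-- Reindexing a form along an equality of degrees. -/
def castForm {p q : ℕ} (h : p = q) (f : AltForm T p) : AltForm T q :=
  { f.toAlternatingMap.domDomCongr (finCongr h) with
    cont := f.cont.comp (continuous_pi fun _ => continuous_apply _) }

theorem castForm_apply {p q : ℕ} (h : p = q) (f : AltForm T p) (v : Fin q → T) :
    castForm h f v = f (v ∘ Fin.cast h) := rfl

theorem sigma_castForm {p q : ℕ} (h : p = q) (f : AltForm T p) :
    (⟨p, f⟩ : GradedMonoid (AltForm T)) = ⟨q, castForm h f⟩ := by
  subst h
  rfl

theorem add_wedge {p q : ℕ} (f f' : AltForm T p) (g : AltForm T q) :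
    wedge (f + f') g = wedge f g + wedge f' g := by
  ext v
  simp [wedge_apply, add_mul, mul_add, Finset.sum_add_distrib]

theorem wedge_add {p q : ℕ} (f : AltForm T p) (g g' : AltForm T q) :
    wedge f (g + g') = wedge f g + wedge f g' := by
  ext v
  simp [wedge_apply, mul_add, Finset.sum_add_distrib]

theorem smul_wedge {p q : ℕ} (c : ℝ) (f : AltForm T p) (g : AltForm T q) :
    wedge (c • f) g = c • wedge f g := by
  ext v
  simp only [wedge_apply, ContinuousAlternatingMap.smul_apply, smul_eq_mul, Finset.mul_sum]
  refine Finset.sum_congr rfl fun σ _ => ?_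
  ring

theorem wedge_smul {p q : ℕ} (c : ℝ) (f : AltForm T p) (g : AltForm T q) :
    wedge f (c • g) = c • wedge f g := by
  ext v
  simp only [wedge_apply, ContinuousAlternatingMap.smul_apply, smul_eq_mul, Finset.mul_sum]
  refine Finset.sum_congr rfl fun σ _ => ?_
  ring

theorem wedge_comp {T' : Type*} [AddCommGroup T'] [Module ℝ T'] [TopologicalSpace T']
    {p q : ℕ} (f : AltForm T p) (g : AltForm T q) (L : T' →L[ℝ] T) :
    (wedge f g).compContinuousLinearMap L =
      wedge (f.compContinuousLinearMap L) (g.compContinuousLinearMap L) := by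
  ext v
  simp only [ContinuousAlternatingMap.compContinuousLinearMap_apply, wedge_apply]
  rfl

theorem alternating_sign {p : ℕ} (f : AltForm T p) (v : Fin p → T) (σ : Equiv.Perm (Fin p)) :
    ((Equiv.Perm.sign σ : ℤ) : ℝ) * f (v ∘ σ) = f v := by
  have h := f.toAlternatingMap.map_perm v σ
  have h' : f (v ∘ σ) = ((Equiv.Perm.sign σ : ℤ) : ℝ) * f v := by
    rw [Units.smul_def, zsmul_eq_mul] at h
    exact h
  rw [h', ← mul_assoc, ← Int.cast_mul, Int.units_coe_mul_self]
  simp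

theorem sign_mul_self {ι : Type*} [Fintype ι] [DecidableEq ι] (σ : Equiv.Perm ι) :
    ((Equiv.Perm.sign σ : ℤ) : ℝ) * ((Equiv.Perm.sign σ : ℤ) : ℝ) = 1 := by
  rw [← Int.cast_mul, Int.units_coe_mul_self, Int.cast_one]

/-- Antisymmetrizing over a subgroup first does not change the total antisymmetrization. -/
theorem sum_absorb {ι κ : Type*} [Fintype ι] [DecidableEq ι] [Fintype κ] [DecidableEq κ]
    (emb : Equiv.Perm κ → Equiv.Perm ι) (hemb : ∀ τ, Equiv.Perm.sign (emb τ) = Equiv.Perm.sign τ)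
    (H : Equiv.Perm ι → ℝ) :
    ∑ σ : Equiv.Perm ι, ((Equiv.Perm.sign σ : ℤ) : ℝ) *
      ∑ τ : Equiv.Perm κ, ((Equiv.Perm.sign τ : ℤ) : ℝ) * H (σ * emb τ) =
    ((Fintype.card κ)! : ℝ) * ∑ σ : Equiv.Perm ι, ((Equiv.Perm.sign σ : ℤ) : ℝ) * H σ := by
  simp only [Finset.mul_sum]
  rw [Finset.sum_comm]
  have key (τ : Equiv.Perm κ) : ∑ σ : Equiv.Perm ι, ((Equiv.Perm.sign σ : ℤ) : ℝ) *
      (((Equiv.Perm.sign τ : ℤ) : ℝ) * H (σ * emb τ)) =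
      ∑ σ : Equiv.Perm ι, ((Equiv.Perm.sign σ : ℤ) : ℝ) * H σ := by
    refine Fintype.sum_equiv (Equiv.mulRight (emb τ)) _ _ fun σ => ?_
    simp only [Equiv.coe_mulRight, Equiv.Perm.sign_mul, hemb, Units.val_mul, Int.cast_mul]
    ring
  rw [Finset.sum_congr rfl fun τ _ => key τ]
  simp [Fintype.card_perm, Finset.mul_sum]

/-- A permutation of the first `p` of `p + q` letters. -/
def permLeft {p : ℕ} (q : ℕ) (τ : Equiv.Perm (Fin p)) : Equiv.Perm (Fin (p + q)) :=
  finSumFinEquiv.permCongr (Equiv.sumCongr τ 1)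

/-- A permutation of the last `q` of `p + q` letters. -/
def permRight (p : ℕ) {q : ℕ} (τ : Equiv.Perm (Fin q)) : Equiv.Perm (Fin (p + q)) :=
  finSumFinEquiv.permCongr (Equiv.sumCongr 1 τ)

theorem sign_permLeft {p : ℕ} (q : ℕ) (τ : Equiv.Perm (Fin p)) :
    Equiv.Perm.sign (permLeft q τ) = Equiv.Perm.sign τ := by
  simp [permLeft]

theorem sign_permRight (p : ℕ) {q : ℕ} (τ : Equiv.Perm (Fin q)) :
    Equiv.Perm.sign (permRight p τ) = Equiv.Perm.sign τ := by
  simp [permRight]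

@[simp] theorem permLeft_castAdd {p q : ℕ} (τ : Equiv.Perm (Fin p)) (i : Fin p) :
    permLeft q τ (Fin.castAdd q i) = Fin.castAdd q (τ i) := by
  simp [permLeft, Equiv.permCongr_apply]

@[simp] theorem permLeft_natAdd {p q : ℕ} (τ : Equiv.Perm (Fin p)) (i : Fin q) :
    permLeft q τ (Fin.natAdd p i) = Fin.natAdd p i := by
  simp [permLeft, Equiv.permCongr_apply]

@[simp] theorem permRight_castAdd {p q : ℕ} (τ : Equiv.Perm (Fin q)) (i : Fin p) :
    permRight p τ (Fin.castAdd q i) = Fin.castAdd q i := by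
  simp [permRight, Equiv.permCongr_apply]

@[simp] theorem permRight_natAdd {p q : ℕ} (τ : Equiv.Perm (Fin q)) (i : Fin q) :
    permRight p τ (Fin.natAdd p i) = Fin.natAdd p (τ i) := by
  simp [permRight, Equiv.permCongr_apply]

theorem wedge_wedge_apply {p q r : ℕ} (f : AltForm T p) (g : AltForm T q) (h : AltForm T r)
    (v : Fin (p + q + r) → T) :
    wedge (wedge f g) h v = ((p ! * q ! * r ! : ℝ))⁻¹ * ∑ σ : Equiv.Perm (Fin (p + q + r)),
      ((Equiv.Perm.sign σ : ℤ) : ℝ) * (f (v ∘ σ ∘ Fin.castAdd r ∘ Fin.castAdd q) *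
        g (v ∘ σ ∘ Fin.castAdd r ∘ Fin.natAdd p) * h (v ∘ σ ∘ Fin.natAdd (p + q))) := by
  have key := sum_absorb (permLeft r) (sign_permLeft (p := p + q) r) (fun σ =>
    f (v ∘ σ ∘ Fin.castAdd r ∘ Fin.castAdd q) *
        g (v ∘ σ ∘ Fin.castAdd r ∘ Fin.natAdd p) * h (v ∘ σ ∘ Fin.natAdd (p + q)))
  have e1 (σ : Equiv.Perm (Fin (p + q + r))) (τ : Equiv.Perm (Fin (p + q))) :
      v ∘ ⇑(σ * permLeft r τ) ∘ Fin.castAdd r ∘ Fin.castAdd q =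
        (v ∘ σ ∘ Fin.castAdd r) ∘ τ ∘ Fin.castAdd q := by ext; simp
  have e2 (σ : Equiv.Perm (Fin (p + q + r))) (τ : Equiv.Perm (Fin (p + q))) :
      v ∘ ⇑(σ * permLeft r τ) ∘ Fin.castAdd r ∘ Fin.natAdd p =
        (v ∘ σ ∘ Fin.castAdd r) ∘ τ ∘ Fin.natAdd p := by ext; simp
  have e3 (σ : Equiv.Perm (Fin (p + q + r))) (τ : Equiv.Perm (Fin (p + q))) :
      v ∘ ⇑(σ * permLeft r τ) ∘ Fin.natAdd (p + q) = v ∘ σ ∘ Fin.natAdd (p + q) := by ext; simp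
  simp only [e1, e2, e3, Fintype.card_fin] at key
  have hne : ((p + q)! : ℝ) ≠ 0 := by positivity
  rw [← mul_right_inj' hne, mul_left_comm, ← key, wedge_apply]
  simp only [wedge_apply, Finset.mul_sum, Finset.sum_mul]
  refine Finset.sum_congr rfl fun σ _ => Finset.sum_congr rfl fun τ _ => ?_
  field_simp

theorem wedge_wedge_apply' {p q r : ℕ} (f : AltForm T p) (g : AltForm T q) (h : AltForm T r)
    (v : Fin (p + (q + r)) → T) :
    wedge f (wedge g h) v = ((p ! * q ! * r ! : ℝ))⁻¹ * ∑ σ : Equiv.Perm (Fin (p + (q + r))),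
      ((Equiv.Perm.sign σ : ℤ) : ℝ) * (f (v ∘ σ ∘ Fin.castAdd (q + r)) *
        g (v ∘ σ ∘ Fin.natAdd p ∘ Fin.castAdd r) * h (v ∘ σ ∘ Fin.natAdd p ∘ Fin.natAdd q)) := by
  have key := sum_absorb (permRight p) (sign_permRight (q := q + r) p) (fun σ =>
    f (v ∘ σ ∘ Fin.castAdd (q + r)) *
        g (v ∘ σ ∘ Fin.natAdd p ∘ Fin.castAdd r) * h (v ∘ σ ∘ Fin.natAdd p ∘ Fin.natAdd q))
  have e1 (σ : Equiv.Perm (Fin (p + (q + r)))) (τ : Equiv.Perm (Fin (q + r))) :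
      v ∘ ⇑(σ * permRight p τ) ∘ Fin.castAdd (q + r) = v ∘ σ ∘ Fin.castAdd (q + r) := by ext; simp
  have e2 (σ : Equiv.Perm (Fin (p + (q + r)))) (τ : Equiv.Perm (Fin (q + r))) :
      v ∘ ⇑(σ * permRight p τ) ∘ Fin.natAdd p ∘ Fin.castAdd r =
        (v ∘ σ ∘ Fin.natAdd p) ∘ τ ∘ Fin.castAdd r := by ext; simp
  have e3 (σ : Equiv.Perm (Fin (p + (q + r)))) (τ : Equiv.Perm (Fin (q + r))) :
      v ∘ ⇑(σ * permRight p τ) ∘ Fin.natAdd p ∘ Fin.natAdd q =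
        (v ∘ σ ∘ Fin.natAdd p) ∘ τ ∘ Fin.natAdd q := by ext; simp
  simp only [e1, e2, e3, Fintype.card_fin] at key
  have hne : ((q + r)! : ℝ) ≠ 0 := by positivity
  rw [← mul_right_inj' hne, mul_left_comm, ← key, wedge_apply]
  simp only [wedge_apply, Finset.mul_sum]
  refine Finset.sum_congr rfl fun σ _ => Finset.sum_congr rfl fun τ _ => ?_
  field_simp

theorem wedge_assoc {p q r : ℕ} (f : AltForm T p) (g : AltForm T q) (h : AltForm T r) :
    castForm (add_assoc p q r) (wedge (wedge f g) h) = wedge f (wedge g h) := by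
  ext v
  rw [castForm_apply, wedge_wedge_apply, wedge_wedge_apply']
  congr 1
  refine Fintype.sum_equiv (finCongr (add_assoc p q r)).permCongr _ _ fun σ => ?_
  rw [Equiv.Perm.sign_permCongr]
  congr 1
  have e1 : (v ∘ Fin.cast (add_assoc p q r)) ∘ σ ∘ Fin.castAdd r ∘ Fin.castAdd q =
      v ∘ (finCongr (add_assoc p q r)).permCongr σ ∘ Fin.castAdd (q + r) := by
    ext i; simp [Equiv.permCongr_apply, Fin.castAdd, Fin.castLE, Fin.cast]
  have e2 : (v ∘ Fin.cast (add_assoc p q r)) ∘ σ ∘ Fin.castAdd r ∘ Fin.natAdd p =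
      v ∘ (finCongr (add_assoc p q r)).permCongr σ ∘ Fin.natAdd p ∘ Fin.castAdd r := by
    ext i; simp [Equiv.permCongr_apply, Fin.castAdd, Fin.castLE, Fin.natAdd, Fin.cast]
  have e3 : (v ∘ Fin.cast (add_assoc p q r)) ∘ σ ∘ Fin.natAdd (p + q) =
      v ∘ (finCongr (add_assoc p q r)).permCongr σ ∘ Fin.natAdd p ∘ Fin.natAdd q := by
    ext i; simp [Equiv.permCongr_apply, Fin.natAdd, Fin.cast, add_assoc]
  rw [e1, e2, e3]

theorem one_wedge {p : ℕ} (f : AltForm T p) : castForm (zero_add p) (wedge oneForm f) = f := by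
  ext v
  rw [castForm_apply, wedge_apply]
  have (σ : Equiv.Perm (Fin (0 + p))) : ((Equiv.Perm.sign σ : ℤ) : ℝ) *
      (oneForm (T := T) ((v ∘ Fin.cast (zero_add p)) ∘ σ ∘ Fin.castAdd p) *
        f ((v ∘ Fin.cast (zero_add p)) ∘ σ ∘ Fin.natAdd 0)) = f v := by
    rw [← alternating_sign f v ((finCongr (zero_add p)).permCongr σ), Equiv.Perm.sign_permCongr]
    simp only [oneForm, ContinuousAlternatingMap.constOfIsEmpty_apply, one_mul]
    congr 2
    ext i
    simp [Equiv.permCongr_apply, Fin.cast]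
  rw [Finset.sum_congr rfl fun σ _ => this σ]
  simp [Fintype.card_perm]
  field_simp

theorem wedge_one {p : ℕ} (f : AltForm T p) : wedge f oneForm = f := by
  ext v
  rw [wedge_apply]
  have (σ : Equiv.Perm (Fin (p + 0))) : ((Equiv.Perm.sign σ : ℤ) : ℝ) *
      (f (v ∘ σ ∘ Fin.castAdd 0) * oneForm (T := T) (v ∘ σ ∘ Fin.natAdd p)) = f v := by
    rw [← alternating_sign f v σ]
    simp only [oneForm, ContinuousAlternatingMap.constOfIsEmpty_apply, mul_one]
    rfl
  rw [Finset.sum_congr rfl fun σ _ => this σ]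
  simp [Fintype.card_perm]
  field_simp

theorem zero_wedge {p q : ℕ} (g : AltForm T q) : wedge (0 : AltForm T p) g = 0 := by
  ext v
  simp [wedge_apply]

theorem wedge_zero {p q : ℕ} (f : AltForm T p) : wedge f (0 : AltForm T q) = 0 := by
  ext v
  simp [wedge_apply]

instance : GradedMonoid.GOne (AltForm T) where
  one := oneForm

instance : GradedMonoid.GMul (AltForm T) where
  mul f g := wedge f g

/-- The exterior algebra `Λ(T*) = ⨁ₖ Λᵏ(T*)` is a graded ring under the wedge product. -/
instance : DirectSum.GRing (AltForm T) where
  toGMonoid :=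
    { one_mul := fun ⟨p, f⟩ => (sigma_castForm (zero_add p) (wedge oneForm f)).trans
        (congrArg (Sigma.mk p) (one_wedge f))
      mul_one := fun ⟨p, f⟩ => congrArg (Sigma.mk p) (wedge_one f)
      mul_assoc := fun ⟨p, f⟩ ⟨q, g⟩ ⟨r, h⟩ =>
        (sigma_castForm (add_assoc p q r) (wedge (wedge f g) h)).trans
          (congrArg (Sigma.mk (p + (q + r))) (wedge_assoc f g h)) }
  mul_zero := wedge_zero
  zero_mul := zero_wedge
  mul_add := wedge_add
  add_mul := add_wedge
  natCast n := (n : ℝ) • oneForm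
  natCast_zero := by simp
  natCast_succ n := by
    rw [Nat.cast_succ, add_smul, one_smul]
    rfl
  intCast n := (n : ℝ) • oneForm
  intCast_ofNat n := by simp
  intCast_negSucc_ofNat n := by
    rw [Int.cast_negSucc, ← neg_smul ((n + 1 : ℕ) : ℝ) (oneForm (T := T))]

/-- The graded ring `Λ(T*)` is a real algebra. -/
instance : DirectSum.GAlgebra ℝ (AltForm T) where
  toFun :=
    { toFun := fun c => c • oneForm
      map_zero' := zero_smul _ _
      map_add' := fun c d => add_smul _ _ _ }
  map_one := one_smul _ _
  map_mul c d := by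
    refine Eq.symm (congrArg (Sigma.mk 0) ((smul_wedge c oneForm (d • oneForm)).trans
      ((congrArg (c • ·) ((wedge_smul d oneForm oneForm).trans
        (congrArg (d • ·) (wedge_one oneForm)))).trans (smul_smul c d _))))
  commutes := fun c ⟨p, f⟩ => by
    refine (sigma_castForm (zero_add p) (wedge (c • oneForm) f)).trans
      (congrArg (Sigma.mk p) ?_)
    rw [smul_wedge]
    refine Eq.trans (b := c • f) ?_ ?_
    · ext v
      rw [castForm_apply, ContinuousAlternatingMap.smul_apply, ← castForm_apply, one_wedge]
      rfl
    · exact ((wedge_smul c f oneForm).trans (congrArg (c • ·) (wedge_one f))).symm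
  smul_def := fun c ⟨p, f⟩ => by
    refine Eq.symm ((sigma_castForm (zero_add p) (wedge (c • oneForm) f)).trans
      (congrArg (Sigma.mk p) ?_))
    rw [smul_wedge]
    ext v
    rw [castForm_apply, ContinuousAlternatingMap.smul_apply, ← castForm_apply, one_wedge]
    rfl

/-- The exterior algebra `Λ(T*)`. -/
abbrev ExtAlg (T : Type*) [AddCommGroup T] [Module ℝ T] [TopologicalSpace T] : Type _ :=
  ⨁ k : ℕ, AltForm T k

end Alternating

section Leibniz

variable {E : Type*} [NormedAddCommGroup E] [NormedSpace ℝ E]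

theorem norm_wedge_le {p q : ℕ} (f : AltForm E p) (g : AltForm E q) :
    ‖wedge f g‖ ≤ ((p ! * q ! : ℝ))⁻¹ * (p + q)! * ‖f‖ * ‖g‖ := by
  refine ContinuousAlternatingMap.opNorm_le_bound _ (by positivity) fun v => ?_
  rw [wedge_apply, norm_mul, Real.norm_of_nonneg (by positivity : (0 : ℝ) ≤ (p ! * q ! : ℝ)⁻¹)]
  have h (σ : Equiv.Perm (Fin (p + q))) : ‖((Equiv.Perm.sign σ : ℤ) : ℝ) *
      (f (v ∘ σ ∘ Fin.castAdd q) * g (v ∘ σ ∘ Fin.natAdd p))‖ ≤ ‖f‖ * ‖g‖ * ∏ i, ‖v i‖ := by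
    have h1 : ‖((Equiv.Perm.sign σ : ℤ) : ℝ)‖ = 1 := by
      rcases Int.units_eq_one_or (Equiv.Perm.sign σ) with h | h <;> simp [h]
    rw [norm_mul, h1, one_mul, norm_mul]
    refine (mul_le_mul (f.le_opNorm _) (g.le_opNorm _) (norm_nonneg _) (by positivity)).trans_eq ?_
    rw [← Equiv.prod_comp σ (fun i => ‖v i‖), Fin.prod_univ_add]
    simp only [Function.comp_apply]
    ring
  refine (mul_le_mul_of_nonneg_left ((norm_sum_le _ _).trans (Finset.sum_le_sum fun σ _ => h σ))
    (by positivity)).trans_eq ?_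
  simp [Fintype.card_perm]
  ring

/-- The wedge product as a continuous bilinear map. -/
def wedgeL (E : Type*) [NormedAddCommGroup E] [NormedSpace ℝ E] (p q : ℕ) :
    AltForm E p →L[ℝ] AltForm E q →L[ℝ] AltForm E (p + q) :=
  LinearMap.mkContinuous₂ (LinearMap.mk₂ ℝ wedge add_wedge smul_wedge wedge_add wedge_smul)
    (((p ! * q ! : ℝ))⁻¹ * (p + q)!) norm_wedge_le

theorem wedgeL_apply {p q : ℕ} (f : AltForm E p) (g : AltForm E q) :
    wedgeL E p q f g = wedge f g := rfl

theorem uncurry_apply {k : ℕ} (L : E →L[ℝ] AltForm E k) (v : Fin (k + 1) → E) :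
    ContinuousAlternatingMap.alternatizeUncurryFin L v = (k ! : ℝ)⁻¹ *
      ∑ σ : Equiv.Perm (Fin (k + 1)), ((Equiv.Perm.sign σ : ℤ) : ℝ) *
        L (v (σ 0)) (v ∘ σ ∘ Fin.succ) := by
  set A := ContinuousAlternatingMap.alternatizeUncurryFin L with hA
  have h1 : ((k + 1)! : ℝ) * A v =
      ∑ σ : Equiv.Perm (Fin (k + 1)), ((Equiv.Perm.sign σ : ℤ) : ℝ) * A (v ∘ σ) := by
    rw [Finset.sum_congr rfl fun σ _ => alternating_sign A v σ]
    simp [Fintype.card_perm]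
  have h2 (i : Fin (k + 1)) : ∑ σ : Equiv.Perm (Fin (k + 1)), ((Equiv.Perm.sign σ : ℤ) : ℝ) *
      ((-1) ^ (i : ℕ) * L (v (σ i)) (i.removeNth (v ∘ σ))) =
      ∑ σ : Equiv.Perm (Fin (k + 1)), ((Equiv.Perm.sign σ : ℤ) : ℝ) *
        L (v (σ 0)) (v ∘ σ ∘ Fin.succ) := by
    refine Fintype.sum_equiv (Equiv.mulRight i.cycleRange.symm) _ _ fun σ => ?_
    have e : v ∘ ⇑(σ * i.cycleRange.symm) ∘ Fin.succ = i.removeNth (v ∘ σ) := by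
      ext j; simp [Fin.removeNth]
    rw [Equiv.coe_mulRight, e, Equiv.Perm.sign_mul]
    simp only [Equiv.Perm.sign_symm, Fin.sign_cycleRange, Equiv.Perm.coe_mul, Function.comp_apply,
      Fin.cycleRange_symm_zero]
    push_cast
    ring
  have h3 : ((k + 1)! : ℝ) * A v = ((k + 1 : ℕ) : ℝ) *
      ∑ σ : Equiv.Perm (Fin (k + 1)), ((Equiv.Perm.sign σ : ℤ) : ℝ) *
        L (v (σ 0)) (v ∘ σ ∘ Fin.succ) := by
    rw [h1]
    have h4 (σ : Equiv.Perm (Fin (k + 1))) : ((Equiv.Perm.sign σ : ℤ) : ℝ) * A (v ∘ σ) =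
        ∑ i : Fin (k + 1), ((Equiv.Perm.sign σ : ℤ) : ℝ) *
          ((-1) ^ (i : ℕ) * L (v (σ i)) (i.removeNth (v ∘ σ))) := by
      rw [← Finset.mul_sum, hA, ContinuousAlternatingMap.alternatizeUncurryFin_apply]
      simp
    rw [Finset.sum_congr rfl fun σ _ => h4 σ, Finset.sum_comm,
      Finset.sum_congr rfl fun i _ => h2 i]
    simp
  rw [Nat.factorial_succ, Nat.cast_mul, mul_assoc] at h3
  have h5 := mul_left_cancel₀ (by positivity) h3
  rw [← h5]
  field_simp

/-- The permutation of `k + 1` letters fixing the first one. -/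
def permSucc {k : ℕ} (τ : Equiv.Perm (Fin k)) : Equiv.Perm (Fin (k + 1)) :=
  Equiv.Perm.decomposeFin.symm (0, τ)

theorem sign_permSucc {k : ℕ} (τ : Equiv.Perm (Fin k)) :
    Equiv.Perm.sign (permSucc τ) = Equiv.Perm.sign τ := by
  simp [permSucc]

@[simp] theorem permSucc_zero {k : ℕ} (τ : Equiv.Perm (Fin k)) : permSucc τ 0 = 0 := by
  simp [permSucc]

@[simp] theorem permSucc_succ {k : ℕ} (τ : Equiv.Perm (Fin k)) (i : Fin k) :
    permSucc τ i.succ = (τ i).succ := by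
  simp [permSucc]

theorem uncurry_wedge_left {p q : ℕ} (L : E →L[ℝ] AltForm E p) (g : AltForm E q) :
    castForm (Nat.add_right_comm p q 1)
      (ContinuousAlternatingMap.alternatizeUncurryFin ((wedgeL E p q).flip g ∘L L)) =
    wedge (ContinuousAlternatingMap.alternatizeUncurryFin L) g := by
  ext w
  rw [castForm_apply, uncurry_apply, wedge_apply]
  set v := w ∘ Fin.cast (Nat.add_right_comm p q 1) with hv
  have key1 := sum_absorb permSucc (sign_permSucc (k := p + q)) (fun σ =>
    L (v (σ 0)) (v ∘ σ ∘ Fin.succ ∘ Fin.castAdd q) * g (v ∘ σ ∘ Fin.succ ∘ Fin.natAdd p))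
  have e1 (σ : Equiv.Perm (Fin (p + q + 1))) (τ : Equiv.Perm (Fin (p + q))) :
      v ∘ ⇑(σ * permSucc τ) ∘ Fin.succ ∘ Fin.castAdd q =
        (v ∘ σ ∘ Fin.succ) ∘ τ ∘ Fin.castAdd q := by ext; simp
  have e2 (σ : Equiv.Perm (Fin (p + q + 1))) (τ : Equiv.Perm (Fin (p + q))) :
      v ∘ ⇑(σ * permSucc τ) ∘ Fin.succ ∘ Fin.natAdd p =
        (v ∘ σ ∘ Fin.succ) ∘ τ ∘ Fin.natAdd p := by ext; simp
  have e0 (σ : Equiv.Perm (Fin (p + q + 1))) (τ : Equiv.Perm (Fin (p + q))) :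
      v ((σ * permSucc τ) 0) = v (σ 0) := by simp
  simp only [e0, e1, e2, Fintype.card_fin] at key1
  have key2 := sum_absorb (permLeft q) (sign_permLeft (p := p + 1) q) (fun σ =>
    L (w (σ (Fin.castAdd q 0))) (w ∘ σ ∘ Fin.castAdd q ∘ Fin.succ) *
      g (w ∘ σ ∘ Fin.natAdd (p + 1)))
  have e3 (σ : Equiv.Perm (Fin (p + 1 + q))) (τ : Equiv.Perm (Fin (p + 1))) :
      w ((σ * permLeft q τ) (Fin.castAdd q 0)) = (w ∘ σ ∘ Fin.castAdd q) (τ 0) := by simp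
  have e4 (σ : Equiv.Perm (Fin (p + 1 + q))) (τ : Equiv.Perm (Fin (p + 1))) :
      w ∘ ⇑(σ * permLeft q τ) ∘ Fin.castAdd q ∘ Fin.succ =
        (w ∘ σ ∘ Fin.castAdd q) ∘ τ ∘ Fin.succ := by ext; simp
  have e5 (σ : Equiv.Perm (Fin (p + 1 + q))) (τ : Equiv.Perm (Fin (p + 1))) :
      w ∘ ⇑(σ * permLeft q τ) ∘ Fin.natAdd (p + 1) = w ∘ σ ∘ Fin.natAdd (p + 1) := by
    ext; simp
  simp only [e3, e4, e5, Fintype.card_fin] at key2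
  have key3 : ∑ σ : Equiv.Perm (Fin (p + q + 1)), ((Equiv.Perm.sign σ : ℤ) : ℝ) *
      (L (v (σ 0)) (v ∘ σ ∘ Fin.succ ∘ Fin.castAdd q) * g (v ∘ σ ∘ Fin.succ ∘ Fin.natAdd p)) =
      ∑ σ : Equiv.Perm (Fin (p + 1 + q)), ((Equiv.Perm.sign σ : ℤ) : ℝ) *
      (L (w (σ (Fin.castAdd q 0))) (w ∘ σ ∘ Fin.castAdd q ∘ Fin.succ) *
        g (w ∘ σ ∘ Fin.natAdd (p + 1))) := by
    refine Fintype.sum_equiv (finCongr (Nat.add_right_comm p q 1)).permCongr _ _ fun σ => ?_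
    rw [Equiv.Perm.sign_permCongr]
    congr 1
    have f1 : v (σ 0) =
        w ((finCongr (Nat.add_right_comm p q 1)).permCongr σ (Fin.castAdd q 0)) := by
      simp [hv, Equiv.permCongr_apply, Fin.cast]
    have f2 : v ∘ σ ∘ Fin.succ ∘ Fin.castAdd q =
        w ∘ (finCongr (Nat.add_right_comm p q 1)).permCongr σ ∘ Fin.castAdd q ∘ Fin.succ := by
      ext i; simp [hv, Equiv.permCongr_apply, Fin.castAdd, Fin.castLE, Fin.cast, Fin.succ]
    have f3 : v ∘ σ ∘ Fin.succ ∘ Fin.natAdd p =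
        w ∘ (finCongr (Nat.add_right_comm p q 1)).permCongr σ ∘ Fin.natAdd (p + 1) := by
      ext i
      simp [hv, Equiv.permCongr_apply, Fin.natAdd, Fin.cast, Fin.succ, Nat.add_right_comm]
    rw [f1, f2, f3]
  have hne1 : ((p + q)! : ℝ) ≠ 0 := by positivity
  have hne2 : ((p + 1)! : ℝ) ≠ 0 := by positivity
  rw [← key3] at key2
  set S := ∑ σ : Equiv.Perm (Fin (p + q + 1)), ((Equiv.Perm.sign σ : ℤ) : ℝ) *
      (L (v (σ 0)) (v ∘ σ ∘ Fin.succ ∘ Fin.castAdd q) * g (v ∘ σ ∘ Fin.succ ∘ Fin.natAdd p))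
  have l1 : ∑ σ : Equiv.Perm (Fin (p + q + 1)), ((Equiv.Perm.sign σ : ℤ) : ℝ) *
      ((wedgeL E p q).flip g ∘L L) (v (σ 0)) (v ∘ σ ∘ Fin.succ) =
      ((p ! * q ! : ℝ))⁻¹ * ((p + q)! * S) := by
    rw [← key1, Finset.mul_sum]
    refine Finset.sum_congr rfl fun σ _ => ?_
    simp only [ContinuousLinearMap.comp_apply, ContinuousLinearMap.flip_apply, wedgeL_apply,
      wedge_apply]
    ring
  have l2 : ∑ σ : Equiv.Perm (Fin (p + 1 + q)), ((Equiv.Perm.sign σ : ℤ) : ℝ) *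
      (ContinuousAlternatingMap.alternatizeUncurryFin L (w ∘ σ ∘ Fin.castAdd q) *
        g (w ∘ σ ∘ Fin.natAdd (p + 1))) = (p ! : ℝ)⁻¹ * ((p + 1)! * S) := by
    rw [← key2, Finset.mul_sum]
    refine Finset.sum_congr rfl fun σ _ => ?_
    simp only [uncurry_apply, Finset.mul_sum, Finset.sum_mul]
    refine Finset.sum_congr rfl fun τ _ => ?_
    simp only [Function.comp_def]
    ring
  rw [l1, l2]
  field_simp

theorem uncurry_wedge_right {p q : ℕ} (f : AltForm E p) (L : E →L[ℝ] AltForm E q) :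
    ContinuousAlternatingMap.alternatizeUncurryFin (wedgeL E p q f ∘L L) =
    (-1 : ℝ) ^ p • wedge f (ContinuousAlternatingMap.alternatizeUncurryFin L) := by
  ext v
  rw [ContinuousAlternatingMap.smul_apply, uncurry_apply]
  erw [wedge_apply]
  have key1 := sum_absorb permSucc (sign_permSucc (k := p + q)) (fun σ =>
    f (v ∘ σ ∘ Fin.succ ∘ Fin.castAdd q) * L (v (σ 0)) (v ∘ σ ∘ Fin.succ ∘ Fin.natAdd p))
  have e1 (σ : Equiv.Perm (Fin (p + q + 1))) (τ : Equiv.Perm (Fin (p + q))) :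
      v ∘ ⇑(σ * permSucc τ) ∘ Fin.succ ∘ Fin.castAdd q =
        (v ∘ σ ∘ Fin.succ) ∘ τ ∘ Fin.castAdd q := by ext; simp
  have e2 (σ : Equiv.Perm (Fin (p + q + 1))) (τ : Equiv.Perm (Fin (p + q))) :
      v ∘ ⇑(σ * permSucc τ) ∘ Fin.succ ∘ Fin.natAdd p =
        (v ∘ σ ∘ Fin.succ) ∘ τ ∘ Fin.natAdd p := by ext; simp
  have e0 (σ : Equiv.Perm (Fin (p + q + 1))) (τ : Equiv.Perm (Fin (p + q))) :
      v ((σ * permSucc τ) 0) = v (σ 0) := by simp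
  simp only [e0, e1, e2, Fintype.card_fin] at key1
  have key2 := sum_absorb (permRight p) (sign_permRight (q := q + 1) p) (fun σ =>
    f (v ∘ σ ∘ Fin.castAdd (q + 1)) *
      L (v (σ (Fin.natAdd p 0))) (v ∘ σ ∘ Fin.natAdd p ∘ Fin.succ))
  have e3 (σ : Equiv.Perm (Fin (p + (q + 1)))) (τ : Equiv.Perm (Fin (q + 1))) :
      v ((σ * permRight p τ) (Fin.natAdd p 0)) = (v ∘ σ ∘ Fin.natAdd p) (τ 0) := by simp
  have e4 (σ : Equiv.Perm (Fin (p + (q + 1)))) (τ : Equiv.Perm (Fin (q + 1))) :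
      v ∘ ⇑(σ * permRight p τ) ∘ Fin.natAdd p ∘ Fin.succ =
        (v ∘ σ ∘ Fin.natAdd p) ∘ τ ∘ Fin.succ := by ext; simp
  have e5 (σ : Equiv.Perm (Fin (p + (q + 1)))) (τ : Equiv.Perm (Fin (q + 1))) :
      v ∘ ⇑(σ * permRight p τ) ∘ Fin.castAdd (q + 1) = v ∘ σ ∘ Fin.castAdd (q + 1) := by
    ext; simp
  simp only [e3, e4, e5, Fintype.card_fin] at key2
  have key3 : ∑ σ : Equiv.Perm (Fin (p + q + 1)), ((Equiv.Perm.sign σ : ℤ) : ℝ) *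
      (f (v ∘ σ ∘ Fin.succ ∘ Fin.castAdd q) * L (v (σ 0)) (v ∘ σ ∘ Fin.succ ∘ Fin.natAdd p)) =
      (-1) ^ p * ∑ σ : Equiv.Perm (Fin (p + (q + 1))), ((Equiv.Perm.sign σ : ℤ) : ℝ) *
      (f (v ∘ σ ∘ Fin.castAdd (q + 1)) *
        L (v (σ (Fin.natAdd p 0))) (v ∘ σ ∘ Fin.natAdd p ∘ Fin.succ)) := by
    rw [Finset.mul_sum]
    set c : Fin (p + q + 1) := ⟨p, by omega⟩ with hc
    refine Fintype.sum_equiv (Equiv.mulRight c.cycleRange) _ _ fun σ => ?_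
    have hs : c.cycleRange (Fin.natAdd (m := q + 1) p 0) = 0 := by
      have : (Fin.natAdd (m := q + 1) p 0) = c := by ext; simp [hc]
      rw [this]; exact Fin.cycleRange_self c
    have f1 : v ((Equiv.mulRight c.cycleRange) σ (Fin.natAdd (m := q + 1) p 0)) = v (σ 0) := by
      simp only [Equiv.coe_mulRight, Equiv.Perm.coe_mul, Function.comp_apply]
      exact congrArg (fun i => v (σ i)) hs
    have f2 : v ∘ ⇑((Equiv.mulRight c.cycleRange) σ) ∘ Fin.castAdd (q + 1) =
        v ∘ σ ∘ Fin.succ ∘ Fin.castAdd q := by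
      ext i
      simp only [Equiv.coe_mulRight, Equiv.Perm.coe_mul, Function.comp_apply]
      refine congrArg (fun i => v (σ i)) ?_
      have : Fin.castAdd (q + 1) i = c.succAbove (Fin.castAdd q i) := by
        rw [Fin.succAbove_of_castSucc_lt _ _ (by simp [Fin.lt_def, hc])]
        rfl
      rw [this]; exact Fin.cycleRange_succAbove c _
    have f3 : v ∘ ⇑((Equiv.mulRight c.cycleRange) σ) ∘ Fin.natAdd p ∘ Fin.succ =
        v ∘ σ ∘ Fin.succ ∘ Fin.natAdd p := by
      ext i
      simp only [Equiv.coe_mulRight, Equiv.Perm.coe_mul, Function.comp_apply]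
      refine congrArg (fun i => v (σ i)) ?_
      have : Fin.natAdd p i.succ = c.succAbove (Fin.natAdd p i) := by
        rw [Fin.succAbove_of_le_castSucc _ _ (by simp [Fin.le_def, hc])]
        rfl
      rw [this]; exact Fin.cycleRange_succAbove c _
    rw [f1, f2, f3, Equiv.coe_mulRight, Equiv.Perm.sign_mul, Fin.sign_cycleRange]
    have hsq : ((-1 : ℝ) ^ p) * (-1) ^ p = 1 := by rw [← mul_pow]; simp
    push_cast
    simp only [hc]
    linear_combination (-(Equiv.Perm.sign σ : ℤ) * (f (v ∘ σ ∘ Fin.succ ∘ Fin.castAdd q) *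
      L (v (σ 0)) (v ∘ σ ∘ Fin.succ ∘ Fin.natAdd p)) : ℝ) * hsq
  set S := ∑ σ : Equiv.Perm (Fin (p + (q + 1))), ((Equiv.Perm.sign σ : ℤ) : ℝ) *
      (f (v ∘ σ ∘ Fin.castAdd (q + 1)) *
        L (v (σ (Fin.natAdd p 0))) (v ∘ σ ∘ Fin.natAdd p ∘ Fin.succ))
  have l1 : ∑ σ : Equiv.Perm (Fin (p + q + 1)), ((Equiv.Perm.sign σ : ℤ) : ℝ) *
      (wedgeL E p q f ∘L L) (v (σ 0)) (v ∘ σ ∘ Fin.succ) =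
      ((p ! * q ! : ℝ))⁻¹ * ((p + q)! * ((-1) ^ p * S)) := by
    rw [← key3, ← key1, Finset.mul_sum]
    refine Finset.sum_congr rfl fun σ _ => ?_
    simp only [ContinuousLinearMap.comp_apply, wedgeL_apply, wedge_apply]
    ring
  have l2 : ∑ σ : Equiv.Perm (Fin (p + (q + 1))), ((Equiv.Perm.sign σ : ℤ) : ℝ) *
      (f (v ∘ σ ∘ Fin.castAdd (q + 1)) *
        ContinuousAlternatingMap.alternatizeUncurryFin L (v ∘ σ ∘ Fin.natAdd p)) =
      (q ! : ℝ)⁻¹ * ((q + 1)! * S) := by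
    rw [← key2, Finset.mul_sum]
    refine Finset.sum_congr rfl fun σ _ => ?_
    simp only [uncurry_apply, Finset.mul_sum]
    refine Finset.sum_congr rfl fun τ _ => ?_
    simp only [Function.comp_def]
    ring
  rw [l1, l2, smul_eq_mul]
  field_simp

/-- The Leibniz rule for the exterior derivative on a normed space. -/
theorem extDeriv_wedge {p q : ℕ} {a : E → AltForm E p} {b : E → AltForm E q} {x : E}
    (ha : DifferentiableAt ℝ a x) (hb : DifferentiableAt ℝ b x) :
    extDeriv (fun y => wedge (a y) (b y)) x =
      castForm (Nat.add_right_comm p 1 q) (wedge (extDeriv a x) (b x)) +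
      (-1 : ℝ) ^ p • wedge (a x) (extDeriv b x) := by
  have h := ((wedgeL E p q).hasFDerivAt_of_bilinear ha.hasFDerivAt hb.hasFDerivAt).fderiv
  simp only [wedgeL_apply] at h
  have e1 : (wedgeL E p q).precompR E (a x) (fderiv ℝ b x) = wedgeL E p q (a x) ∘L fderiv ℝ b x :=
    rfl
  have e2 : (wedgeL E p q).precompL E (fderiv ℝ a x) (b x) =
    (wedgeL E p q).flip (b x) ∘L fderiv ℝ a x := rfl
  rw [e1, e2] at h
  rw [extDeriv, h, ContinuousAlternatingMap.alternatizeUncurryFin_add, uncurry_wedge_right,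
    extDeriv, ← uncurry_wedge_left]
  exact add_comm ((-1 : ℝ) ^ p • wedge (a x) (extDeriv b x) : AltForm E (p + q + 1)) _

end Leibniz

section Forms

variable {E : Type*} [NormedAddCommGroup E] [NormedSpace ℝ E]
  {M : Type*} [TopologicalSpace M] [ChartedSpace E M]
  {F : Type*} [NormedAddCommGroup F] [NormedSpace ℝ F]

/-- Not necessarily smooth `F`-valued `k`-forms on the manifold `M`. -/
abbrev FormField (E : Type*) [NormedAddCommGroup E] [NormedSpace ℝ E]
    (M : Type*) [TopologicalSpace M] [ChartedSpace E M]
    (F : Type*) [NormedAddCommGroup F] [NormedSpace ℝ F] (k : ℕ) : Type _ :=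
  ∀ x : M, TangentSpace 𝓘(ℝ, E) x [⋀^Fin k]→L[ℝ] F

/-- The differential at `y` of the inverse of the preferred chart around `c`. -/
def chartSymmDeriv (c : M) (y : E) :
    E →L[ℝ] TangentSpace 𝓘(ℝ, E) ((chartAt E c).symm y) :=
  (mfderiv 𝓘(ℝ, E) 𝓘(ℝ, E) (chartAt E c).symm y).comp
    (NormedSpace.fromTangentSpace (𝕜 := ℝ) y).symm.toContinuousLinearMap

/-- The differential at `x` of the preferred chart around `c`. -/
def chartDeriv (c x : M) : TangentSpace 𝓘(ℝ, E) x →L[ℝ] E :=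
  (NormedSpace.fromTangentSpace (𝕜 := ℝ) (chartAt E c x)).toContinuousLinearMap.comp
    (mfderiv 𝓘(ℝ, E) 𝓘(ℝ, E) (chartAt E c) x)

/-- The expression of a form in the preferred chart around `c`, that is, its pullback by the
inverse of this chart; meaningful on the target of the chart. -/
def FormField.inChart {k : ℕ} (w : FormField E M F k) (c : M) (y : E) : E [⋀^Fin k]→L[ℝ] F :=
  (w ((chartAt E c).symm y)).compContinuousLinearMap (chartSymmDeriv c y)

/-- The space `Ωᵏ(M; F)` of smooth `F`-valued differential `k`-forms on `M`. -/
def DiffForm (E : Type*) [NormedAddCommGroup E] [NormedSpace ℝ E]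
    (M : Type*) [TopologicalSpace M] [ChartedSpace E M]
    (F : Type*) [NormedAddCommGroup F] [NormedSpace ℝ F] (k : ℕ) :
    Submodule ℝ (FormField E M F k) where
  carrier := {w | ∀ c : M, ContDiffOn ℝ ∞ (FormField.inChart w c) (chartAt E c).target}
  add_mem' ha hb c := (ha c).add (hb c)
  zero_mem' c := by
    have h : FormField.inChart (0 : FormField E M F k) c = fun _ => 0 := by
      ext y v
      rfl
    change ContDiffOn ℝ ∞ (FormField.inChart (0 : FormField E M F k) c) _
    rw [h]
    exact contDiffOn_const
  smul_mem' r _ ha c := (ha c).const_smul r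

/-- The exterior derivative of a form at `x`, computed in the preferred chart around `x`. -/
def FormField.extD {k : ℕ} (w : FormField E M F k) : FormField E M F (k + 1) := fun x =>
  (extDeriv (FormField.inChart w x) (chartAt E x x)).compContinuousLinearMap (chartDeriv x x)

theorem two_le_smooth : minSmoothness ℝ 2 ≤ ∞ := by
  rw [minSmoothness_of_isRCLikeNormedField]
  exact WithTop.coe_le_coe.2 (le_top : (2 : ℕ∞) ≤ ⊤)

theorem chartSymmDeriv_change [IsManifold 𝓘(ℝ, E) ∞ M] (c c' : M) {y : E}
    (hy : y ∈ (chartAt E c).target) (hy' : (chartAt E c).symm y ∈ (chartAt E c').source) :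
    fderiv ℝ (chartAt E c' ∘ (chartAt E c).symm) y =
      (chartDeriv c' ((chartAt E c).symm y)).comp (chartSymmDeriv c y) := by
  have h1 := (mdifferentiable_chart (I := 𝓘(ℝ, E)) c').mdifferentiableAt hy'
  have h2 := (mdifferentiable_chart (I := 𝓘(ℝ, E)) c).mdifferentiableAt_symm hy
  have h := mfderiv_comp y h1 h2
  rw [mfderiv_eq_fderiv] at h
  ext v
  exact congrArg (fun L => L v) h

theorem chartSymmDeriv_comp_chartDeriv [IsManifold 𝓘(ℝ, E) ∞ M] (c' : M) {y : E}
    (hy : y ∈ (chartAt E c').target) (v : E) :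
    chartDeriv c' ((chartAt E c').symm y) (chartSymmDeriv c' y v) = v := by
  have h := (mdifferentiable_chart (I := 𝓘(ℝ, E)) c').comp_symm_deriv hy
  exact congrArg (fun L => L v) h

theorem chartDeriv_comp_chartSymmDeriv [IsManifold 𝓘(ℝ, E) ∞ M] (c' x : M)
    (hx : x ∈ (chartAt E c').source) (v : TangentSpace 𝓘(ℝ, E) x) :
    chartSymmDeriv c' (chartAt E c' x) (chartDeriv c' x v) = (v : E) := by
  have h := (mdifferentiable_chart (I := 𝓘(ℝ, E)) c').symm_comp_deriv hx
  exact congrArg (fun L => L v) h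

theorem inChart_change [IsManifold 𝓘(ℝ, E) ∞ M] {k : ℕ} (w : FormField E M F k) (c c' : M) {y : E}
    (hy : y ∈ (chartAt E c).target) (hy' : (chartAt E c).symm y ∈ (chartAt E c').source) :
    w.inChart c y = (w.inChart c' ((chartAt E c' ∘ (chartAt E c).symm) y)).compContinuousLinearMap
      (fderiv ℝ (chartAt E c' ∘ (chartAt E c).symm) y) := by
  have hw (x x' : M) (h : x' = x) (v : Fin k → E) : w x' v = w x v := by subst h; rfl
  ext v
  rw [chartSymmDeriv_change c c' hy hy']
  refine Eq.trans ?_ (hw _ _ ((chartAt E c').left_inv hy') _).symm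
  refine congrArg (w ((chartAt E c).symm y)) ?_
  ext i
  exact (chartDeriv_comp_chartSymmDeriv c' _ hy' _).symm

theorem inChart_extD [IsManifold 𝓘(ℝ, E) ∞ M] {k : ℕ} {w : FormField E M F k}
    (hw : w ∈ DiffForm E M F k) (c : M) {y : E} (hy : y ∈ (chartAt E c).target) :
    w.extD.inChart c y = extDeriv (w.inChart c) y := by
  set x := (chartAt E c).symm y with hx
  have hxs : x ∈ (chartAt E x).source := mem_chart_source E x
  have hev : w.inChart c =ᶠ[nhds y] fun z =>
      (w.inChart x ((chartAt E x ∘ (chartAt E c).symm) z)).compContinuousLinearMap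
        (fderiv ℝ (chartAt E x ∘ (chartAt E c).symm) z) := by
    have h1 : ∀ᶠ z in nhds y, z ∈ (chartAt E c).target :=
      (chartAt E c).open_target.mem_nhds hy
    have h2 : ∀ᶠ z in nhds y, (chartAt E c).symm z ∈ (chartAt E x).source :=
      ((chartAt E c).continuousAt_symm hy).eventually
        ((chartAt E x).open_source.mem_nhds hxs)
    filter_upwards [h1, h2] with z hz hz'
    exact inChart_change w c x hz hz'
  have hdiff : DifferentiableAt ℝ (w.inChart x) ((chartAt E x ∘ (chartAt E c).symm) y) :=
    ((hw x).contDiffAt ((chartAt E x).open_target.mem_nhds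
      ((chartAt E x).map_source hxs))).differentiableAt (by simp)
  have hτ : ContDiffAt ℝ ∞ (chartAt E x ∘ (chartAt E c).symm) y := by
    have h1 : ContMDiffAt 𝓘(ℝ, E) 𝓘(ℝ, E) ∞ (chartAt E c).symm y :=
      (contMDiffOn_chart_symm (I := 𝓘(ℝ, E)) (x := c)).contMDiffAt
        ((chartAt E c).open_target.mem_nhds hy)
    have h2 : ContMDiffAt 𝓘(ℝ, E) 𝓘(ℝ, E) ∞ (chartAt E x) ((chartAt E c).symm y) :=
      (contMDiffOn_chart (I := 𝓘(ℝ, E)) (x := x)).contMDiffAt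
        ((chartAt E x).open_source.mem_nhds hxs)
    exact (h2.comp y h1).contDiffAt
  rw [hev.extDeriv_eq, extDeriv_pullback hdiff hτ two_le_smooth,
    chartSymmDeriv_change c x hy hxs]
  rfl

theorem contDiffOn_extDeriv {k : ℕ} {w : E → E [⋀^Fin k]→L[ℝ] F} {s : Set E} (hs : IsOpen s)
    (hw : ContDiffOn ℝ ∞ w s) : ContDiffOn ℝ ∞ (extDeriv w) s := by
  have h1 : ContDiffOn ℝ ∞ (fderiv ℝ w) s := hw.fderiv_of_isOpen hs (by simp)
  exact (ContinuousAlternatingMap.alternatizeUncurryFinCLM ℝ E F).contDiff.comp_contDiffOn h1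

theorem extD_mem [IsManifold 𝓘(ℝ, E) ∞ M] {k : ℕ} {w : FormField E M F k}
    (hw : w ∈ DiffForm E M F k) : w.extD ∈ DiffForm E M F (k + 1) := fun c =>
  (contDiffOn_extDeriv (chartAt E c).open_target (hw c)).congr fun _ hy => inChart_extD hw c hy

theorem differentiableAt_inChart {k : ℕ} {w : FormField E M F k} (hw : w ∈ DiffForm E M F k)
    (x : M) : DifferentiableAt ℝ (w.inChart x) (chartAt E x x) :=
  ((hw x).contDiffAt ((chartAt E x).open_target.mem_nhds
    ((chartAt E x).map_source (mem_chart_source E x)))).differentiableAt (by simp)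

/-- The exterior derivative `d : Ωᵏ(M; F) → Ωᵏ⁺¹(M; F)`. -/
def DiffForm.d [IsManifold 𝓘(ℝ, E) ∞ M] {k : ℕ} :
    DiffForm E M F k →ₗ[ℝ] DiffForm E M F (k + 1) where
  toFun w := ⟨FormField.extD w.1, extD_mem w.2⟩
  map_add' a b := by
    ext x v
    have h := extDeriv_add (differentiableAt_inChart a.2 x) (differentiableAt_inChart b.2 x)
    exact congrArg (fun L => L fun i => chartDeriv x x (v i)) h
  map_smul' r a := by
    ext x v
    have h := extDeriv_smul (x := chartAt E x x) r (FormField.inChart a.1 x)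
    exact congrArg (fun L => L fun i => chartDeriv x x (v i)) h

theorem DiffForm.d_d [IsManifold 𝓘(ℝ, E) ∞ M] {k : ℕ} (w : DiffForm E M F k) :
    DiffForm.d (DiffForm.d w) = 0 := by
  ext x v
  have hx := (chartAt E x).map_source (mem_chart_source E x)
  have hev : FormField.inChart (FormField.extD w.1) x =ᶠ[nhds (chartAt E x x)]
      extDeriv (FormField.inChart w.1 x) := by
    filter_upwards [(chartAt E x).open_target.mem_nhds hx] with y hy
    exact inChart_extD w.2 x hy
  have h := extDeriv_extDeriv_apply
    ((w.2 x).contDiffAt ((chartAt E x).open_target.mem_nhds hx)) (r := ∞) two_le_smooth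
  rw [← hev.extDeriv_eq] at h
  exact congrArg (fun L => L fun i => chartDeriv x x (v i)) h

end Forms

section Algebra

variable {E : Type*} [NormedAddCommGroup E] [NormedSpace ℝ E]
  {M : Type*} [TopologicalSpace M] [ChartedSpace E M]

/-- The space `Ωᵏ(M)` of smooth real-valued differential `k`-forms on `M`. -/
def RForm (E : Type*) [NormedAddCommGroup E] [NormedSpace ℝ E]
    (M : Type*) [TopologicalSpace M] [ChartedSpace E M] (k : ℕ) : Type _ :=
  DiffForm E M ℝ k

instance (k : ℕ) : AddCommGroup (RForm E M k) := inferInstanceAs (AddCommGroup (DiffForm E M ℝ k))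

instance (k : ℕ) : Module ℝ (RForm E M k) := inferInstanceAs (Module ℝ (DiffForm E M ℝ k))

/-- The pointwise wedge product `Ωᵖ(M) × Ω^q(M) → Ω^{p+q}(M)`. -/
def RForm.wedge {p q : ℕ} (a : RForm E M p) (b : RForm E M q) : RForm E M (p + q) :=
  ⟨fun x => GStr.wedge (a.1 x) (b.1 x), fun c => by
    have h : FormField.inChart (fun x => GStr.wedge (a.1 x) (b.1 x)) c = fun y =>
        wedgeL E p q (FormField.inChart a.1 c y) (FormField.inChart b.1 c y) := by
      funext y
      exact wedge_comp _ _ _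
    rw [h]
    exact ((wedgeL E p q).contDiff.comp_contDiffOn (a.2 c)).clm_apply (b.2 c)⟩

/-- The constant function `1`, as a `0`-form. -/
def RForm.one : RForm E M 0 :=
  ⟨fun _ => oneForm, fun c => by
    have h : FormField.inChart (fun x : M => oneForm (T := TangentSpace 𝓘(ℝ, E) x)) c =
        fun _ => oneForm := by
      funext y
      ext v
      rfl
    rw [h]
    exact contDiffOn_const⟩

/-- Reindexing a form along an equality of degrees. -/
def RForm.cast {p q : ℕ} (h : p = q) (a : RForm E M p) : RForm E M q := h ▸ a

theorem RForm.cast_apply {p q : ℕ} (h : p = q) (a : RForm E M p) (x : M) :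
    (RForm.cast h a).1 x = castForm h (a.1 x) := by
  subst h
  rfl

theorem RForm.sigma_cast {p q : ℕ} (h : p = q) (a : RForm E M p) :
    (⟨p, a⟩ : GradedMonoid (RForm E M)) = ⟨q, RForm.cast h a⟩ := by
  subst h
  rfl

theorem RForm.ext {k : ℕ} {a b : RForm E M k} (h : ∀ x, a.1 x = b.1 x) : a = b :=
  Subtype.ext (funext h)

theorem RForm.wedge_assoc {p q r : ℕ} (a : RForm E M p) (b : RForm E M q) (c : RForm E M r) :
    RForm.cast (add_assoc p q r) (RForm.wedge (RForm.wedge a b) c) =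
      RForm.wedge a (RForm.wedge b c) :=
  RForm.ext fun x => by
    rw [RForm.cast_apply]
    exact GStr.wedge_assoc _ _ _

theorem RForm.one_wedge {p : ℕ} (a : RForm E M p) :
    RForm.cast (zero_add p) (RForm.wedge RForm.one a) = a :=
  RForm.ext fun x => by
    rw [RForm.cast_apply]
    exact GStr.one_wedge _

theorem RForm.wedge_one {p : ℕ} (a : RForm E M p) : RForm.wedge a RForm.one = a :=
  RForm.ext fun _ => GStr.wedge_one _

theorem RForm.smul_wedge {p q : ℕ} (c : ℝ) (a : RForm E M p) (b : RForm E M q) :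
    RForm.wedge (c • a) b = c • RForm.wedge a b :=
  RForm.ext fun _ => GStr.smul_wedge _ _ _

theorem RForm.wedge_smul {p q : ℕ} (c : ℝ) (a : RForm E M p) (b : RForm E M q) :
    RForm.wedge a (c • b) = c • RForm.wedge a b :=
  RForm.ext fun _ => GStr.wedge_smul _ _ _

instance : GradedMonoid.GOne (RForm E M) where
  one := RForm.one

instance : GradedMonoid.GMul (RForm E M) where
  mul a b := RForm.wedge a b

/-- `Ω(M) = ⨁ₖ Ωᵏ(M)` is a graded ring under the wedge product. -/
instance : DirectSum.GRing (RForm E M) where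
  toGMonoid :=
    { one_mul := fun ⟨p, f⟩ => (RForm.sigma_cast (zero_add p) (RForm.wedge RForm.one f)).trans
        (congrArg (Sigma.mk p) (RForm.one_wedge f))
      mul_one := fun ⟨p, f⟩ => congrArg (Sigma.mk p) (RForm.wedge_one f)
      mul_assoc := fun ⟨p, f⟩ ⟨q, g⟩ ⟨r, h⟩ =>
        (RForm.sigma_cast (add_assoc p q r) (RForm.wedge (RForm.wedge f g) h)).trans
          (congrArg (Sigma.mk (p + (q + r))) (RForm.wedge_assoc f g h)) }
  mul_zero _ := RForm.ext fun _ => wedge_zero _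
  zero_mul _ := RForm.ext fun _ => zero_wedge _
  mul_add _ _ _ := RForm.ext fun _ => wedge_add _ _ _
  add_mul _ _ _ := RForm.ext fun _ => add_wedge _ _ _
  natCast n := (n : ℝ) • RForm.one
  natCast_zero := by simp
  natCast_succ n := by
    rw [Nat.cast_succ, add_smul, one_smul]
    rfl
  intCast n := (n : ℝ) • RForm.one
  intCast_ofNat n := by simp
  intCast_negSucc_ofNat n := by
    rw [Int.cast_negSucc, ← neg_smul ((n + 1 : ℕ) : ℝ) (RForm.one (E := E) (M := M))]

/-- The graded ring `Ω(M)` is a real algebra. -/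
instance : DirectSum.GAlgebra ℝ (RForm E M) where
  toFun :=
    { toFun := fun c => c • RForm.one
      map_zero' := zero_smul _ _
      map_add' := fun c d => add_smul _ _ _ }
  map_one := one_smul _ _
  map_mul c d := by
    refine Eq.symm (congrArg (Sigma.mk 0) ((RForm.smul_wedge c RForm.one (d • RForm.one)).trans
      ((congrArg (c • ·) ((RForm.wedge_smul d RForm.one RForm.one).trans
        (congrArg (d • ·) (RForm.wedge_one RForm.one)))).trans (smul_smul c d _))))
  commutes := fun c ⟨p, f⟩ => by
    refine (RForm.sigma_cast (zero_add p) (RForm.wedge (c • RForm.one) f)).trans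
      (congrArg (Sigma.mk p) ?_)
    refine Eq.trans (b := c • f) ?_ ?_
    · refine Eq.trans ?_ (congrArg (c • ·) (RForm.one_wedge f))
      exact RForm.ext fun x => by
        rw [RForm.cast_apply, RForm.smul_wedge]
        change _ = c • (RForm.cast _ _).1 x
        rw [RForm.cast_apply]
        rfl
    · exact ((RForm.wedge_smul c f RForm.one).trans
        (congrArg (c • ·) (RForm.wedge_one f))).symm
  smul_def := fun c ⟨p, f⟩ => by
    refine Eq.symm ((RForm.sigma_cast (zero_add p) (RForm.wedge (c • RForm.one) f)).trans
      (congrArg (Sigma.mk p) ?_))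
    refine Eq.trans ?_ (congrArg (c • ·) (RForm.one_wedge f))
    exact RForm.ext fun x => by
      rw [RForm.cast_apply, RForm.smul_wedge]
      change _ = c • (RForm.cast _ _).1 x
      rw [RForm.cast_apply]
      rfl

/-- The algebra `Ω(M) = ⨁ₖ Ωᵏ(M)` of differential forms on `M`. -/
abbrev Omega (E : Type*) [NormedAddCommGroup E] [NormedSpace ℝ E]
    (M : Type*) [TopologicalSpace M] [ChartedSpace E M] : Type _ :=
  ⨁ k : ℕ, RForm E M k

/-- The sign operator `a ↦ (-1)ᵏ a` for `a ∈ Ωᵏ(M)`. -/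
def Omega.signOp : Omega E M →ₗ[ℝ] Omega E M :=
  DirectSum.toModule ℝ ℕ _ fun k => (-1 : ℝ) ^ k • DirectSum.lof ℝ ℕ (RForm E M) k

theorem Omega.signOp_of {k : ℕ} (a : RForm E M k) :
    Omega.signOp (DirectSum.of (RForm E M) k a) = (-1 : ℝ) ^ k • DirectSum.of (RForm E M) k a :=
  DirectSum.toModule_lof ℝ k a

theorem RForm.of_cast {p q : ℕ} (h : p = q) (a : RForm E M p) :
    DirectSum.of (RForm E M) q (RForm.cast h a) = DirectSum.of (RForm E M) p a := by
  subst h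
  rfl

theorem Omega.of_smul {k : ℕ} (c : ℝ) (a : RForm E M k) :
    DirectSum.of (RForm E M) k (c • a) = c • DirectSum.of (RForm E M) k a :=
  map_smul (DirectSum.lof ℝ ℕ (RForm E M) k) c a

theorem Omega.signOp_signOp (a : Omega E M) : Omega.signOp (Omega.signOp a) = a := by
  induction a using DirectSum.induction_on with
  | zero => simp
  | of k a =>
    rw [Omega.signOp_of, map_smul, Omega.signOp_of, smul_smul, ← mul_pow]
    simp
  | add a b ha hb => rw [map_add, map_add, ha, hb]

variable [IsManifold 𝓘(ℝ, E) ∞ M]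

/-- The exterior derivative `d : Ωᵏ(M) → Ωᵏ⁺¹(M)`. -/
def RForm.d {k : ℕ} : RForm E M k →ₗ[ℝ] RForm E M (k + 1) := DiffForm.d (F := ℝ)

theorem RForm.d_d {k : ℕ} (w : RForm E M k) : RForm.d (RForm.d w) = 0 := DiffForm.d_d (F := ℝ) w

theorem RForm.d_wedge {p q : ℕ} (a : RForm E M p) (b : RForm E M q) :
    RForm.d (RForm.wedge a b) =
      RForm.cast (Nat.add_right_comm p 1 q) (RForm.wedge (RForm.d a) b) +
      (-1 : ℝ) ^ p • RForm.wedge a (RForm.d b) := by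
  refine RForm.ext fun x => ?_
  have h1 : FormField.inChart (RForm.wedge a b).1 x = fun y =>
      GStr.wedge (FormField.inChart a.1 x y) (FormField.inChart b.1 x y) := by
    funext y
    exact wedge_comp _ _ _
  have h2 := extDeriv_wedge (differentiableAt_inChart a.2 x) (differentiableAt_inChart b.2 x)
  rw [← h1] at h2
  have h3 : ∀ {k : ℕ} (w : FormField E M ℝ k), FormField.inChart w x (chartAt E x x) =
      (w ((chartAt E x).symm (chartAt E x x))).compContinuousLinearMap
        (chartSymmDeriv x (chartAt E x x)) := fun _ => rfl
  have hw {k : ℕ} (w : FormField E M ℝ k) (x x' : M) (h : x' = x) (v : Fin k → E) :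
    w x' v = w x v := by subst h; rfl
  have h4 {k : ℕ} (w : FormField E M ℝ k) :
      (FormField.inChart w x (chartAt E x x)).compContinuousLinearMap (chartDeriv x x) = w x := by
    ext v
    refine (hw w _ _ ((chartAt E x).left_inv (mem_chart_source E x)) _).trans ?_
    refine congrArg (w x) ?_
    ext i
    exact chartDeriv_comp_chartSymmDeriv x x (mem_chart_source E x) _
  change (extDeriv (FormField.inChart (RForm.wedge a b).1 x) (chartAt E x x)).compContinuousLinearMap
      (chartDeriv x x) = (RForm.cast (Nat.add_right_comm p 1 q) (RForm.wedge (RForm.d a) b)).1 x +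
      (-1 : ℝ) ^ p • GStr.wedge (a.1 x) ((RForm.d b).1 x)
  rw [h2, RForm.cast_apply]
  refine Eq.trans (b := castForm (Nat.add_right_comm p 1 q)
      ((GStr.wedge (extDeriv (FormField.inChart a.1 x) (chartAt E x x))
        (FormField.inChart b.1 x (chartAt E x x))).compContinuousLinearMap (chartDeriv x x)) +
      (-1 : ℝ) ^ p • (GStr.wedge (FormField.inChart a.1 x (chartAt E x x))
        (extDeriv (FormField.inChart b.1 x) (chartAt E x x))).compContinuousLinearMap
          (chartDeriv x x)) rfl ?_
  rw [wedge_comp, wedge_comp, h4, h4]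
  rfl

/-- The exterior derivative `d : Ω(M) → Ω(M)`. -/
def Omega.d : Omega E M →ₗ[ℝ] Omega E M :=
  DirectSum.toModule ℝ ℕ _ fun k => DirectSum.lof ℝ ℕ (RForm E M) (k + 1) ∘ₗ RForm.d

theorem Omega.d_of {k : ℕ} (a : RForm E M k) :
    Omega.d (DirectSum.of (RForm E M) k a) = DirectSum.of (RForm E M) (k + 1) (RForm.d a) :=
  DirectSum.toModule_lof ℝ k a

theorem Omega.d_d (a : Omega E M) : Omega.d (Omega.d a) = 0 := by
  induction a using DirectSum.induction_on with
  | zero => simp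
  | of k a => rw [Omega.d_of, Omega.d_of, RForm.d_d, map_zero]
  | add a b ha hb => rw [map_add, map_add, ha, hb, add_zero]

/-- The Leibniz rule. -/
theorem Omega.d_mul (a b : Omega E M) :
    Omega.d (a * b) = Omega.d a * b + Omega.signOp a * Omega.d b := by
  induction a using DirectSum.induction_on with
  | zero => simp
  | add a a' ha ha' =>
    rw [add_mul, map_add, ha, ha', map_add, map_add, add_mul, add_mul]
    abel
  | of p a =>
    induction b using DirectSum.induction_on with
    | zero => simp
    | add b b' hb hb' =>
      rw [mul_add, map_add, hb, hb', map_add, mul_add, mul_add]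
      abel
    | of q b =>
      rw [DirectSum.of_mul_of, Omega.d_of, Omega.d_of, Omega.d_of, Omega.signOp_of,
        smul_mul_assoc, DirectSum.of_mul_of, DirectSum.of_mul_of]
      refine (congrArg _ (RForm.d_wedge a b)).trans ?_
      rw [map_add, RForm.of_cast, Omega.of_smul]
      rfl

theorem Omega.d_signOp (a : Omega E M) : Omega.d (Omega.signOp a) = - Omega.signOp (Omega.d a) := by
  induction a using DirectSum.induction_on with
  | zero => simp
  | of k a =>
    rw [Omega.signOp_of, map_smul, Omega.d_of, Omega.signOp_of, pow_succ]
    simp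
  | add a b ha hb => rw [map_add, map_add, ha, hb, map_add, map_add, neg_add]

theorem Omega.d_one : Omega.d (1 : Omega E M) = 0 := by
  have h := Omega.d_mul (1 : Omega E M) 1
  have h1 : Omega.signOp (1 : Omega E M) = 1 := by
    refine (Omega.signOp_of (RForm.one (E := E) (M := M))).trans ?_
    rw [pow_zero, one_smul]
    rfl
  rw [h1, mul_one, mul_one, one_mul] at h
  simpa using h

/-- The algebra of closed differential forms on `M`. -/
def closedForms (E : Type*) [NormedAddCommGroup E] [NormedSpace ℝ E]
    (M : Type*) [TopologicalSpace M] [ChartedSpace E M] [IsManifold 𝓘(ℝ, E) ∞ M] :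
    Subalgebra ℝ (Omega E M) where
  carrier := {a | Omega.d a = 0}
  mul_mem' {a b} ha hb := by
    rw [Set.mem_ofPred_eq] at *
    rw [Omega.d_mul, ha, hb, zero_mul, mul_zero, add_zero]
  add_mem' {a b} ha hb := by
    rw [Set.mem_ofPred_eq] at *
    rw [map_add, ha, hb, add_zero]
  algebraMap_mem' r := by
    rw [Set.mem_ofPred_eq, Algebra.algebraMap_eq_smul_one, map_smul, Omega.d_one, smul_zero]

/-- The ideal of exact forms in the algebra of closed forms. -/
def exactForms (E : Type*) [NormedAddCommGroup E] [NormedSpace ℝ E]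
    (M : Type*) [TopologicalSpace M] [ChartedSpace E M] [IsManifold 𝓘(ℝ, E) ∞ M] :
    Ideal (closedForms E M) where
  carrier := {a | ∃ b : Omega E M, Omega.d b = a}
  zero_mem' := ⟨0, map_zero _⟩
  add_mem' := by
    rintro _ _ ⟨b, hb⟩ ⟨b', hb'⟩
    exact ⟨b + b', by rw [map_add, hb, hb']; rfl⟩
  smul_mem' := by
    rintro ⟨a, ha⟩ c ⟨b, hb⟩
    have ha' : Omega.d a = 0 := ha
    refine ⟨Omega.signOp a * b, ?_⟩
    rw [Omega.d_mul, Omega.d_signOp, ha', Omega.signOp_signOp, hb]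
    simp

instance : (exactForms E M).IsTwoSided where
  mul_mem_of_left := by
    rintro c ⟨a, ha⟩ ⟨b, hb⟩
    have ha' : Omega.d a = 0 := ha
    refine ⟨b * a, ?_⟩
    rw [Omega.d_mul, ha', mul_zero, add_zero, hb]
    rfl

/-- The de Rham cohomology algebra `H*(M)`: closed forms modulo exact forms. -/
abbrev DeRham (E : Type*) [NormedAddCommGroup E] [NormedSpace ℝ E]
    (M : Type*) [TopologicalSpace M] [ChartedSpace E M] [IsManifold 𝓘(ℝ, E) ∞ M] : Type _ :=
  closedForms E M ⧸ exactForms E M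

end Algebra

section Invariants

/-- The pullback of alternating forms along a linear map, as an algebra homomorphism. -/
def ExtAlg.map {T T' : Type*} [AddCommGroup T] [Module ℝ T] [TopologicalSpace T]
    [AddCommGroup T'] [Module ℝ T'] [TopologicalSpace T'] (L : T' →L[ℝ] T) :
    ExtAlg T →ₐ[ℝ] ExtAlg T' :=
  DirectSum.toAlgebra ℝ (AltForm T)
    (fun k => DirectSum.lof ℝ ℕ (AltForm T') k ∘ₗ
      { toFun := fun f => f.compContinuousLinearMap L
        map_add' := fun _ _ => rfl
        map_smul' := fun _ _ => rfl })
    rfl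
    (fun {i j} a b => by
      refine Eq.trans ?_ (DirectSum.of_mul_of (A := AltForm T') _ _).symm
      exact congrArg (DirectSum.of (AltForm T') (i + j)) (wedge_comp a b L))

theorem ExtAlg.map_apply {T T' : Type*} [AddCommGroup T] [Module ℝ T] [TopologicalSpace T]
    [AddCommGroup T'] [Module ℝ T'] [TopologicalSpace T'] (L : T' →L[ℝ] T) (f : ExtAlg T) (k : ℕ) :
    ExtAlg.map L f k = (f k).compContinuousLinearMap L := by
  induction f using DirectSum.induction_on with
  | zero => rw [map_zero]; rfl
  | of i a =>
    have h : ExtAlg.map L (DirectSum.of (AltForm T) i a) =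
        DirectSum.of (AltForm T') i (a.compContinuousLinearMap L) :=
      (DirectSum.toAlgebra_apply ..).trans (DirectSum.toSemiring_of _ _ _ i a)
    rw [h]
    by_cases hik : i = k
    · subst hik
      rw [DirectSum.of_eq_same, DirectSum.of_eq_same]
    · rw [DirectSum.of_eq_of_ne _ _ _ (Ne.symm hik), DirectSum.of_eq_of_ne _ _ _ (Ne.symm hik)]
      rfl
  | add a b ha hb =>
    rw [map_add, DirectSum.add_apply, ha, hb, DirectSum.add_apply]
    rfl

/-- The algebra `Λ(V*)^G` of the alternating forms on `V` that are invariant under a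
representation of `G` on `V`. -/
def invariantForms {G V : Type*} [Group G] [NormedAddCommGroup V] [NormedSpace ℝ V]
    (rep : G →* (V ≃L[ℝ] V)) : Subalgebra ℝ (ExtAlg V) where
  carrier := {f | ∀ (g : G) (k : ℕ),
    (f k).compContinuousLinearMap (rep g : V →L[ℝ] V) = f k}
  mul_mem' {a b} ha hb g k := by
    have ha' : ExtAlg.map (rep g : V →L[ℝ] V) a = a :=
      DFinsupp.ext fun k => (ExtAlg.map_apply _ a k).trans (ha g k)
    have hb' : ExtAlg.map (rep g : V →L[ℝ] V) b = b :=
      DFinsupp.ext fun k => (ExtAlg.map_apply _ b k).trans (hb g k)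
    rw [← ExtAlg.map_apply, map_mul, ha', hb']
  add_mem' {a b} ha hb g k := by
    rw [← ExtAlg.map_apply, map_add, DirectSum.add_apply, ExtAlg.map_apply, ExtAlg.map_apply,
      ha g k, hb g k, DirectSum.add_apply]
  algebraMap_mem' r g k := by
    rw [← ExtAlg.map_apply, AlgHom.commutes]

end Invariants

section Structures

variable {E : Type*} [NormedAddCommGroup E] [NormedSpace ℝ E]
  {M : Type*} [TopologicalSpace M] [ChartedSpace E M]
  {EG : Type*} [NormedAddCommGroup EG] [NormedSpace ℝ EG]
  {G : Type*} [TopologicalSpace G] [ChartedSpace EG G] [Group G]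
  {EP : Type*} [NormedAddCommGroup EP] [NormedSpace ℝ EP]
  {P : Type*} [TopologicalSpace P] [ChartedSpace EP P]
  {V : Type*} [NormedAddCommGroup V] [NormedSpace ℝ V]
  {F : Type*} [NormedAddCommGroup F] [NormedSpace ℝ F]

/-- A smooth `1`-form at a point, as a linear map on the tangent space. -/
def covector (w : DiffForm E M F 1) (x : M) : TangentSpace 𝓘(ℝ, E) x →L[ℝ] F :=
  (ContinuousAlternatingMap.ofSubsingleton ℝ (TangentSpace 𝓘(ℝ, E) x) F (0 : Fin 1)).symm (w.1 x)

/-- The pullback along `proj : P → M` of a form on `M`. -/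
def FormField.pullback {k : ℕ} (proj : P → M) (w : FormField E M F k) : FormField EP P F k :=
  fun p => (w (proj p)).compContinuousLinearMap (mfderiv 𝓘(ℝ, EP) 𝓘(ℝ, E) proj p)

/-- The tangent space of a Lie group at `1`, which Mathlib realizes on the model space itself. -/
def lieEquiv (EG : Type*) [NormedAddCommGroup EG] [NormedSpace ℝ EG]
    (G : Type*) [TopologicalSpace G] [ChartedSpace EG G] [Group G] :
    EG ≃L[ℝ] GroupLieAlgebra 𝓘(ℝ, EG) G where
  toFun v := v
  invFun v := v
  map_add' _ _ := rfl
  map_smul' _ _ := rfl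
  continuous_toFun := continuous_id
  continuous_invFun := continuous_id

/-- The adjoint action `Ad(g)` on the Lie algebra: the differential at `1` of `h ↦ g h g⁻¹`. -/
def Ad (EG : Type*) [NormedAddCommGroup EG] [NormedSpace ℝ EG]
    {G : Type*} [TopologicalSpace G] [ChartedSpace EG G] [Group G] (g : G) : EG →L[ℝ] EG :=
  ((lieEquiv EG G).symm.toContinuousLinearMap.comp
    (mfderiv 𝓘(ℝ, EG) 𝓘(ℝ, EG) (fun h : G => g * h * g⁻¹) (1 : G))).comp
    (lieEquiv EG G).toContinuousLinearMap

/-- A smooth principal `G`-bundle `proj : P → M`: a smooth right action of `G` on `P` together with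
equivariant local trivializations `U × G ≅ proj⁻¹(U)` over `M`. -/
structure PrincipalBundle (E : Type*) [NormedAddCommGroup E] [NormedSpace ℝ E]
    (M : Type*) [TopologicalSpace M] [ChartedSpace E M]
    (EG : Type*) [NormedAddCommGroup EG] [NormedSpace ℝ EG]
    (G : Type*) [TopologicalSpace G] [ChartedSpace EG G] [Group G]
    (EP : Type*) [NormedAddCommGroup EP] [NormedSpace ℝ EP]
    (P : Type*) [TopologicalSpace P] [ChartedSpace EP P] where
  /-- The bundle projection. -/
  proj : P → M
  /-- The right action. -/
  act : P → G → P
  contMDiff_proj : ContMDiff 𝓘(ℝ, EP) 𝓘(ℝ, E) ∞ proj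
  contMDiff_act : ContMDiff (𝓘(ℝ, EP).prod 𝓘(ℝ, EG)) 𝓘(ℝ, EP) ∞ (fun x : P × G => act x.1 x.2)
  act_one : ∀ p, act p 1 = p
  act_mul : ∀ p g h, act p (g * h) = act (act p g) h
  locallyTrivial : ∀ x : M, ∃ (U : Set M) (e : OpenPartialHomeomorph (M × G) P),
    IsOpen U ∧ x ∈ U ∧ e.source = U ×ˢ Set.univ ∧ e.target = proj ⁻¹' U ∧
    ContMDiffOn (𝓘(ℝ, E).prod 𝓘(ℝ, EG)) 𝓘(ℝ, EP) ∞ e e.source ∧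
    ContMDiffOn 𝓘(ℝ, EP) (𝓘(ℝ, E).prod 𝓘(ℝ, EG)) ∞ e.symm e.target ∧
    ∀ y ∈ U, ∀ g : G, proj (e (y, g)) = y ∧ ∀ h : G, act (e (y, g)) h = e (y, g * h)

namespace PrincipalBundle

variable (B : PrincipalBundle E M EG G EP P)

/-- The fundamental vector fields `ζ_X(p) = d/dt|₀ p · exp(tX)` of the action. -/
def fundamental (p : P) : EG →L[ℝ] TangentSpace 𝓘(ℝ, EP) p :=
  (mfderiv 𝓘(ℝ, EG) 𝓘(ℝ, EP) (B.act p) (1 : G)).comp (lieEquiv EG G).toContinuousLinearMap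

/-- The differential at `p` of the right translation by `g`. -/
def rightDeriv (g : G) (p : P) :
    TangentSpace 𝓘(ℝ, EP) p →L[ℝ] TangentSpace 𝓘(ℝ, EP) (B.act p g) :=
  mfderiv 𝓘(ℝ, EP) 𝓘(ℝ, EP) (fun q => B.act q g) p

/-- A principal connection: a `G`-equivariant one-form on `P` with values in the Lie algebra of `G`
which reproduces the generators of the fundamental vector fields. -/
structure Connection where
  /-- The connection form. -/
  form : DiffForm EP P EG 1
  form_fundamental : ∀ (p : P) (X : EG), covector form p (B.fundamental p X) = X
  equivariant : ∀ (g : G) (p : P) (X : TangentSpace 𝓘(ℝ, EP) p),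
    covector form (B.act p g) (B.rightDeriv g p X) = Ad EG g⁻¹ (covector form p X)

variable {B}

/-- The projection onto the horizontal bundle, the kernel of the connection form. -/
def Connection.horProj (C : B.Connection) (p : P) :
    TangentSpace 𝓘(ℝ, EP) p →L[ℝ] TangentSpace 𝓘(ℝ, EP) p :=
  ContinuousLinearMap.id ℝ _ - (B.fundamental p).comp (covector C.form p)

/-- The covariant exterior derivative: the horizontal part of the exterior derivative. -/
def Connection.covD (C : B.Connection) {k : ℕ} (w : DiffForm EP P F k) : FormField EP P F (k + 1) :=
  fun p => (FormField.extD w.1 p).compContinuousLinearMap (C.horProj p)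

end PrincipalBundle

/-- A `G`-structure on `M`: a principal bundle `P → M` with structure group `G`, a smooth
representation of `G` on a vector space `V` of dimension `dim M`, and a `G`-equivariant `V`-valued
one-form `theta` on `P`, the displacement form, whose kernel is exactly the vertical bundle. -/
structure GStructure (E : Type*) [NormedAddCommGroup E] [NormedSpace ℝ E]
    (M : Type*) [TopologicalSpace M] [ChartedSpace E M]
    (EG : Type*) [NormedAddCommGroup EG] [NormedSpace ℝ EG]
    (G : Type*) [TopologicalSpace G] [ChartedSpace EG G] [Group G]
    (EP : Type*) [NormedAddCommGroup EP] [NormedSpace ℝ EP]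
    (P : Type*) [TopologicalSpace P] [ChartedSpace EP P]
    (V : Type*) [NormedAddCommGroup V] [NormedSpace ℝ V]
    extends PrincipalBundle E M EG G EP P where
  /-- The representation of the structure group. -/
  rep : G →* (V ≃L[ℝ] V)
  contMDiff_rep : ContMDiff 𝓘(ℝ, EG) 𝓘(ℝ, V →L[ℝ] V) ∞ (fun g => (rep g : V →L[ℝ] V))
  finrank_eq : Module.finrank ℝ V = Module.finrank ℝ E
  /-- The displacement form. -/
  theta : DiffForm EP P V 1
  equivariant : ∀ (g : G) (p : P) (X : TangentSpace 𝓘(ℝ, EP) p),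
    covector theta (act p g) (toPrincipalBundle.rightDeriv g p X) = rep g⁻¹ (covector theta p X)
  ker_theta : ∀ (p : P) (X : TangentSpace 𝓘(ℝ, EP) p),
    covector theta p X = 0 ↔ mfderiv 𝓘(ℝ, EP) 𝓘(ℝ, E) proj p X = 0

namespace GStructure

variable (S : GStructure E M EG G EP P V)

/-- The form `f^θ = f(θ,…,θ)` on `P`, given by
`f^θ(X₁,…,X_k) = f(θ(X₁),…,θ(X_k))` for an alternating `k`-form `f` on `V`. -/
def insertTheta {k : ℕ} (f : AltForm V k) : FormField EP P ℝ k :=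
  fun p => f.compContinuousLinearMap (covector S.theta p)

/-- The torsion of a connection: the covariant exterior derivative of the displacement form. -/
def torsion (C : S.toPrincipalBundle.Connection) : FormField EP P V 2 := C.covD S.theta

/-- A `G`-structure is `1`-integrable if it admits a torsion-free connection. -/
def OneIntegrable : Prop := ∃ C : S.toPrincipalBundle.Connection, S.torsion C = 0

/-- The map `nu` assigns to every invariant form `f` the differential form on `M` whose pullback
to `P` is `f^θ`. -/
def IsCharacteristicMap (nu : invariantForms S.rep → Omega E M) : Prop :=
  ∀ (f : invariantForms S.rep) (k : ℕ),
    FormField.pullback S.proj (nu f k).1 = S.insertTheta (f.1 k)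

end GStructure

end Structures

end GStr

end

/-!
A point `p` of the `G`-structure over `x` stands for a coframe `T_x M ≅ V`, the linear map through
which the displacement form at `p` factors, and `p · g` stands for the coframe `ρ(g⁻¹) ∘ coframe p`
(`GStructure.coframe_act`). The equation `π^*(ν(f)) = f(θ,…,θ)` says that `ν(f)` at `x` is the
pullback of `f` along the coframe of any point over `x`. This determines `ν` and makes it
multiplicative; for invariant `f` it does not depend on the point, and `ν(f)` is locally the smooth
form `s^*(f(θ,…,θ))` for a section `s` (`GStructure.nu`).

If a connection is torsion-free, then `dθ` vanishes on horizontal vectors, and so does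
`d(f(θ,…,θ)) = ∑ ± f(θ,…,dθ,…,θ)`. As every tangent vector of `M` has a horizontal lift and
`f(θ,…,θ) = π^*(s^*(f(θ,…,θ)))` near `s`, the form `s^*(f(θ,…,θ))` is closed. This needs the
invariance of `f` only under the elements of `G` near `1` (`GStructure.extDeriv_localForm_eq_zero`).

For injectivity, let `M` and `G` be compact and let `f ≠ 0` be an invariant form of positive degree
with `ν(f) = da`. There is a form `f'` on `V` of complementary degree with `f ∧ f' ≠ 0`, and
averaging over `G` makes it transform under `g` by `det ρ(g)`, as the top degree form `f ∧ f'` does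
(`exists_semiinvariant_wedge_ne_zero`). Since `G` is compact, `det ρ = ±1`, and `det ρ` is `1`
near `1`. Thus `f'` and `f ∧ f'` induce forms on `M` that are well defined up to a common sign,
the first one is locally closed, and `d(a ∧ ν(f')) = ν(f ∧ f')` is a nowhere vanishing top degree form up to sign,
that is, a positive density. As `M` need not be orientable, Stokes' theorem enters in the form of
the divergence theorem for this density `δ`: the operator `D u = d(u (a ∧ ν(f'))) / ν(f ∧ f')` on
functions is not affected by the signs, the integral of `D u` against `δ` vanishes for `u` with
small support, and `D 1 = 1`. With a partition of unity `ρᵢ` it follows that the total integral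
`∑ᵢ ∫ D ρᵢ δ` of `δ` is both zero and positive (`false_of_integral_eq_zero`). In degree `0` exact
forms vanish, and injectivity is clear as `M` is non-empty.
-/

open scoped Manifold ContDiff Nat DirectSum

noncomputable section

namespace GStr

/-! ### Pullback of alternating forms along families of linear maps -/

section Pullback

variable {E : Type*} [NormedAddCommGroup E] [NormedSpace ℝ E]
  {V : Type*} [NormedAddCommGroup V] [NormedSpace ℝ V]
  {F : Type*} [NormedAddCommGroup F] [NormedSpace ℝ F]

/-- Alternatization of multilinear maps, as a continuous linear map. -/
def alternatizationCLM (E F : Type*) [NormedAddCommGroup E] [NormedSpace ℝ E]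
    [NormedAddCommGroup F] [NormedSpace ℝ F] (k : ℕ) :
    ContinuousMultilinearMap ℝ (fun _ : Fin k => E) F →L[ℝ] E [⋀^Fin k]→L[ℝ] F :=
  LinearMap.mkContinuous
    { toFun := ContinuousMultilinearMap.alternatization
      map_add' := map_add _
      map_smul' := fun c f => by
        ext v
        simp only [ContinuousMultilinearMap.alternatization_apply_apply,
          _root_.smul_apply, RingHom.id_apply,
          ContinuousAlternatingMap.smul_apply, Finset.smul_sum]
        exact Finset.sum_congr rfl fun σ _ => smul_comm _ _ _ }
    (k ! : ℝ) fun f => by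
      refine ContinuousAlternatingMap.opNorm_le_bound _ (by positivity) fun v => ?_
      rw [LinearMap.coe_mk, AddHom.coe_mk, ContinuousMultilinearMap.alternatization_apply_apply]
      refine (norm_sum_le _ _).trans ((Finset.sum_le_sum (g := fun _ => ‖f‖ * ∏ i, ‖v i‖)
        fun σ _ => ?_).trans_eq ?_)
      · rw [← Equiv.prod_comp σ (fun i => ‖v i‖)]
        refine le_trans (le_of_eq ?_) (f.le_opNorm (v ∘ σ))
        rcases Int.units_eq_one_or (Equiv.Perm.sign σ) with h | h <;> simp [h]
      · simp [Fintype.card_perm, mul_assoc]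

theorem alternatizationCLM_coe {k : ℕ} (f : E [⋀^Fin k]→L[ℝ] F) :
    alternatizationCLM E F k f.toContinuousMultilinearMap = (k ! : ℝ) • f := by
  ext v
  change ContinuousMultilinearMap.alternatization _ v = _
  rw [ContinuousMultilinearMap.alternatization_apply_apply, ContinuousAlternatingMap.smul_apply]
  have h (σ : Equiv.Perm (Fin k)) :
      Equiv.Perm.sign σ • f.toContinuousMultilinearMap (v ∘ σ) = f v := by
    have h := f.toAlternatingMap.map_perm v σ
    change f (v ∘ σ) = Equiv.Perm.sign σ • f v at h
    change Equiv.Perm.sign σ • f (v ∘ σ) = f v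
    rw [h, smul_smul, Int.units_mul_self, one_smul]
  rw [Finset.sum_congr rfl fun σ _ => h σ]
  simp [Fintype.card_perm, Nat.cast_smul_eq_nsmul]

/-- The pullback `f ↦ f ∘ A` of alternating forms is jointly smooth in the form and the
linear map. -/
theorem contDiff_compContinuousLinearMap (k : ℕ) : ContDiff ℝ ∞
    (fun x : (V [⋀^Fin k]→L[ℝ] F) × (E →L[ℝ] V) => x.1.compContinuousLinearMap x.2) := by
  have h : (fun x : (V [⋀^Fin k]→L[ℝ] F) × (E →L[ℝ] V) => x.1.compContinuousLinearMap x.2) =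
      fun x => (k ! : ℝ)⁻¹ • alternatizationCLM E F k
        (ContinuousMultilinearMap.compContinuousLinearMapContinuousMultilinear ℝ
          (fun _ : Fin k => E) (fun _ => V) F (fun _ => x.2)
          (ContinuousAlternatingMap.toContinuousMultilinearMapCLM ℝ x.1)) := by
    funext x
    have := alternatizationCLM_coe (x.1.compContinuousLinearMap x.2)
    rw [eq_inv_smul_iff₀ (by positivity), ← this]
    rfl
  rw [h]
  have h1 : ContDiff ℝ ∞ fun x : (V [⋀^Fin k]→L[ℝ] F) × (E →L[ℝ] V) =>
      ContinuousMultilinearMap.compContinuousLinearMapContinuousMultilinear ℝ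
        (fun _ : Fin k => E) (fun _ => V) F (fun _ => x.2) :=
    (ContinuousMultilinearMap.contDiff _).comp (contDiff_pi.2 fun _ => contDiff_snd)
  have h2 : ContDiff ℝ ∞ fun x : (V [⋀^Fin k]→L[ℝ] F) × (E →L[ℝ] V) =>
      ContinuousAlternatingMap.toContinuousMultilinearMapCLM ℝ x.1 :=
    (ContinuousAlternatingMap.toContinuousMultilinearMapCLM (𝕜 := ℝ) (E := V) (F := F)
      (ι := Fin k) ℝ).contDiff.comp contDiff_fst
  exact ((alternatizationCLM E F k).contDiff.comp (h1.clm_apply h2)).const_smul _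

theorem contDiffOn_compContinuousLinearMap {k : ℕ} {X : Type*} [NormedAddCommGroup X]
    [NormedSpace ℝ X] {s : Set X} {w : X → V [⋀^Fin k]→L[ℝ] F} {A : X → E →L[ℝ] V}
    (hw : ContDiffOn ℝ ∞ w s) (hA : ContDiffOn ℝ ∞ A s) :
    ContDiffOn ℝ ∞ (fun y => (w y).compContinuousLinearMap (A y)) s :=
  (contDiff_compContinuousLinearMap k).comp_contDiffOn (hw.prodMk hA)

/-- If the derivative of the `V`-valued one-form `A` is symmetric on the vectors `v i`, that is, if
`dA (v i, v j) = 0`, then `d(f(A,…,A)) = ∑ ± f(A,…,dA,…,A)` vanishes on them. -/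
theorem extDeriv_comp_apply_eq_zero {k : ℕ} (f : AltForm V k) {A : E → E →L[ℝ] V} {z : E}
    (hA : DifferentiableAt ℝ A z) (v : Fin (k + 1) → E)
    (hv : ∀ i j, fderiv ℝ A z (v i) (v j) = fderiv ℝ A z (v j) (v i)) :
    extDeriv (fun y => f.compContinuousLinearMap (A y)) z v = 0 := by
  have hd := fderiv_continuousAlternatingMapCompContinuousLinearMap
    (f := fun _ => f) (differentiableAt_const _) hA
  rw [fderiv_const_apply, ContinuousLinearMap.comp_zero, zero_add] at hd
  rw [extDeriv, hd, uncurry_apply]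
  simp only [ContinuousLinearMap.comp_apply,
    ContinuousAlternatingMap.fderivCompContinuousLinearMap_apply, Finset.mul_sum]
  rw [Finset.sum_comm]
  refine Finset.sum_eq_zero fun j _ => ?_
  rw [← Finset.mul_sum]
  refine mul_eq_zero_of_right _ ?_
  -- Composing with the transposition `(0 j+1)` changes the sign of the summand.
  have key : ∀ σ : Equiv.Perm (Fin (k + 1)), (fun i => Function.update (fun _ : Fin k => A z) j
      (fderiv ℝ A z (v ((σ * Equiv.swap 0 j.succ) 0))) i
        ((v ∘ ⇑(σ * Equiv.swap 0 j.succ) ∘ Fin.succ) i)) =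
      (fun i => Function.update (fun _ : Fin k => A z) j (fderiv ℝ A z (v (σ 0))) i
        ((v ∘ σ ∘ Fin.succ) i)) := fun σ => by
    funext i
    by_cases hij : i = j
    · subst hij
      simp [hv (σ 0)]
    · have h : Equiv.swap 0 j.succ i.succ = i.succ :=
        Equiv.swap_apply_of_ne_of_ne (Fin.succ_ne_zero i) (by simpa using hij)
      simp [Function.update_of_ne hij, h]
  have h := Fintype.sum_equiv (Equiv.mulRight (Equiv.swap (0 : Fin (k + 1)) j.succ))
    (fun σ : Equiv.Perm (Fin (k + 1)) => -(((Equiv.Perm.sign σ : ℤ) : ℝ) *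
      f (fun i => Function.update (fun _ : Fin k => A z) j (fderiv ℝ A z (v (σ 0))) i
        ((v ∘ σ ∘ Fin.succ) i))))
    (fun σ : Equiv.Perm (Fin (k + 1)) => ((Equiv.Perm.sign σ : ℤ) : ℝ) *
      f (fun i => Function.update (fun _ : Fin k => A z) j (fderiv ℝ A z (v (σ 0))) i
        ((v ∘ σ ∘ Fin.succ) i))) (fun σ => by
      simp only [Equiv.coe_mulRight]
      rw [key, Equiv.Perm.sign_mul, Equiv.Perm.sign_swap (Fin.succ_ne_zero j).symm]
      simp)
  rw [Finset.sum_neg_distrib] at h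
  linarith

end Pullback

/-! ### Pullback of differential forms in charts -/

section FormPullback

/-- Near a point of the target of a chart, the inverse chart takes values in any neighbourhood of
the corresponding point of the manifold. -/
theorem eventually_chart_symm {EP : Type*} [TopologicalSpace EP]
    {P : Type*} [TopologicalSpace P] [ChartedSpace EP P] {c : P} {y : EP}
    (hy : y ∈ (chartAt EP c).target) {q : P → Prop}
    (hq : ∀ᶠ x in nhds ((chartAt EP c).symm y), q x) :
    ∀ᶠ z in nhds y, z ∈ (chartAt EP c).target ∧ q ((chartAt EP c).symm z) :=
  Filter.Eventually.and ((chartAt EP c).open_target.mem_nhds hy)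
    (((chartAt EP c).continuousAt_symm hy).eventually hq)

/-- The expression of a map `u` in the preferred charts around `c` and `c'`. -/
def chartExpr {E M EP P : Type*} [TopologicalSpace E] [TopologicalSpace M] [ChartedSpace E M]
    [TopologicalSpace EP] [TopologicalSpace P] [ChartedSpace EP P] (u : P → M) (c : P) (c' : M) :
    EP → E :=
  chartAt E c' ∘ u ∘ (chartAt EP c).symm

theorem chartExpr_mem_target {E M EP P : Type*} [TopologicalSpace E] [TopologicalSpace M]
    [ChartedSpace E M] [TopologicalSpace EP] [TopologicalSpace P] [ChartedSpace EP P]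
    {u : P → M} {c : P} {c' : M} {y : EP}
    (hy' : u ((chartAt EP c).symm y) ∈ (chartAt E c').source) :
    chartExpr u c c' y ∈ (chartAt E c').target :=
  (chartAt E c').map_source hy'

variable {E : Type*} [NormedAddCommGroup E] [NormedSpace ℝ E]
  {M : Type*} [TopologicalSpace M] [ChartedSpace E M]
  {EP : Type*} [NormedAddCommGroup EP] [NormedSpace ℝ EP]
  {P : Type*} [TopologicalSpace P] [ChartedSpace EP P]
  {F : Type*} [NormedAddCommGroup F] [NormedSpace ℝ F]

/-- A form evaluated at two points that are equal only propositionally. -/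
theorem FormField.apply_congr {k : ℕ} (w : FormField E M F k) {x x' : M} (h : x' = x)
    (v : Fin k → E) : w x' v = w x v := by
  subst h
  rfl

/-- Smooth forms are smooth in every chart, in the pointwise sense. -/
theorem contDiffAt_inChart {k : ℕ} {w : FormField E M F k} (hw : w ∈ DiffForm E M F k) (c : M)
    {y : E} (hy : y ∈ (chartAt E c).target) : ContDiffAt ℝ ∞ (w.inChart c) y :=
  (hw c).contDiffAt ((chartAt E c).open_target.mem_nhds hy)

variable [IsManifold 𝓘(ℝ, E) ∞ M] [IsManifold 𝓘(ℝ, EP) ∞ P]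

theorem fderiv_chartExpr {u : P → M} {c : P} {c' : M} {y : EP} (hy : y ∈ (chartAt EP c).target)
    (hu : MDifferentiableAt 𝓘(ℝ, EP) 𝓘(ℝ, E) u ((chartAt EP c).symm y))
    (hy' : u ((chartAt EP c).symm y) ∈ (chartAt E c').source) :
    fderiv ℝ (chartExpr u c c') y = (chartDeriv c' (u ((chartAt EP c).symm y))).comp
      ((mfderiv 𝓘(ℝ, EP) 𝓘(ℝ, E) u ((chartAt EP c).symm y)).comp (chartSymmDeriv c y)) := by
  have h1 := (mdifferentiable_chart (I := 𝓘(ℝ, E)) c').mdifferentiableAt hy'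
  have h2 := (mdifferentiable_chart (I := 𝓘(ℝ, EP)) c).mdifferentiableAt_symm hy
  have h := mfderiv_comp y h1 (hu.comp y h2)
  have h' := mfderiv_comp y hu h2
  change mfderiv 𝓘(ℝ, EP) 𝓘(ℝ, E) (chartExpr u c c') y = _ at h
  rw [mfderiv_eq_fderiv, h'] at h
  ext v
  exact congrArg (fun L => L v) h

theorem contDiffAt_chartExpr {u : P → M} {c : P} {c' : M} {y : EP}
    (hy : y ∈ (chartAt EP c).target)
    (hu : ContMDiffAt 𝓘(ℝ, EP) 𝓘(ℝ, E) ∞ u ((chartAt EP c).symm y))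
    (hy' : u ((chartAt EP c).symm y) ∈ (chartAt E c').source) :
    ContDiffAt ℝ ∞ (chartExpr u c c' : EP → E) y := by
  have h1 : ContMDiffAt 𝓘(ℝ, EP) 𝓘(ℝ, EP) ∞ (chartAt EP c).symm y :=
    (contMDiffOn_chart_symm (I := 𝓘(ℝ, EP)) (x := c)).contMDiffAt
      ((chartAt EP c).open_target.mem_nhds hy)
  have h2 : ContMDiffAt 𝓘(ℝ, E) 𝓘(ℝ, E) ∞ (chartAt E c') (u ((chartAt EP c).symm y)) :=
    (contMDiffOn_chart (I := 𝓘(ℝ, E)) (x := c')).contMDiffAt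
      ((chartAt E c').open_source.mem_nhds hy')
  exact (h2.comp y (hu.comp y h1)).contDiffAt

/-- The pullback of a form is computed in charts by the pullback along the chart expression. -/
theorem inChart_pullback {k : ℕ} (w : FormField E M F k) {u : P → M} {c : P} {c' : M} {y : EP}
    (hy : y ∈ (chartAt EP c).target)
    (hu : MDifferentiableAt 𝓘(ℝ, EP) 𝓘(ℝ, E) u ((chartAt EP c).symm y))
    (hy' : u ((chartAt EP c).symm y) ∈ (chartAt E c').source) :
    (FormField.pullback (EP := EP) u w).inChart c y =
      (w.inChart c' (chartExpr u c c' y)).compContinuousLinearMap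
        (fderiv ℝ (chartExpr u c c') y) := by
  ext v
  rw [fderiv_chartExpr hy hu hy']
  refine Eq.trans ?_ (w.apply_congr ((chartAt E c').left_inv hy') _).symm
  refine congrArg (w (u ((chartAt EP c).symm y))) ?_
  ext i
  exact (chartDeriv_comp_chartSymmDeriv c' _ hy' _).symm

theorem eventually_inChart_pullback {k : ℕ} (w : FormField E M F k) {u : P → M} {c : P} {c' : M}
    {y : EP} (hy : y ∈ (chartAt EP c).target)
    (hu : ContMDiffAt 𝓘(ℝ, EP) 𝓘(ℝ, E) ∞ u ((chartAt EP c).symm y))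
    (hy' : u ((chartAt EP c).symm y) ∈ (chartAt E c').source) :
    ∀ᶠ z in nhds y, (FormField.pullback (EP := EP) u w).inChart c z =
      (w.inChart c' (chartExpr u c c' z)).compContinuousLinearMap
        (fderiv ℝ (chartExpr u c c') z) := by
  have h := ((contMDiffAt_iff_contMDiffAt_nhds (n := 1) (by simp)).1 (hu.of_le (by simp))).and
    (hu.continuousAt.eventually ((chartAt E c').open_source.mem_nhds hy'))
  filter_upwards [eventually_chart_symm hy h] with z hz
  exact inChart_pullback w hz.1 (hz.2.1.mdifferentiableAt one_ne_zero) hz.2.2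

theorem contDiffAt_inChart_pullback {k : ℕ} {w : FormField E M F k} {u : P → M} {c : P} {c' : M}
    {y : EP} (hy : y ∈ (chartAt EP c).target)
    (hu : ContMDiffAt 𝓘(ℝ, EP) 𝓘(ℝ, E) ∞ u ((chartAt EP c).symm y))
    (hy' : u ((chartAt EP c).symm y) ∈ (chartAt E c').source)
    (hw : ContDiffAt ℝ ∞ (w.inChart c') (chartExpr u c c' y)) :
    ContDiffAt ℝ ∞ ((FormField.pullback (EP := EP) u w).inChart c) y := by
  have hσ := contDiffAt_chartExpr hy hu hy'
  refine ContDiffAt.congr_of_eventuallyEq ?_ (eventually_inChart_pullback w hy hu hy')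
  exact (contDiff_compContinuousLinearMap k).contDiffAt.comp y
    ((hw.comp y hσ).prodMk (hσ.fderiv_right (by simp)))

/-- The exterior derivative commutes with pullback, in charts. -/
theorem extDeriv_inChart_pullback {k : ℕ} {w : FormField E M F k} {u : P → M} {c : P} {c' : M}
    {y : EP} (hy : y ∈ (chartAt EP c).target)
    (hu : ContMDiffAt 𝓘(ℝ, EP) 𝓘(ℝ, E) ∞ u ((chartAt EP c).symm y))
    (hy' : u ((chartAt EP c).symm y) ∈ (chartAt E c').source)
    (hw : ContDiffAt ℝ ∞ (w.inChart c') (chartExpr u c c' y)) :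
    extDeriv ((FormField.pullback (EP := EP) u w).inChart c) y =
      (extDeriv (w.inChart c') (chartExpr u c c' y)).compContinuousLinearMap
        (fderiv ℝ (chartExpr u c c') y) := by
  have hev : (FormField.pullback (EP := EP) u w).inChart c =ᶠ[nhds y] _ :=
    eventually_inChart_pullback w hy hu hy'
  rw [hev.extDeriv_eq]
  exact extDeriv_pullback (hw.differentiableAt (by simp)) (contDiffAt_chartExpr hy hu hy')
    two_le_smooth

end FormPullback

/-! ### Local sections and coframes -/

section LocalGeometry

variable {E : Type*} [NormedAddCommGroup E] [NormedSpace ℝ E]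
  {M : Type*} [TopologicalSpace M] [ChartedSpace E M]
  {EG : Type*} [NormedAddCommGroup EG] [NormedSpace ℝ EG]
  {G : Type*} [TopologicalSpace G] [ChartedSpace EG G] [Group G]
  {EP : Type*} [NormedAddCommGroup EP] [NormedSpace ℝ EP]
  {P : Type*} [TopologicalSpace P] [ChartedSpace EP P]
  {V : Type*} [NormedAddCommGroup V] [NormedSpace ℝ V]

namespace PrincipalBundle

variable (B : PrincipalBundle E M EG G EP P)

/-- A smooth local section `s` of a principal bundle over the open set `U`, such that the induced
trivialization of the bundle over `U` is continuous at the points of the section: a point `p` near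
`s x` is of the form `s (π p) · g` with `g` near `1`. -/
structure IsLocalSection (U : Set M) (s : M → P) : Prop where
  isOpen : IsOpen U
  contMDiffOn : ContMDiffOn 𝓘(ℝ, E) 𝓘(ℝ, EP) ∞ s U
  proj_eq : ∀ x ∈ U, B.proj (s x) = x
  exists_act : ∀ p, B.proj p ∈ U → ∃ g, p = B.act (s (B.proj p)) g
  eventually_act : ∀ x ∈ U, ∀ N ∈ nhds (1 : G), ∀ᶠ p in nhds (s x),
    ∃ g ∈ N, p = B.act (s (B.proj p)) g

theorem exists_isLocalSection (x : M) : ∃ U s, x ∈ U ∧ B.IsLocalSection U s := by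
  obtain ⟨U, e, hU, hxU, hes, het, he, hes', h⟩ := B.locallyTrivial x
  have hmem (y : M) (hy : y ∈ U) (g : G) : (y, g) ∈ e.source := by
    rw [hes]
    exact ⟨hy, Set.mem_univ g⟩
  have hact (p : P) (hp : p ∈ e.target) : p = B.act (e (B.proj p, 1)) (e.symm p).2 := by
    have h1 : (e.symm p).1 ∈ U := by
      have := e.map_target hp
      rw [hes] at this
      exact this.1
    have h2 : e ((e.symm p).1, (e.symm p).2) = p := e.right_inv hp
    have h3 := (h _ h1 (e.symm p).2).1
    rw [h2] at h3
    rw [h3, (h _ h1 1).2, one_mul, h2]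
  refine ⟨U, fun y => e (y, 1), hxU, hU, ?_, fun y hy => (h y hy 1).1, fun p hp => ?_,
    fun y hy N hN => ?_⟩
  · exact he.comp (contMDiff_id.prodMk contMDiff_const).contMDiffOn fun y hy => hmem y hy 1
  · exact ⟨_, hact p (het ▸ hp)⟩
  · have hs := e.map_source (hmem y hy 1)
    have hc : Filter.Tendsto (fun p => (e.symm p).2) (nhds (e (y, 1))) (nhds 1) := by
      have h1 := (continuous_snd.tendsto _).comp (e.continuousAt_symm hs)
      rwa [e.left_inv (hmem y hy 1)] at h1
    filter_upwards [e.open_target.mem_nhds hs, hc hN] with p hp hpN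
    exact ⟨_, hpN, hact p hp⟩

theorem proj_act (p : P) (g : G) : B.proj (B.act p g) = B.proj p := by
  obtain ⟨U, e, hU, hxU, hes, het, he, hes', h⟩ := B.locallyTrivial (B.proj p)
  have hp : p ∈ e.target := by
    rw [het]
    exact hxU
  have h1 : (e.symm p).1 ∈ U := by
    have := e.map_target hp
    rw [hes] at this
    exact this.1
  have h2 : e ((e.symm p).1, (e.symm p).2) = p := e.right_inv hp
  have h3 := (h _ h1 (e.symm p).2).2 g
  rw [h2] at h3
  rw [h3, (h _ h1 _).1, ← (h _ h1 (e.symm p).2).1, h2]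

theorem proj_surjective : Function.Surjective B.proj := fun x => by
  obtain ⟨U, s, hx, hs⟩ := B.exists_isLocalSection x
  exact ⟨s x, hs.proj_eq x hx⟩

/-- Two points of the same fibre differ by an element of the structure group. -/
theorem exists_act_eq {p q : P} (h : B.proj p = B.proj q) : ∃ g, q = B.act p g := by
  obtain ⟨U, s, hx, hs⟩ := B.exists_isLocalSection (B.proj p)
  obtain ⟨g, hg⟩ := hs.exists_act p hx
  obtain ⟨g', hg'⟩ := hs.exists_act q (h ▸ hx)
  have h1 := congrArg (fun p => B.act p g⁻¹) hg
  simp only [← B.act_mul, mul_inv_cancel, B.act_one] at h1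
  exact ⟨g⁻¹ * g', by rw [B.act_mul, h1, h, ← hg']⟩

/-- The differential of a section is a right inverse of the differential of the projection. -/
theorem mfderiv_proj_section {U : Set M} {s : M → P} (hU : IsOpen U)
    (hs : ContMDiffOn 𝓘(ℝ, E) 𝓘(ℝ, EP) ∞ s U) (hproj : ∀ x ∈ U, B.proj (s x) = x) {x : M}
    (hx : x ∈ U) (v : E) :
    mfderiv 𝓘(ℝ, EP) 𝓘(ℝ, E) B.proj (s x) (mfderiv 𝓘(ℝ, E) 𝓘(ℝ, EP) s x v) = v := by
  have h1 : MDifferentiableAt 𝓘(ℝ, E) 𝓘(ℝ, EP) s x :=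
    (hs.contMDiffAt (hU.mem_nhds hx)).mdifferentiableAt (by simp)
  have h2 : MDifferentiableAt 𝓘(ℝ, EP) 𝓘(ℝ, E) B.proj (s x) :=
    B.contMDiff_proj.mdifferentiableAt (by simp)
  have h3 : B.proj ∘ s =ᶠ[nhds x] id := by
    filter_upwards [hU.mem_nhds hx] with y hy using hproj y hy
  have h4 := mfderiv_comp x h2 h1
  rw [h3.mfderiv_eq, mfderiv_id] at h4
  exact (congrArg (fun L => L v) h4).symm

theorem contMDiff_act_right [IsManifold 𝓘(ℝ, EP) ∞ P] (g : G) :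
    ContMDiff 𝓘(ℝ, EP) 𝓘(ℝ, EP) ∞ fun p => B.act p g :=
  B.contMDiff_act.comp (contMDiff_id.prodMk contMDiff_const)

/-- The differential of the bundle projection has a right inverse at every point. -/
theorem exists_rightInverse_mfderiv_proj (p : P) :
    ∃ R : E →L[ℝ] TangentSpace 𝓘(ℝ, EP) p,
      ∀ v : E, mfderiv 𝓘(ℝ, EP) 𝓘(ℝ, E) B.proj p (R v) = v := by
  obtain ⟨U, s, hx, hs⟩ := B.exists_isLocalSection (B.proj p)
  obtain ⟨g, hg⟩ := hs.exists_act p hx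
  have h1 : ContMDiffOn 𝓘(ℝ, E) 𝓘(ℝ, EP) ∞ (fun y => B.act (s y) g) U :=
    B.contMDiff_act.comp_contMDiffOn (hs.contMDiffOn.prodMk contMDiffOn_const)
  have h2 := fun v => B.mfderiv_proj_section hs.isOpen h1
    (fun y hy => (B.proj_act _ _).trans (hs.proj_eq y hy)) hx v
  have h3 : ∀ q, q = p → (∃ R : E →L[ℝ] TangentSpace 𝓘(ℝ, EP) q,
      ∀ v : E, mfderiv 𝓘(ℝ, EP) 𝓘(ℝ, E) B.proj q (R v) = v) →
      ∃ R : E →L[ℝ] TangentSpace 𝓘(ℝ, EP) p,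
        ∀ v : E, mfderiv 𝓘(ℝ, EP) 𝓘(ℝ, E) B.proj p (R v) = v := by
    rintro q rfl h
    exact h
  exact h3 _ hg.symm ⟨mfderiv 𝓘(ℝ, E) 𝓘(ℝ, EP) (fun y => B.act (s y) g) (B.proj p), h2⟩

/-- Fundamental vector fields are vertical. -/
theorem mfderiv_proj_fundamental [LieGroup 𝓘(ℝ, EG) ∞ G] (p : P) (X : EG) :
    mfderiv 𝓘(ℝ, EP) 𝓘(ℝ, E) B.proj p (show EP from B.fundamental p X) = 0 := by
  have h1 : MDifferentiableAt 𝓘(ℝ, EG) 𝓘(ℝ, EP) (B.act p) 1 :=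
    (B.contMDiff_act.comp (contMDiff_const.prodMk contMDiff_id)).mdifferentiableAt (by simp)
  have h2 : MDifferentiableAt 𝓘(ℝ, EP) 𝓘(ℝ, E) B.proj (B.act p 1) :=
    B.contMDiff_proj.mdifferentiableAt (by simp)
  have h3 := mfderiv_comp 1 h2 h1
  have h4 : B.proj ∘ B.act p = fun _ => B.proj p := funext fun g => B.proj_act p g
  rw [h4, mfderiv_const] at h3
  have h5 := congrArg (fun L => L (lieEquiv EG G X)) h3
  have h6 : ∀ q, q = p → mfderiv 𝓘(ℝ, EP) 𝓘(ℝ, E) B.proj q (show EP from B.fundamental p X) = 0 →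
      mfderiv 𝓘(ℝ, EP) 𝓘(ℝ, E) B.proj p (show EP from B.fundamental p X) = 0 := by
    rintro q rfl h
    exact h
  exact h6 _ (B.act_one p) h5.symm

end PrincipalBundle

namespace GStructure

variable (S : GStructure E M EG G EP P V)

/-- The displacement form at `p` factors through the tangent space of `M`, since it vanishes on
vertical vectors. -/
theorem exists_coframe (p : P) : ∃ L : E →L[ℝ] V, ∀ X : TangentSpace 𝓘(ℝ, EP) p,
    L (mfderiv 𝓘(ℝ, EP) 𝓘(ℝ, E) S.proj p X) = covector S.theta p X := by
  obtain ⟨R, hR⟩ := S.exists_rightInverse_mfderiv_proj p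
  refine ⟨(covector S.theta p).comp R, fun X => ?_⟩
  change covector S.theta p (R (mfderiv 𝓘(ℝ, EP) 𝓘(ℝ, E) S.proj p X)) = _
  rw [← sub_eq_zero, ← map_sub, S.ker_theta, map_sub, sub_eq_zero]
  exact hR _

/-- The coframe `T_x M → V` at `x = π(p)` which the point `p` of the `G`-structure stands for: the
linear map through which the displacement form at `p` factors. -/
def coframe (p : P) : E →L[ℝ] V := (S.exists_coframe p).choose

theorem coframe_mfderiv_proj (p : P) (X : TangentSpace 𝓘(ℝ, EP) p) :
    S.coframe p (mfderiv 𝓘(ℝ, EP) 𝓘(ℝ, E) S.proj p X) = covector S.theta p X :=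
  (S.exists_coframe p).choose_spec X

theorem coframe_injective (p : P) : Function.Injective (S.coframe p) := by
  rw [injective_iff_map_eq_zero]
  intro u hu
  obtain ⟨R, hR⟩ := S.exists_rightInverse_mfderiv_proj p
  rw [← hR u] at hu ⊢
  rwa [S.coframe_mfderiv_proj, S.ker_theta] at hu

/-- The coframe is equivariant. -/
theorem coframe_act [IsManifold 𝓘(ℝ, EP) ∞ P] (p : P) (g : G) :
    S.coframe (S.act p g) = (S.rep g⁻¹ : V →L[ℝ] V).comp (S.coframe p) := by
  ext u
  obtain ⟨R, hR⟩ := S.exists_rightInverse_mfderiv_proj p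
  have h1 : MDifferentiableAt 𝓘(ℝ, EP) 𝓘(ℝ, EP) (fun q => S.act q g) p :=
    (S.contMDiff_act_right g).mdifferentiableAt (by simp)
  have h2 : MDifferentiableAt 𝓘(ℝ, EP) 𝓘(ℝ, E) S.proj (S.act p g) :=
    S.contMDiff_proj.mdifferentiableAt (by simp)
  have h3 := mfderiv_comp p h2 h1
  have h4 : S.proj ∘ (fun q => S.act q g) = S.proj := funext fun q => S.proj_act q g
  rw [h4] at h3
  have h5 : mfderiv 𝓘(ℝ, EP) 𝓘(ℝ, E) S.proj p (R u) =
      mfderiv 𝓘(ℝ, EP) 𝓘(ℝ, E) S.proj (S.act p g) (S.rightDeriv g p (R u)) :=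
    congrArg (fun L => L (R u)) h3
  have h6 := S.coframe_mfderiv_proj (S.act p g) (S.rightDeriv g p (R u))
  rw [S.equivariant, ← S.coframe_mfderiv_proj] at h6
  rw [hR] at h5 h6
  rw [ContinuousLinearMap.comp_apply]
  exact (congrArg (S.coframe (S.act p g)) h5).trans h6

theorem insertTheta_apply {k : ℕ} (f : AltForm V k) (p : P) :
    S.insertTheta f p = (f.compContinuousLinearMap (S.coframe p)).compContinuousLinearMap
      (mfderiv 𝓘(ℝ, EP) 𝓘(ℝ, E) S.proj p) := by
  ext v
  refine congrArg f (funext fun i => ?_)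
  exact (S.coframe_mfderiv_proj p (v i)).symm

/-- The form `s^*(f(θ,…,θ))`, for a local section `s`. -/
def localForm (s : M → P) {k : ℕ} (f : AltForm V k) : FormField E M ℝ k :=
  FormField.pullback s (S.insertTheta f)

theorem localForm_apply {U : Set M} {s : M → P} (hs : S.IsLocalSection U s) {k : ℕ}
    (f : AltForm V k) {x : M} (hx : x ∈ U) :
    S.localForm s f x = f.compContinuousLinearMap (S.coframe (s x)) := by
  ext v
  refine congrArg f (funext fun i => ?_)
  refine (S.coframe_mfderiv_proj (s x) _).symm.trans ?_
  exact congrArg (S.coframe (s x))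
    (S.mfderiv_proj_section hs.isOpen hs.contMDiffOn hs.proj_eq hx (v i))

/-- The displacement form in the preferred chart around `c`, as a family of linear maps. -/
def thetaInChart (c : P) (z : EP) : EP →L[ℝ] V :=
  (ContinuousAlternatingMap.ofSubsingletonLIE (𝕜 := ℝ) (E := EP) (F := V) (i := (0 : Fin 1))).symm
    (FormField.inChart S.theta.1 c z)

theorem contDiffOn_thetaInChart (c : P) :
    ContDiffOn ℝ ∞ (S.thetaInChart c) (chartAt EP c).target :=
  (ContinuousAlternatingMap.ofSubsingletonLIE (𝕜 := ℝ) (E := EP) (F := V)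
    (i := (0 : Fin 1))).symm.contDiff.comp_contDiffOn (S.theta.2 c)

theorem inChart_insertTheta {k : ℕ} (f : AltForm V k) (c : P) (z : EP) :
    (S.insertTheta f).inChart c z = f.compContinuousLinearMap (S.thetaInChart c z) := rfl

theorem insertTheta_mem {k : ℕ} (f : AltForm V k) : S.insertTheta f ∈ DiffForm EP P ℝ k :=
  fun c => by
    have h := contDiffOn_compContinuousLinearMap (contDiffOn_const (c := f))
      (S.contDiffOn_thetaInChart c)
    exact h

theorem contDiffAt_inChart_localForm [IsManifold 𝓘(ℝ, E) ∞ M] [IsManifold 𝓘(ℝ, EP) ∞ P]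
    {U : Set M} {s : M → P} (hs : S.IsLocalSection U s)
    {k : ℕ} (f : AltForm V k) {c : M} {y : E} (hy : y ∈ (chartAt E c).target)
    (hyU : (chartAt E c).symm y ∈ U) : ContDiffAt ℝ ∞ ((S.localForm s f).inChart c) y :=
  contDiffAt_inChart_pullback (c' := s ((chartAt E c).symm y)) hy
    (hs.contMDiffOn.contMDiffAt (hs.isOpen.mem_nhds hyU)) (mem_chart_source _ _)
    (contDiffAt_inChart (S.insertTheta_mem f) _ (chartExpr_mem_target (mem_chart_source _ _)))

/-- A form on `V` is locally invariant if it is invariant under all elements of the structure group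
near `1`. -/
def LocallyInvariant {k : ℕ} (f : AltForm V k) : Prop :=
  ∀ᶠ g in nhds (1 : G), f.compContinuousLinearMap (S.rep g : V →L[ℝ] V) = f

/-- For a locally invariant form `f`, the form `f(θ,…,θ)` is the pullback of `s^*(f(θ,…,θ))` near
the section `s`. -/
theorem insertTheta_eventuallyEq_pullback [IsTopologicalGroup G] [IsManifold 𝓘(ℝ, EP) ∞ P]
    {U : Set M} {s : M → P}
    (hs : S.IsLocalSection U s) {k : ℕ} {f : AltForm V k} (hf : S.LocallyInvariant f) {x : M}
    (hx : x ∈ U) :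
    ∀ᶠ p in nhds (s x),
      S.insertTheta f p = FormField.pullback (EP := EP) S.proj (S.localForm s f) p := by
  have hN : {g : G | f.compContinuousLinearMap (S.rep g⁻¹ : V →L[ℝ] V) = f} ∈ nhds (1 : G) :=
    (continuous_inv.tendsto' (1 : G) 1 inv_one).eventually hf
  have hU : ∀ᶠ p in nhds (s x), S.proj p ∈ U := by
    refine S.contMDiff_proj.continuous.continuousAt.eventually (hs.isOpen.mem_nhds ?_)
    rwa [hs.proj_eq x hx]
  filter_upwards [hs.eventually_act x hx _ hN, hU] with p hp hpU
  obtain ⟨g, hg, hgp⟩ := hp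
  rw [S.insertTheta_apply, FormField.pullback, S.localForm_apply hs f hpU]
  congr 1
  have h := S.coframe_act (s (S.proj p)) g
  rw [← hgp] at h
  rw [h]
  ext v
  exact congrArg (fun f => f fun i => S.coframe (s (S.proj p)) (v i)) hg

/-- For a torsion-free connection, the derivative of the displacement form is symmetric on
horizontal vectors. -/
theorem fderiv_thetaInChart_symm {C : S.toPrincipalBundle.Connection} (hC : S.torsion C = 0)
    (p : P) (X Y : TangentSpace 𝓘(ℝ, EP) p) :
    fderiv ℝ (S.thetaInChart p) (chartAt EP p p) (chartDeriv p p (C.horProj p X))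
        (chartDeriv p p (C.horProj p Y)) =
      fderiv ℝ (S.thetaInChart p) (chartAt EP p p) (chartDeriv p p (C.horProj p Y))
        (chartDeriv p p (C.horProj p X)) := by
  have h := congrArg (fun w => w p ![X, Y]) hC
  have hd := differentiableAt_inChart S.theta.2 p
  change extDeriv (FormField.inChart S.theta.1 p) (chartAt EP p p)
    (fun i => chartDeriv p p (C.horProj p (![X, Y] i))) = 0 at h
  rw [extDeriv, ContinuousAlternatingMap.alternatizeUncurryFin_apply, Fin.sum_univ_two] at h
  have hA (u v : EP) : fderiv ℝ (S.thetaInChart p) (chartAt EP p p) u v =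
      fderiv ℝ (FormField.inChart S.theta.1 p) (chartAt EP p p) u (fun _ => v) := by
    have h1 := ((ContinuousAlternatingMap.ofSubsingletonLIE (𝕜 := ℝ) (E := EP) (F := V)
      (i := (0 : Fin 1))).symm.toContinuousLinearEquiv.hasFDerivAt.comp _ hd.hasFDerivAt).fderiv
    change fderiv ℝ (S.thetaInChart p) (chartAt EP p p) = _ at h1
    rw [h1]
    rfl
  rw [hA, hA]
  have e (i : Fin 2) (Z : TangentSpace 𝓘(ℝ, EP) p) (hZ : ∀ j, ![X, Y] (i.succAbove j) = Z) :
      i.removeNth (fun i => chartDeriv p p (C.horProj p (![X, Y] i))) =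
        fun _ => chartDeriv p p (C.horProj p Z) :=
    funext fun j => congrArg (fun Z => chartDeriv p p (C.horProj p Z)) (hZ j)
  have hY (j : Fin 1) : ![X, Y] ((0 : Fin 2).succAbove j) = Y := by
    fin_cases j
    rfl
  have hX (j : Fin 1) : ![X, Y] ((1 : Fin 2).succAbove j) = X := by
    fin_cases j
    rfl
  rw [e 0 Y hY, e 1 X hX] at h
  simp only [Fin.val_zero, pow_zero, one_smul, Fin.val_one, pow_one, neg_smul] at h
  exact add_neg_eq_zero.1 h

end GStructure

end LocalGeometry

/-! ### Torsion-free connections and closed forms -/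

section Closedness

variable {E : Type*} [NormedAddCommGroup E] [NormedSpace ℝ E]
  {M : Type*} [TopologicalSpace M] [ChartedSpace E M] [IsManifold 𝓘(ℝ, E) ∞ M]
  {EG : Type*} [NormedAddCommGroup EG] [NormedSpace ℝ EG]
  {G : Type*} [TopologicalSpace G] [ChartedSpace EG G] [Group G] [LieGroup 𝓘(ℝ, EG) ∞ G]
  {EP : Type*} [NormedAddCommGroup EP] [NormedSpace ℝ EP]
  {P : Type*} [TopologicalSpace P] [ChartedSpace EP P] [IsManifold 𝓘(ℝ, EP) ∞ P]
  {V : Type*} [NormedAddCommGroup V] [NormedSpace ℝ V]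

namespace GStructure

variable (S : GStructure E M EG G EP P V)

/-- If the `G`-structure has a torsion-free connection, then the form `s^*(f(θ,…,θ))` is closed for
every locally invariant `f`: its pullback to `P` agrees near `s` with `f(θ,…,θ)`, whose exterior
derivative vanishes on horizontal vectors, and all vectors lift to horizontal ones. -/
theorem extDeriv_localForm_eq_zero {C : S.toPrincipalBundle.Connection} (hC : S.torsion C = 0)
    {U : Set M} {s : M → P} (hs : S.IsLocalSection U s) {k : ℕ} {f : AltForm V k}
    (hf : S.LocallyInvariant f) {c : M} {y : E} (hy : y ∈ (chartAt E c).target)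
    (hyU : (chartAt E c).symm y ∈ U) : extDeriv ((S.localForm s f).inChart c) y = 0 := by
  have : IsTopologicalGroup G := topologicalGroup_of_lieGroup 𝓘(ℝ, EG) ∞
  obtain ⟨x, hx⟩ : ∃ x, x = (chartAt E c).symm y := ⟨_, rfl⟩
  obtain ⟨p, hp⟩ : ∃ p, p = s x := ⟨_, rfl⟩
  obtain ⟨z, hz⟩ : ∃ z, z = chartAt EP p p := ⟨_, rfl⟩
  have hxU : x ∈ U := hx ▸ hyU
  have hxc : x ∈ (chartAt E c).source := hx ▸ (chartAt E c).map_target hy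
  have hcx : chartAt E c x = y := hx ▸ (chartAt E c).right_inv hy
  have hpx : S.proj p = x := hp ▸ hs.proj_eq x hxU
  have hzp : (chartAt EP p).symm z = p := hz ▸ (chartAt EP p).left_inv (mem_chart_source _ _)
  have hzt : z ∈ (chartAt EP p).target := hz ▸ (chartAt EP p).map_source (mem_chart_source _ _)
  have hc' : S.proj ((chartAt EP p).symm z) ∈ (chartAt E c).source := by rwa [hzp, hpx]
  have hyz : chartExpr S.proj p c z = y := by
    change chartAt E c (S.proj ((chartAt EP p).symm z)) = y
    rw [hzp, hpx, hcx]
  have hpull := extDeriv_inChart_pullback (w := S.localForm s f) hzt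
    S.contMDiff_proj.contMDiffAt hc'
    (by rw [hyz]; exact S.contDiffAt_inChart_localForm hs f hy hyU)
  have hev : (FormField.pullback (EP := EP) S.proj (S.localForm s f)).inChart p =ᶠ[nhds z]
      fun z' => f.compContinuousLinearMap (S.thetaInChart p z') := by
    have h := S.insertTheta_eventuallyEq_pullback hs hf hxU
    rw [← hp, ← hzp] at h
    filter_upwards [eventually_chart_symm hzt h] with z' hz'
    rw [← S.inChart_insertTheta, FormField.inChart, FormField.inChart, hz'.2]
  rw [hev.extDeriv_eq, hyz] at hpull
  ext v
  -- Lift the given vectors to horizontal vectors at `p`.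
  obtain ⟨R, hR⟩ := S.exists_rightInverse_mfderiv_proj p
  set X : Fin (k + 1) → TangentSpace 𝓘(ℝ, EP) p :=
    fun i => C.horProj p (R (chartSymmDeriv c y (v i))) with hX
  have hXproj (i : Fin (k + 1)) :
      mfderiv 𝓘(ℝ, EP) 𝓘(ℝ, E) S.proj p (X i) = chartSymmDeriv c y (v i) := by
    have h1 := S.mfderiv_proj_fundamental p (covector C.form p (R (chartSymmDeriv c y (v i))))
    have h2 := map_sub (mfderiv 𝓘(ℝ, EP) 𝓘(ℝ, E) S.proj p) (R (chartSymmDeriv c y (v i)))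
      (S.fundamental p (covector C.form p (R (chartSymmDeriv c y (v i)))))
    refine h2.trans ?_
    refine (congrArg₂ (fun a b : E => a - b) (hR _) h1).trans ?_
    exact sub_zero _
  have hD (i : Fin (k + 1)) :
      fderiv ℝ (chartExpr S.proj p c) z (chartDeriv p p (X i)) = v i := by
    rw [fderiv_chartExpr hzt (S.contMDiff_proj.mdifferentiableAt (by simp)) hc']
    have h1 : chartSymmDeriv p z (chartDeriv p p (X i)) = (X i : EP) := by
      rw [hz]
      exact chartDeriv_comp_chartSymmDeriv p p (mem_chart_source _ _) (X i)
    have h2 : ∀ q, q = p → chartDeriv c (S.proj q)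
        (mfderiv 𝓘(ℝ, EP) 𝓘(ℝ, E) S.proj q (show EP from X i)) = v i := by
      rintro q rfl
      refine (congrArg (chartDeriv c (S.proj q)) (hXproj i)).trans ?_
      rw [hpx, hx]
      exact chartSymmDeriv_comp_chartDeriv c hy (v i)
    refine Eq.trans ?_ (h2 _ hzp)
    exact congrArg (fun e : EP => chartDeriv c (S.proj ((chartAt EP p).symm z))
      (mfderiv 𝓘(ℝ, EP) 𝓘(ℝ, E) S.proj ((chartAt EP p).symm z) e)) h1
  have h := congrArg (fun w => w fun i => chartDeriv p p (X i)) hpull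
  simp only [ContinuousAlternatingMap.compContinuousLinearMap_apply] at h
  have h0 : extDeriv (fun z' => f.compContinuousLinearMap (S.thetaInChart p z')) z
      (fun i => chartDeriv p p (X i)) = 0 := by
    refine extDeriv_comp_apply_eq_zero f ?_ _ fun i j => ?_
    · exact ((S.contDiffOn_thetaInChart p).contDiffAt
        ((chartAt EP p).open_target.mem_nhds hzt)).differentiableAt (by simp)
    · rw [hz]
      exact S.fderiv_thetaInChart_symm hC p _ _
  rw [h0] at h
  have h3 : (⇑(fderiv ℝ (chartExpr S.proj p c) z) ∘ fun i => chartDeriv p p (X i)) = v :=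
    funext hD
  rw [h3] at h
  exact h.symm

end GStructure

end Closedness

/-! ### The characteristic map -/

section CharacteristicMap

variable {E : Type*} [NormedAddCommGroup E] [NormedSpace ℝ E]
  {M : Type*} [TopologicalSpace M] [ChartedSpace E M]

/-- Evaluation of differential forms at a point, as a homomorphism of algebras. Mathlib realizes the
tangent space at `x` on the model space `E`. -/
def Omega.evalAt (x : M) : Omega E M →ₐ[ℝ] ExtAlg E :=
  DirectSum.toAlgebra ℝ (RForm E M)
    (fun k => DirectSum.lof ℝ ℕ (AltForm E) k ∘ₗ
      { toFun := fun a => a.1 x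
        map_add' := fun _ _ => rfl
        map_smul' := fun _ _ => rfl })
    rfl
    (fun _ _ => (DirectSum.of_mul_of (A := AltForm E) _ _).symm)

theorem Omega.evalAt_apply (x : M) (a : Omega E M) (k : ℕ) : Omega.evalAt x a k = (a k).1 x := by
  induction a using DirectSum.induction_on with
  | zero => rw [map_zero]; rfl
  | of i a =>
    have h : Omega.evalAt x (DirectSum.of (RForm E M) i a) = DirectSum.of (AltForm E) i (a.1 x) :=
      (DirectSum.toAlgebra_apply ..).trans (DirectSum.toSemiring_of _ _ _ i a)
    refine (congrArg (fun b => b k) h).trans ?_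
    by_cases hik : i = k
    · subst hik
      rw [DirectSum.of_eq_same]
      exact DirectSum.of_eq_same i (β := AltForm E) (a.1 x)
    · rw [DirectSum.of_eq_of_ne (β := RForm E M) _ _ _ (Ne.symm hik)]
      exact DirectSum.of_eq_of_ne (β := AltForm E) _ _ _ (Ne.symm hik)
  | add a b ha hb =>
    rw [map_add, DirectSum.add_apply, ha, hb, DirectSum.add_apply]
    rfl

theorem Omega.ext_evalAt {a b : Omega E M} (h : ∀ x, Omega.evalAt x a = Omega.evalAt x b) :
    a = b :=
  DFinsupp.ext fun k => RForm.ext fun x => by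
    rw [← Omega.evalAt_apply, ← Omega.evalAt_apply, h]

theorem Omega.d_apply_succ [IsManifold 𝓘(ℝ, E) ∞ M] (a : Omega E M) (k : ℕ) :
    Omega.d a (k + 1) = RForm.d (a k) := by
  induction a using DirectSum.induction_on with
  | zero => rw [map_zero]; exact (map_zero _).symm
  | of i a =>
    rw [Omega.d_of]
    by_cases hik : i = k
    · subst hik
      rw [DirectSum.of_eq_same, DirectSum.of_eq_same]
    · rw [DirectSum.of_eq_of_ne _ _ _ (Ne.symm hik), DirectSum.of_eq_of_ne _ _ _ (by omega),
        map_zero]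
  | add a b ha hb => rw [map_add, DirectSum.add_apply, ha, hb, DirectSum.add_apply, map_add]

theorem Omega.d_apply_zero [IsManifold 𝓘(ℝ, E) ∞ M] (a : Omega E M) : Omega.d a 0 = 0 := by
  induction a using DirectSum.induction_on with
  | zero => rw [map_zero]; rfl
  | of i a => rw [Omega.d_of, DirectSum.of_eq_of_ne _ _ _ (by omega)]
  | add a b ha hb => rw [map_add, DirectSum.add_apply, ha, hb, add_zero]

variable {EG : Type*} [NormedAddCommGroup EG] [NormedSpace ℝ EG]
  {G : Type*} [TopologicalSpace G] [ChartedSpace EG G] [Group G]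
  {EP : Type*} [NormedAddCommGroup EP] [NormedSpace ℝ EP]
  {P : Type*} [TopologicalSpace P] [ChartedSpace EP P]
  {V : Type*} [NormedAddCommGroup V] [NormedSpace ℝ V]

namespace GStructure

variable (S : GStructure E M EG G EP P V)

/-- An arbitrary, not necessarily continuous, choice of points in the fibres. -/
def point (x : M) : P := (S.proj_surjective x).choose

theorem proj_point (x : M) : S.proj (S.point x) = x := (S.proj_surjective x).choose_spec

/-- The form on `M` obtained from a form `f` on `V` by means of the coframes at the points
`S.point x`. It does not depend on these points if `f` is invariant. -/
def nuForm {k : ℕ} (f : AltForm V k) : FormField E M ℝ k :=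
  fun x => f.compContinuousLinearMap (S.coframe (S.point x))

/-- A map with values in `Ω(M)` satisfies the defining property of the characteristic map if and
only if it is pointwise induced by the coframes. -/
theorem isCharacteristicMap_iff {nu : invariantForms S.rep → Omega E M} :
    S.IsCharacteristicMap nu ↔
      ∀ f p, Omega.evalAt (S.proj p) (nu f) = ExtAlg.map (S.coframe p) f.1 := by
  have key (f : invariantForms S.rep) (k : ℕ) (p : P) :
      FormField.pullback S.proj (nu f k).1 p = S.insertTheta (f.1 k) p ↔
        (nu f k).1 (S.proj p) = (f.1 k).compContinuousLinearMap (S.coframe p) := by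
    rw [S.insertTheta_apply]
    constructor
    · intro h
      obtain ⟨R, hR⟩ := S.exists_rightInverse_mfderiv_proj p
      ext v
      have h1 := congrArg (fun w => w fun i => R (v i)) h
      have h2 : (fun i => mfderiv 𝓘(ℝ, EP) 𝓘(ℝ, E) S.proj p (R (v i))) = v :=
        funext fun i => hR (v i)
      change (nu f k).1 (S.proj p) (fun i => mfderiv 𝓘(ℝ, EP) 𝓘(ℝ, E) S.proj p (R (v i))) =
        (f.1 k) (fun i => S.coframe p (mfderiv 𝓘(ℝ, EP) 𝓘(ℝ, E) S.proj p (R (v i)))) at h1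
      have h3 : (fun i => S.coframe p (mfderiv 𝓘(ℝ, EP) 𝓘(ℝ, E) S.proj p (R (v i)))) =
          fun i => S.coframe p (v i) := funext fun i => congrArg (S.coframe p) (hR (v i))
      rw [h3] at h1
      exact (congrArg ((nu f k).1 (S.proj p)) h2).symm.trans h1
    · intro h
      rw [FormField.pullback, h]
      rfl
  constructor
  · intro h f p
    refine DFinsupp.ext fun k => ?_
    rw [Omega.evalAt_apply, ExtAlg.map_apply]
    exact (key f k p).1 (congrFun (h f k) p)
  · intro h f k
    refine funext fun p => (key f k p).2 ?_
    rw [← Omega.evalAt_apply, h, ExtAlg.map_apply]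

theorem IsCharacteristicMap.unique {nu nu' : invariantForms S.rep → Omega E M}
    (h : S.IsCharacteristicMap nu) (h' : S.IsCharacteristicMap nu') : nu' = nu := by
  rw [isCharacteristicMap_iff] at h h'
  funext f
  refine Omega.ext_evalAt fun x => ?_
  obtain ⟨p, rfl⟩ := S.proj_surjective x
  rw [h, h']

theorem coframe_surjective [FiniteDimensional ℝ E] [FiniteDimensional ℝ V] (p : P) :
    Function.Surjective (S.coframe p) :=
  (LinearMap.injective_iff_surjective_of_finrank_eq_finrank
    (f := (S.coframe p).toLinearMap) S.finrank_eq.symm).1 (S.coframe_injective p)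

theorem compContinuousLinearMap_coframe_injective [FiniteDimensional ℝ E]
    [FiniteDimensional ℝ V] (k : ℕ) (p : P) :
    Function.Injective fun f : AltForm V k => f.compContinuousLinearMap (S.coframe p) := by
  intro f f' h
  ext v
  choose u hu using fun i => S.coframe_surjective p (v i)
  have h3 : (fun i => S.coframe p (u i)) = v := funext hu
  rw [← h3]
  exact congrArg (fun w => w u) h

variable [IsManifold 𝓘(ℝ, EP) ∞ P]

theorem nuForm_proj {k : ℕ} {f : AltForm V k}
    (hf : ∀ g : G, f.compContinuousLinearMap (S.rep g : V →L[ℝ] V) = f) (p : P) :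
    S.nuForm f (S.proj p) = f.compContinuousLinearMap (S.coframe p) := by
  obtain ⟨g, hg⟩ := S.exists_act_eq (S.proj_point (S.proj p)).symm
  rw [nuForm, hg, S.coframe_act]
  ext v
  exact congrArg (fun f => f fun i => S.coframe p (v i)) (hf g⁻¹)

theorem nuForm_eq_localForm {U : Set M} {s : M → P} (hs : S.IsLocalSection U s) {k : ℕ}
    {f : AltForm V k} (hf : ∀ g : G, f.compContinuousLinearMap (S.rep g : V →L[ℝ] V) = f) {x : M}
    (hx : x ∈ U) : S.nuForm f x = S.localForm s f x := by
  rw [S.localForm_apply hs f hx, ← S.nuForm_proj hf, hs.proj_eq x hx]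

theorem eventually_inChart_nuForm {U : Set M} {s : M → P} (hs : S.IsLocalSection U s) {k : ℕ}
    {f : AltForm V k} (hf : ∀ g : G, f.compContinuousLinearMap (S.rep g : V →L[ℝ] V) = f) {c : M}
    {y : E} (hy : y ∈ (chartAt E c).target) (hyU : (chartAt E c).symm y ∈ U) :
    (S.nuForm f).inChart c =ᶠ[nhds y] (S.localForm s f).inChart c := by
  filter_upwards [eventually_chart_symm hy (hs.isOpen.mem_nhds hyU)] with z hz
  rw [FormField.inChart, FormField.inChart, S.nuForm_eq_localForm hs hf hz.2]

variable [IsManifold 𝓘(ℝ, E) ∞ M]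

theorem nuForm_mem {k : ℕ} {f : AltForm V k}
    (hf : ∀ g : G, f.compContinuousLinearMap (S.rep g : V →L[ℝ] V) = f) :
    S.nuForm f ∈ DiffForm E M ℝ k := fun c y hy => by
  obtain ⟨U, s, hx, hs⟩ := S.exists_isLocalSection ((chartAt E c).symm y)
  exact ((S.contDiffAt_inChart_localForm hs f hy hx).congr_of_eventuallyEq
    (S.eventually_inChart_nuForm hs hf hy hx)).contDiffWithinAt

open Classical in
/-- The degree `k` part of the characteristic map, extended by zero to the forms that are not
invariant. -/
def nuDeg (k : ℕ) (f : AltForm V k) : RForm E M k :=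
  if hf : ∀ g : G, f.compContinuousLinearMap (S.rep g : V →L[ℝ] V) = f then
    ⟨S.nuForm f, S.nuForm_mem hf⟩
  else 0

theorem nuDeg_apply {k : ℕ} {f : AltForm V k}
    (hf : ∀ g : G, f.compContinuousLinearMap (S.rep g : V →L[ℝ] V) = f) (x : M) :
    (S.nuDeg k f).1 x = S.nuForm f x :=
  congrArg (fun a : RForm E M k => a.1 x) (dif_pos hf)

theorem nuDeg_zero (k : ℕ) : S.nuDeg k 0 = 0 :=
  RForm.ext fun x => S.nuDeg_apply (fun _ => rfl) x

/-- The underlying map of the characteristic map. -/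
def nuFun (f : invariantForms S.rep) : Omega E M :=
  DFinsupp.mapRange S.nuDeg S.nuDeg_zero f.1

theorem nuFun_apply (f : invariantForms S.rep) (k : ℕ) : S.nuFun f k = S.nuDeg k (f.1 k) :=
  DFinsupp.mapRange_apply _ _ _ _

theorem evalAt_nuFun (f : invariantForms S.rep) (p : P) :
    Omega.evalAt (S.proj p) (S.nuFun f) = ExtAlg.map (S.coframe p) f.1 := by
  refine DFinsupp.ext fun k => ?_
  have hf : ∀ g : G, (f.1 k).compContinuousLinearMap (S.rep g : V →L[ℝ] V) = f.1 k :=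
    fun g => f.2 g k
  rw [Omega.evalAt_apply, ExtAlg.map_apply, nuFun_apply, S.nuDeg_apply hf, S.nuForm_proj hf]

/-- The characteristic map `ν : Λ(V*)^G → Ω(M)`. It is multiplicative since it is so at every
point. -/
def nu : invariantForms S.rep →ₐ[ℝ] Omega E M where
  toFun := S.nuFun
  map_one' := Omega.ext_evalAt fun x => by
    obtain ⟨p, rfl⟩ := S.proj_surjective x
    rw [evalAt_nuFun, map_one]
    exact map_one _
  map_mul' f f' := Omega.ext_evalAt fun x => by
    obtain ⟨p, rfl⟩ := S.proj_surjective x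
    rw [map_mul, evalAt_nuFun, evalAt_nuFun, evalAt_nuFun]
    exact map_mul _ f.1 f'.1
  map_zero' := Omega.ext_evalAt fun x => by
    obtain ⟨p, rfl⟩ := S.proj_surjective x
    rw [evalAt_nuFun, map_zero]
    exact map_zero _
  map_add' f f' := Omega.ext_evalAt fun x => by
    obtain ⟨p, rfl⟩ := S.proj_surjective x
    rw [map_add, evalAt_nuFun, evalAt_nuFun, evalAt_nuFun]
    exact map_add _ f.1 f'.1
  commutes' r := Omega.ext_evalAt fun x => by
    obtain ⟨p, rfl⟩ := S.proj_surjective x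
    rw [evalAt_nuFun, AlgHom.commutes]
    exact AlgHom.commutes _ r

theorem isCharacteristicMap_nu : S.IsCharacteristicMap S.nu :=
  S.isCharacteristicMap_iff.2 S.evalAt_nuFun

theorem nu_apply (f : invariantForms S.rep) (k : ℕ) (x : M) :
    (S.nu f k).1 x = S.nuForm (f.1 k) x :=
  (congrArg (fun a : RForm E M k => a.1 x) (S.nuFun_apply f k)).trans
    (S.nuDeg_apply (fun g => f.2 g k) x)

end GStructure

end CharacteristicMap

section ClosedForms

variable {E : Type*} [NormedAddCommGroup E] [NormedSpace ℝ E]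
  {M : Type*} [TopologicalSpace M] [ChartedSpace E M] [IsManifold 𝓘(ℝ, E) ∞ M]
  {EG : Type*} [NormedAddCommGroup EG] [NormedSpace ℝ EG]
  {G : Type*} [TopologicalSpace G] [ChartedSpace EG G] [Group G] [LieGroup 𝓘(ℝ, EG) ∞ G]
  {EP : Type*} [NormedAddCommGroup EP] [NormedSpace ℝ EP]
  {P : Type*} [TopologicalSpace P] [ChartedSpace EP P] [IsManifold 𝓘(ℝ, EP) ∞ P]
  {V : Type*} [NormedAddCommGroup V] [NormedSpace ℝ V]

/-- The characteristic forms of a `1`-integrable `G`-structure are closed. -/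
theorem GStructure.nu_mem_closedForms (S : GStructure E M EG G EP P V) (h : S.OneIntegrable)
    (f : invariantForms S.rep) : S.nu f ∈ closedForms E M := by
  obtain ⟨C, hC⟩ := h
  refine DFinsupp.ext fun k => ?_
  rcases k with - | k
  · exact Omega.d_apply_zero _
  rw [Omega.d_apply_succ]
  refine RForm.ext fun x => ?_
  obtain ⟨U, s, hx, hs⟩ := S.exists_isLocalSection x
  have hf : ∀ g : G, (f.1 k).compContinuousLinearMap (S.rep g : V →L[ℝ] V) = f.1 k :=
    fun g => f.2 g k
  have hy : chartAt E x x ∈ (chartAt E x).target :=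
    (chartAt E x).map_source (mem_chart_source E x)
  have hyU : (chartAt E x).symm (chartAt E x x) ∈ U := by
    rwa [(chartAt E x).left_inv (mem_chart_source E x)]
  have hnu : (S.nu f k).1 = S.nuForm (f.1 k) := funext fun x => S.nu_apply f k x
  change (extDeriv (FormField.inChart (S.nu f k).1 x) (chartAt E x x)).compContinuousLinearMap
    (chartDeriv x x) = 0
  rw [hnu, (S.eventually_inChart_nuForm hs hf hy hyU).extDeriv_eq,
    S.extDeriv_localForm_eq_zero hC hs (Filter.Eventually.of_forall hf) hy hyU]
  rfl

end ClosedForms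

/-! ### Forms of complementary degree and averaging over a compact group -/

section WedgePairing

variable {V : Type*} [NormedAddCommGroup V] [NormedSpace ℝ V]

/-- A top degree form that does not vanish identically does not vanish on bases. -/
theorem apply_basis_ne_zero {n : ℕ} {μ : AltForm V n} (hμ : μ ≠ 0)
    (b : Module.Basis (Fin n) ℝ V) : μ b ≠ 0 := fun h =>
  hμ <| ContinuousAlternatingMap.toAlternatingMap_injective
    ((μ.toAlternatingMap.map_basis_eq_zero_iff b).1 h)

variable [FiniteDimensional ℝ V]

/-- A linearly independent family can be extended to a basis. -/
theorem exists_basis_castAdd_eq {k q : ℕ} (hn : Module.finrank ℝ V = k + q) {v : Fin k → V}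
    (hv : LinearIndependent ℝ v) :
    ∃ b : Module.Basis (Fin (k + q)) ℝ V, ∀ i, b (Fin.castAdd q i) = v i := by
  have b := Module.Basis.sumExtend hv
  have : Finite (Fin k ⊕ Module.Basis.sumExtendIndex hv) := Module.Finite.finite_basis b
  have : Finite (Module.Basis.sumExtendIndex hv) := Finite.sum_right (Fin k)
  cases nonempty_fintype (Module.Basis.sumExtendIndex hv)
  have hcard := Module.finrank_eq_card_basis b
  rw [Fintype.card_sum, Fintype.card_fin, hn] at hcard
  let e := Fintype.equivFinOfCardEq
    (show Fintype.card (Module.Basis.sumExtendIndex hv) = q by omega)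
  refine ⟨(Module.Basis.sumExtend hv).reindex (((Equiv.refl _).sumCongr e).trans finSumFinEquiv),
    fun i => ?_⟩
  simp only [Module.Basis.sumExtend, Module.Basis.reindex_apply, Equiv.symm_trans_apply,
    finSumFinEquiv_symm_apply_castAdd, Equiv.sumCongr_symm, Equiv.sumCongr_apply, Sum.map_inl,
    Equiv.refl_symm, Equiv.refl_apply, Module.Basis.extend_apply_self]
  rfl

/-- The alternating form `u ↦ det (L (u i) j)`. -/
def detForm {q : ℕ} (L : V →ₗ[ℝ] Fin q → ℝ) : AltForm V q :=
  { (Matrix.detRowAlternating (R := ℝ) (n := Fin q)).compLinearMap L with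
    cont := by
      refine Continuous.matrix_det (A := fun u : Fin q → V => Matrix.of fun i => L (u i)) ?_
      refine continuous_pi fun i => ?_
      exact L.continuous_of_finiteDimensional.comp (continuous_apply i) }

theorem detForm_apply {q : ℕ} (L : V →ₗ[ℝ] Fin q → ℝ) (u : Fin q → V) :
    detForm L u = Matrix.det (Matrix.of fun i => L (u i)) := rfl

/-- The wedge pairing of forms of complementary degrees is nondegenerate: if `f (v₁,…,v_k) ≠ 0`,
extend the `vᵢ` to a basis and take the product of the last dual basis vectors. -/
theorem exists_wedge_ne_zero {k q : ℕ} (hn : Module.finrank ℝ V = k + q) {f : AltForm V k}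
    (hf : f ≠ 0) : ∃ f' : AltForm V q, wedge f f' ≠ 0 := by
  obtain ⟨v, hv⟩ : ∃ v, f v ≠ 0 := by
    by_contra! h
    exact hf (ContinuousAlternatingMap.ext h)
  have hli : LinearIndependent ℝ v := by
    by_contra h
    exact hv (f.toAlternatingMap.map_linearDependent v h)
  obtain ⟨b, hb⟩ := exists_basis_castAdd_eq hn hli
  set f' : AltForm V q := detForm (LinearMap.pi fun j => b.coord (Fin.natAdd k j)) with hf'
  have hf'b : f' (b ∘ Fin.natAdd k) = 1 := by
    rw [hf', detForm_apply, ← Matrix.det_one (n := Fin q)]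
    congr 1
    ext i j
    simp [Matrix.one_apply, Finsupp.single_apply]
  have hbv : b ∘ Fin.castAdd q = v := funext hb
  refine ⟨f', fun h0 => ?_⟩
  have h := congrArg (fun w => w b) h0
  change wedge f f' b = 0 at h
  rw [wedge_apply] at h
  have hterm (σ : Equiv.Perm (Fin (k + q))) : 0 ≤ (((Equiv.Perm.sign σ : ℤ) : ℝ) *
      (f (b ∘ σ ∘ Fin.castAdd q) * f' (b ∘ σ ∘ Fin.natAdd k))) * f v := by
    by_cases hσ : Set.MapsTo (finSumFinEquiv.symm.permCongr σ) (Set.range Sum.inl)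
      (Set.range Sum.inl)
    · obtain ⟨⟨τ, τ'⟩, hτ⟩ := Equiv.Perm.mem_sumCongrHom_range_of_perm_mapsTo_inl hσ
      have hσ' : σ = permLeft q τ * permRight k τ' := by
        have h1 : σ = finSumFinEquiv.permCongr (finSumFinEquiv.symm.permCongr σ) := by
          ext i
          simp [Equiv.permCongr_apply]
        rw [h1, ← hτ]
        ext i
        refine Fin.addCases (fun i => ?_) (fun i => ?_) i <;>
          simp [permLeft, permRight, Equiv.permCongr_apply]
      have e1 : b ∘ σ ∘ Fin.castAdd q = v ∘ τ := by
        rw [← hbv, hσ']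
        ext i
        simp
      have e2 : b ∘ σ ∘ Fin.natAdd k = (b ∘ Fin.natAdd k) ∘ τ' := by
        rw [hσ']
        ext i
        simp
      have h1 := alternating_sign f v τ
      have h2 := alternating_sign f' (b ∘ Fin.natAdd k) τ'
      rw [e1, e2, hσ', Equiv.Perm.sign_mul, sign_permLeft, sign_permRight]
      rw [hf'b] at h2
      have h3 : (((Equiv.Perm.sign τ * Equiv.Perm.sign τ' : ℤˣ) : ℤ) : ℝ) *
          (f (v ∘ τ) * f' ((b ∘ Fin.natAdd k) ∘ τ')) =
          (((Equiv.Perm.sign τ : ℤ) : ℝ) * f (v ∘ τ)) *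
            (((Equiv.Perm.sign τ' : ℤ) : ℝ) * f' ((b ∘ Fin.natAdd k) ∘ τ')) := by
        push_cast
        ring
      rw [h3, h1, h2, mul_one]
      exact mul_self_nonneg _
    · -- Some basis vector fed into `f'` is one of the first `k` ones, so a row vanishes.
      rw [Equiv.Perm.perm_mapsTo_inl_iff_mapsTo_inr] at hσ
      obtain ⟨i, hi⟩ : ∃ i : Fin q,
          finSumFinEquiv.symm.permCongr σ (Sum.inr i) ∉ Set.range Sum.inr := by
        by_contra! h
        exact hσ (by rintro _ ⟨i, rfl⟩; exact h i)
      obtain ⟨j, hj⟩ : ∃ j : Fin k, σ (Fin.natAdd k i) = Fin.castAdd q j := by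
        refine Fin.addCases (motive := fun m => m = σ (Fin.natAdd k i) →
          ∃ j : Fin k, σ (Fin.natAdd k i) = Fin.castAdd q j) (fun j hj => ⟨j, hj.symm⟩)
          (fun j hj => (hi ⟨j, ?_⟩).elim) (σ (Fin.natAdd k i)) rfl
        simp [Equiv.permCongr_apply, ← hj]
      have : f' (b ∘ σ ∘ Fin.natAdd k) = 0 := by
        rw [hf', detForm_apply]
        refine Matrix.det_eq_zero_of_row_eq_zero i fun m => ?_
        have hne : Fin.castAdd q j ≠ Fin.natAdd k m := by
          simp only [ne_eq, Fin.ext_iff, Fin.val_castAdd, Fin.val_natAdd]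
          omega
        simp [hj, hne]
      simp [this]
  have hpos : 0 < (∑ σ : Equiv.Perm (Fin (k + q)), ((Equiv.Perm.sign σ : ℤ) : ℝ) *
      (f (b ∘ σ ∘ Fin.castAdd q) * f' (b ∘ σ ∘ Fin.natAdd k))) * f v := by
    rw [Finset.sum_mul]
    refine Finset.sum_pos' (fun σ _ => hterm σ) ⟨1, Finset.mem_univ _, ?_⟩
    have e1 : b ∘ (1 : Equiv.Perm (Fin (k + q))) ∘ Fin.castAdd q = v := hbv
    have e2 : b ∘ (1 : Equiv.Perm (Fin (k + q))) ∘ Fin.natAdd k = b ∘ Fin.natAdd k := rfl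
    rw [e1, e2, hf'b]
    simpa using mul_self_pos.2 hv
  rw [mul_eq_zero, inv_eq_zero] at h
  rcases h with h | h
  · have : (0 : ℝ) < k ! * q ! := by positivity
    exact this.ne' h
  · rw [h, zero_mul] at hpos
    exact lt_irrefl _ hpos

/-- A top degree form is multiplied by the determinant under pullback. -/
theorem compContinuousLinearMap_eq_det_smul {n : ℕ} (hn : Module.finrank ℝ V = n)
    (μ : AltForm V n) (L : V →L[ℝ] V) : μ.compContinuousLinearMap L = L.det • μ := by
  have e : Module.Basis (Fin n) ℝ V := Module.finBasisOfFinrankEq ℝ V hn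
  ext v
  have h := μ.toAlternatingMap.eq_smul_basis_det e
  have h1 (u : Fin n → V) : μ u = μ e * e.det u := congrArg (fun w => w u) h
  rw [ContinuousAlternatingMap.smul_apply, smul_eq_mul, h1 v]
  refine (h1 _).trans ?_
  rw [ContinuousLinearMap.det, mul_left_comm]
  congr 1
  exact e.det_comp L.toLinearMap v

end WedgePairing

section Averaging

open MeasureTheory

variable {G : Type*} [TopologicalSpace G] [Group G]
  {V : Type*} [NormedAddCommGroup V] [NormedSpace ℝ V]

/-- The determinant of a representation. -/
def detHom (rep : G →* (V ≃L[ℝ] V)) : G →* ℝ where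
  toFun g := (rep g : V →L[ℝ] V).det
  map_one' := by
    rw [map_one]
    exact LinearMap.det_id
  map_mul' g h := by
    rw [map_mul]
    exact LinearMap.det_comp _ _

theorem continuous_detHom {rep : G →* (V ≃L[ℝ] V)}
    (hrep : Continuous fun g => (rep g : V →L[ℝ] V)) : Continuous (detHom rep) :=
  ContinuousLinearMap.continuous_det.comp hrep

variable [CompactSpace G]

/-- A continuous real character of a compact group has values `±1`. -/
theorem abs_eq_one_of_compactSpace (χ : G →* ℝ) (hχ : Continuous χ) (g : G) : |χ g| = 1 := by
  obtain ⟨C, hC⟩ := (isCompact_range hχ).isBounded.exists_norm_le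
  have hle (g : G) : |χ g| ≤ 1 := by
    by_contra! h
    obtain ⟨n, hn⟩ := pow_unbounded_of_one_lt C h
    have h1 := hC (χ (g ^ n)) ⟨_, rfl⟩
    rw [map_pow, norm_pow, Real.norm_eq_abs] at h1
    exact absurd h1 (not_le.2 hn)
  have h1 : |χ g| * |χ g⁻¹| = 1 := by
    rw [← abs_mul, ← map_mul, mul_inv_cancel, map_one, abs_one]
  have h2 := hle g
  have h3 := hle g⁻¹
  nlinarith [abs_nonneg (χ g), abs_nonneg (χ g⁻¹)]

theorem eventually_eq_one_of_compactSpace (χ : G →* ℝ) (hχ : Continuous χ) :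
    ∀ᶠ g in nhds (1 : G), χ g = 1 := by
  have h : ∀ᶠ g in nhds (1 : G), 0 < χ g :=
    hχ.continuousAt.eventually (lt_mem_nhds (by rw [map_one]; exact one_pos))
  filter_upwards [h] with g hg
  rw [← abs_of_pos hg, abs_eq_one_of_compactSpace χ hχ]

variable [FiniteDimensional ℝ V]

/-- For a representation of a compact group and an invariant form `f ≠ 0` there is a form of
complementary degree whose wedge product with `f` is not zero, and which transforms under the group
by the determinant. It is obtained by averaging an arbitrary form of complementary degree. -/
theorem exists_semiinvariant_wedge_ne_zero [IsTopologicalGroup G] (rep : G →* (V ≃L[ℝ] V))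
    (hrep : Continuous fun g => (rep g : V →L[ℝ] V)) {k q : ℕ}
    (hn : Module.finrank ℝ V = k + q) {f : AltForm V k} (hf : f ≠ 0)
    (hinv : ∀ g, f.compContinuousLinearMap (rep g : V →L[ℝ] V) = f) :
    ∃ f' : AltForm V q, wedge f f' ≠ 0 ∧
      ∀ g, f'.compContinuousLinearMap (rep g : V →L[ℝ] V) = detHom rep g • f' := by
  obtain ⟨f₀, hf₀⟩ := exists_wedge_ne_zero hn hf
  borelize G
  let ν : Measure G := Measure.haar
  have : IsFiniteMeasure ν := inferInstance
  set H : G → AltForm V q := fun g =>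
    detHom rep g • f₀.compContinuousLinearMap (rep g⁻¹ : V →L[ℝ] V) with hH
  have hHc : Continuous H :=
    (continuous_detHom hrep).smul (((contDiff_compContinuousLinearMap q).continuous.comp
      (continuous_const.prodMk (hrep.comp continuous_inv))))
  have hHi : Integrable H ν :=
    hHc.integrable_of_hasCompactSupport (HasCompactSupport.of_compactSpace H)
  refine ⟨∫ g, H g ∂ν, ?_, fun h => ?_⟩
  · have h1 : wedgeL V k q f (∫ g, H g ∂ν) = ∫ g, wedge f f₀ ∂ν := by
      rw [← ContinuousLinearMap.integral_comp_comm _ hHi]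
      refine integral_congr_ae (Filter.Eventually.of_forall fun g => ?_)
      change wedge f (detHom rep g • f₀.compContinuousLinearMap (rep g⁻¹ : V →L[ℝ] V)) = _
      rw [wedge_smul]
      conv_lhs => rw [← hinv g⁻¹]
      rw [← wedge_comp, compContinuousLinearMap_eq_det_smul hn, smul_smul]
      change (detHom rep g * detHom rep g⁻¹) • _ = _
      rw [← map_mul, mul_inv_cancel, map_one, one_smul]
    rw [wedgeL_apply] at h1
    rw [h1, integral_const]
    refine smul_ne_zero ?_ hf₀
    rw [measureReal_ne_zero_iff]
    exact (NeZero.ne (ν Set.univ))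
  · have h1 : ContinuousAlternatingMap.compContinuousLinearMapCLM (rep h : V →L[ℝ] V)
        (∫ g, H g ∂ν) = ∫ g, detHom rep h • H (h⁻¹ * g) ∂ν := by
      rw [← ContinuousLinearMap.integral_comp_comm _ hHi]
      refine integral_congr_ae (Filter.Eventually.of_forall fun g => ?_)
      change (detHom rep g • f₀.compContinuousLinearMap (rep g⁻¹ : V →L[ℝ] V)
        ).compContinuousLinearMap (rep h : V →L[ℝ] V) = _
      simp only [hH]
      rw [smul_smul, ← map_mul, mul_inv_cancel_left, mul_inv_rev, inv_inv, map_mul]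
      rfl
    refine Eq.trans h1 ?_
    rw [integral_smul, integral_mul_left_eq_self]

end Averaging

/-! ### Stokes' theorem on open sets and densities in charts -/

section Stokes

open MeasureTheory

variable {E : Type*} [NormedAddCommGroup E] [NormedSpace ℝ E] [FiniteDimensional ℝ E]
  [MeasurableSpace E] [BorelSpace E]

/-- The integral of a directional derivative of a function with compact support vanishes. -/
theorem integral_fderiv_apply_eq_zero {g : E → ℝ} (hg : ContDiff ℝ 1 g)
    (hc : HasCompactSupport g) (v : E) : ∫ y, fderiv ℝ g y v ∂Measure.addHaar = 0 := by
  have hcont : Continuous fun y => fderiv ℝ g y v :=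
    (hg.continuous_fderiv one_ne_zero).clm_apply continuous_const
  have h := integral_mul_fderiv_eq_neg_fderiv_mul_of_integrable
    (μ := (Measure.addHaar : Measure E)) (f := fun _ : E => (1 : ℝ)) (g := g) (v := v)
    (by simp) (by simpa using hcont.integrable_of_hasCompactSupport (hc.fderiv_apply ℝ v))
    (by simpa using hg.continuous.integrable_of_hasCompactSupport hc)
    (fun _ _ => differentiableAt_const _) (fun y _ => hg.differentiable one_ne_zero y)
  simpa using h

theorem integrableOn_of_continuousOn_of_eq_zero {O K : Set E} (hO : IsOpen O) (hK : IsCompact K)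
    (hKO : K ⊆ O) {F : E → ℝ} (hF : ContinuousOn F O) (h0 : ∀ y ∈ O \ K, F y = 0) :
    IntegrableOn F O Measure.addHaar :=
  ((hF.mono hKO).integrableOn_compact hK).of_forall_sdiff_eq_zero hO.measurableSet h0

/-- Stokes' theorem for a form of degree `dim E - 1` with compact support on an open set. -/
theorem setIntegral_extDeriv_apply_eq_zero {N : ℕ} {O K : Set E} (hO : IsOpen O)
    (hK : IsCompact K) (hKO : K ⊆ O) {w : E → AltForm E N} (hw : ContDiffOn ℝ ∞ w O)
    (h0 : ∀ y ∈ O \ K, w y = 0) (v : Fin (N + 1) → E) :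
    ∫ y in O, extDeriv w y v ∂Measure.addHaar = 0 := by
  set w' : E → AltForm E N := O.indicator w with hw'
  have hout {y : E} (hy : y ∉ K) : w' =ᶠ[nhds y] fun _ => 0 := by
    filter_upwards [hK.isClosed.isOpen_compl.mem_nhds hy] with z hz
    by_cases hzO : z ∈ O
    · rw [hw', Set.indicator_of_mem hzO, h0 z ⟨hzO, hz⟩]
    · exact Set.indicator_of_notMem hzO _
  have hin {y : E} (hy : y ∈ O) : w' =ᶠ[nhds y] w := by
    filter_upwards [hO.mem_nhds hy] with z hz
    exact Set.indicator_of_mem hz _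
  have hsmooth : ContDiff ℝ 1 w' := contDiff_iff_contDiffAt.2 fun y => by
    by_cases hy : y ∈ O
    · exact ((hw.contDiffAt (hO.mem_nhds hy)).of_le (by simp)).congr_of_eventuallyEq (hin hy)
    · exact contDiffAt_const.congr_of_eventuallyEq (hout fun h => hy (hKO h))
  have hcs : HasCompactSupport w' := HasCompactSupport.intro hK fun y hy => (hout hy).self_of_nhds
  have h1 : ∫ y in O, extDeriv w y v ∂Measure.addHaar =
      ∫ y in O, extDeriv w' y v ∂Measure.addHaar :=
    setIntegral_congr_fun hO.measurableSet fun y hy => by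
      simp only [(hin hy).extDeriv_eq]
  rw [h1, setIntegral_eq_integral_of_forall_compl_eq_zero fun y hy => ?_]
  · have hev (i : Fin (N + 1)) : ContDiff ℝ 1 fun y => w' y (i.removeNth v) :=
      (ContinuousAlternatingMap.apply ℝ E ℝ (i.removeNth v)).contDiff.comp hsmooth
    have hevc (i : Fin (N + 1)) : HasCompactSupport fun y => w' y (i.removeNth v) :=
      hcs.comp_left (g := fun a : AltForm E N => a (i.removeNth v)) rfl
    simp only [extDeriv_apply (hsmooth.differentiable one_ne_zero _), zsmul_eq_mul]
    rw [integral_finsetSum _ fun i _ => ?_]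
    · refine Finset.sum_eq_zero fun i _ => ?_
      rw [integral_const_mul, integral_fderiv_apply_eq_zero (hev i) (hevc i), mul_zero]
    · refine Integrable.const_mul (Continuous.integrable_of_hasCompactSupport ?_
        ((hevc i).fderiv_apply ℝ _)) _
      exact ((hev i).continuous_fderiv one_ne_zero).clm_apply continuous_const
  · have hyK : y ∉ K := fun h => hy (hKO h)
    rw [(hout hyK).extDeriv_eq]
    simp [extDeriv, ContinuousAlternatingMap.alternatizeUncurryFin_apply]

end Stokes

section Density

open MeasureTheory

variable {E : Type*} [NormedAddCommGroup E] [NormedSpace ℝ E]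
  {M : Type*} [TopologicalSpace M] [ChartedSpace E M]

/-- The density on the target of the preferred chart around `c` that corresponds to a function `m`
on `M`, which gives for every `x` a multiple of a fixed volume on the model space `E = T_x M`. -/
def chartDensity (m : M → ℝ) (c : M) (y : E) : ℝ :=
  |(show E →L[ℝ] E from chartSymmDeriv c y).det| * m ((chartAt E c).symm y)

variable [IsManifold 𝓘(ℝ, E) ∞ M]

theorem chartDensity_pos {m : M → ℝ} (hm : ∀ x, 0 < m x) {c : M} {y : E}
    (hy : y ∈ (chartAt E c).target) : 0 < chartDensity m c y := by
  refine mul_pos (abs_pos.2 fun h => ?_) (hm _)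
  have h1 : (show E →L[ℝ] E from chartDeriv c ((chartAt E c).symm y)).comp
      (show E →L[ℝ] E from chartSymmDeriv c y) = ContinuousLinearMap.id ℝ E :=
    ContinuousLinearMap.ext fun v => chartSymmDeriv_comp_chartDeriv c hy v
  have h2 : ((show E →L[ℝ] E from chartDeriv c ((chartAt E c).symm y)).comp
      (show E →L[ℝ] E from chartSymmDeriv c y)).det = 1 := by
    rw [h1]
    exact LinearMap.det_id
  have h3 := LinearMap.det_comp
    (show E →L[ℝ] E from chartDeriv c ((chartAt E c).symm y)).toLinearMap
    (show E →L[ℝ] E from chartSymmDeriv c y).toLinearMap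
  have h4 : LinearMap.det (show E →L[ℝ] E from chartSymmDeriv c y).toLinearMap = 0 := h
  rw [h4, mul_zero] at h3
  exact zero_ne_one (h3.symm.trans h2)

variable [FiniteDimensional ℝ E] [MeasurableSpace E] [BorelSpace E]

/-- The integral of a function against a density does not depend on the chart. -/
theorem setIntegral_chartDensity (m g : M → ℝ) {c c' : M} {W : Set M} (hW : IsOpen W)
    (hc : W ⊆ (chartAt E c).source) (hc' : W ⊆ (chartAt E c').source) :
    ∫ y in chartAt E c '' W, g ((chartAt E c).symm y) * chartDensity m c y ∂Measure.addHaar =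
    ∫ y in chartAt E c' '' W, g ((chartAt E c').symm y) * chartDensity m c' y ∂Measure.addHaar := by
  have himg : chartAt E c' '' W = (chartAt E c' ∘ (chartAt E c).symm) '' (chartAt E c '' W) := by
    rw [Set.image_image]
    refine Set.image_congr fun x hx => ?_
    rw [Function.comp_apply, (chartAt E c).left_inv (hc hx)]
  have hopen : IsOpen (chartAt E c '' W) := (chartAt E c).isOpen_image_of_subset_source hW hc
  have hmem {y : E} (hy : y ∈ chartAt E c '' W) :
      y ∈ (chartAt E c).target ∧ (chartAt E c).symm y ∈ W := by
    obtain ⟨x, hx, rfl⟩ := hy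
    exact ⟨(chartAt E c).map_source (hc hx), by rwa [(chartAt E c).left_inv (hc hx)]⟩
  have hinj : Set.InjOn (chartAt E c' ∘ (chartAt E c).symm) (chartAt E c '' W) :=
    (chartAt E c').injOn.comp ((chartAt E c).symm.injOn.mono fun y hy => (hmem hy).1)
      fun y hy => hc' (hmem hy).2
  rw [himg, integral_image_eq_integral_abs_det_fderiv_smul Measure.addHaar hopen.measurableSet
    (f' := fderiv ℝ (chartAt E c' ∘ (chartAt E c).symm)) (fun y hy => ?_) hinj]
  · refine setIntegral_congr_fun hopen.measurableSet fun y hy => ?_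
    obtain ⟨hy1, hy2⟩ := hmem hy
    have hx' : (chartAt E c').symm ((chartAt E c' ∘ (chartAt E c).symm) y) =
      (chartAt E c).symm y := (chartAt E c').left_inv (hc' hy2)
    have h1 : (show E →L[ℝ] E from chartSymmDeriv c'
        ((chartAt E c' ∘ (chartAt E c).symm) y)).comp
        (fderiv ℝ (chartAt E c' ∘ (chartAt E c).symm) y) =
        (show E →L[ℝ] E from chartSymmDeriv c y) := by
      rw [chartSymmDeriv_change c c' hy1 (hc' hy2)]
      exact ContinuousLinearMap.ext fun v => chartDeriv_comp_chartSymmDeriv c' _ (hc' hy2) _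
    have h2 : (show E →L[ℝ] E from chartSymmDeriv c'
        ((chartAt E c' ∘ (chartAt E c).symm) y)).det *
        (fderiv ℝ (chartAt E c' ∘ (chartAt E c).symm) y).det =
        (show E →L[ℝ] E from chartSymmDeriv c y).det := by
      rw [← h1]
      exact (LinearMap.det_comp _ _).symm
    simp only [chartDensity, smul_eq_mul]
    rw [← h2, abs_mul, hx']
    ring
  · obtain ⟨hy1, hy2⟩ := hmem hy
    have h := contDiffAt_chartExpr (u := (id : M → M)) (c := c) (c' := c') hy1 contMDiffAt_id
      (hc' hy2)
    exact (h.differentiableAt (by simp)).hasFDerivAt.hasFDerivWithinAt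

end Density

/-! ### Vanishing of integrals on a compact manifold -/

section Divergence

open MeasureTheory

variable {E : Type*} [NormedAddCommGroup E] [NormedSpace ℝ E] [FiniteDimensional ℝ E]
  [MeasurableSpace E] [BorelSpace E]
  {M : Type*} [TopologicalSpace M] [ChartedSpace E M] [IsManifold 𝓘(ℝ, E) ∞ M]

/-- The integral against a density of a function supported on the overlap of two chart domains
can be computed in either of them. -/
theorem setIntegral_chartDensity_of_support (m g : M → ℝ) {c c' : M} {W W' : Set M}
    (hW : IsOpen W) (hW' : IsOpen W') (hc : W ⊆ (chartAt E c).source)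
    (hc' : W' ⊆ (chartAt E c').source) (h0 : ∀ x ∉ W ∩ W', g x = 0) :
    ∫ y in chartAt E c '' W, g ((chartAt E c).symm y) * chartDensity m c y ∂Measure.addHaar =
    ∫ y in chartAt E c' '' W', g ((chartAt E c').symm y) * chartDensity m c' y
      ∂Measure.addHaar := by
  have key (c : M) (W W' : Set M) (hW : IsOpen W) (hc : W ⊆ (chartAt E c).source)
      (h0 : ∀ x ∉ W ∩ W', g x = 0) :
      ∫ y in chartAt E c '' W, g ((chartAt E c).symm y) * chartDensity m c y ∂Measure.addHaar =
      ∫ y in chartAt E c '' (W ∩ W'), g ((chartAt E c).symm y) * chartDensity m c y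
        ∂Measure.addHaar := by
    refine setIntegral_eq_of_subset_of_forall_sdiff_eq_zero
      ((chartAt E c).isOpen_image_of_subset_source hW hc).measurableSet
      (Set.image_mono Set.inter_subset_left) fun y hy => ?_
    obtain ⟨⟨x, hx, rfl⟩, hy⟩ := hy
    rw [(chartAt E c).left_inv (hc hx), h0 x fun h => hy ⟨x, h, rfl⟩, zero_mul]
  rw [key c W W' hW hc h0, key c' W' W hW' hc' fun x hx => h0 x fun h => hx h.symm,
    Set.inter_comm W' W]
  exact setIntegral_chartDensity m g (hW.inter hW') (Set.inter_subset_left.trans hc)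
    (Set.inter_subset_right.trans hc')

/-- On a non-empty compact manifold with a density there is no local operator on functions that
maps `1` to `1` and whose values on functions with small support have vanishing integral.
With a partition of unity `ρ`, the total integral of `1 = ∑ᵢ D ρᵢ` would be `0`. -/
theorem false_of_integral_eq_zero [CompactSpace M] [T2Space M] [Nonempty M] {m : M → ℝ}
    (hm : ∀ x, 0 < m x) (D : C^∞⟮𝓘(ℝ, E), M; ℝ⟯ →ₗ[ℝ] (M → ℝ)) (hD1 : D 1 = 1)
    (hD0 : ∀ (u : C^∞⟮𝓘(ℝ, E), M; ℝ⟯) (x : M), x ∉ tsupport u → D u x = 0)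
    (hloc : ∀ c : M, ∃ W : Set M, IsOpen W ∧ c ∈ W ∧ W ⊆ (chartAt E c).source ∧
      (∀ u, ContinuousOn (fun y => D u ((chartAt E c).symm y) * chartDensity m c y)
        (chartAt E c '' W)) ∧
      ∀ u : C^∞⟮𝓘(ℝ, E), M; ℝ⟯, tsupport u ⊆ W →
        ∫ y in chartAt E c '' W, D u ((chartAt E c).symm y) * chartDensity m c y
          ∂Measure.addHaar = 0) : False := by
  choose W hWo hcW hWs hcont hint using hloc
  obtain ⟨t, ht⟩ := isCompact_univ.elim_finite_subcover W hWo fun x _ =>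
    Set.mem_iUnion.2 ⟨x, hcW x⟩
  obtain ⟨r, hr⟩ := SmoothPartitionOfUnity.exists_isSubordinate 𝓘(ℝ, E) isClosed_univ
    (fun c : t => W c) (fun c => hWo c) fun x hx => by
      obtain ⟨c, hc, hxc⟩ := Set.mem_iUnion₂.1 (ht hx)
      exact Set.mem_iUnion.2 ⟨⟨c, hc⟩, hxc⟩
  have hsum (x : M) : ∑ i, r i x = 1 := by
    rw [← finsum_eq_sum_of_fintype]
    exact r.sum_eq_one (Set.mem_univ x)
  have hDsum (x : M) : ∑ i, D (r i) x = 1 := by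
    have h1 : ∑ i, r i = 1 := by
      ext x
      refine Eq.trans ?_ (hsum x)
      exact (map_sum ((Pi.evalAddMonoidHom (fun _ : M => ℝ) x).comp
        ContMDiffMap.coeFnAddMonoidHom) _ _)
    rw [← Finset.sum_apply, ← map_sum, h1, hD1, Pi.one_apply]
  have himg (c : M) : IsOpen (chartAt E c '' W c) :=
    (chartAt E c).isOpen_image_of_subset_source (hWo c) (hWs c)
  have hr0 {i : t} {x : M} (hx : x ∉ W i) : r i x = 0 := image_eq_zero_of_notMem_tsupport
    fun h => hx (hr i h)
  have hDr0 {i : t} {x : M} (hx : x ∉ W i) : D (r i) x = 0 := hD0 _ _ fun h => hx (hr i h)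
  have hK (i : t) : IsCompact (chartAt E i.1 '' tsupport (r i)) :=
    (isClosed_tsupport _).isCompact.image_of_continuousOn
      ((chartAt E i.1).continuousOn.mono ((hr i).trans (hWs i)))
  have hKW (i : t) : chartAt E i.1 '' tsupport (r i) ⊆ chartAt E i.1 '' W i.1 :=
    Set.image_mono (hr i)
  have hrc (i : t) (c : M) : ContinuousOn (fun y => r i ((chartAt E c).symm y))
      (chartAt E c '' W c) := (r i).contMDiff.continuous.comp_continuousOn
    ((chartAt E c).continuousOn_symm.mono ((Set.image_mono (hWs c)).trans
      (chartAt E c).image_source_eq_target.subset))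
  have hI1 (u : C^∞⟮𝓘(ℝ, E), M; ℝ⟯) (i j : t) (g : M → ℝ)
      (hg : g = fun x => r j x * D u x) (hg0 : ∀ x ∉ tsupport (r i), g x = 0) :
      IntegrableOn (fun y => g ((chartAt E i.1).symm y) * chartDensity m i.1 y)
        (chartAt E i.1 '' W i.1) Measure.addHaar := by
    refine integrableOn_of_continuousOn_of_eq_zero (himg i) (hK i) (hKW i) ?_ ?_
    · refine ((hrc j i).mul (hcont i u)).congr fun y _ => ?_
      simp only [hg, Pi.mul_apply, mul_assoc]
    · rintro y ⟨⟨x, hx, rfl⟩, hy⟩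
      rw [(chartAt E i.1).left_inv (hWs _ hx), hg0 x fun h => hy ⟨x, h, rfl⟩, zero_mul]
  have hI2 (i j : t) : IntegrableOn (fun y => r j ((chartAt E i.1).symm y) *
      D (r i) ((chartAt E i.1).symm y) * chartDensity m i.1 y)
        (chartAt E i.1 '' W i.1) Measure.addHaar :=
    hI1 (r i) i j (fun x => r j x * D (r i) x) rfl fun x hx => by
      simp only [hD0 _ _ hx, mul_zero]
  have hI3 (i j : t) : IntegrableOn (fun y => r j ((chartAt E j.1).symm y) *
      D (r i) ((chartAt E j.1).symm y) * chartDensity m j.1 y)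
        (chartAt E j.1 '' W j.1) Measure.addHaar :=
    hI1 (r i) j j (fun x => r j x * D (r i) x) rfl fun x hx => by
      simp only [image_eq_zero_of_notMem_tsupport hx, zero_mul]
  have h1 (i : t) : ∑ j : t, ∫ y in chartAt E i.1 '' W i.1, r j ((chartAt E i.1).symm y) *
      D (r i) ((chartAt E i.1).symm y) * chartDensity m i.1 y ∂Measure.addHaar = 0 := by
    rw [← integral_finsetSum _ fun j _ => hI2 i j, ← hint i (r i) (hr i)]
    refine setIntegral_congr_fun (himg i).measurableSet fun y _ => ?_
    simp only [mul_assoc]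
    rw [← Finset.sum_mul, hsum, one_mul]
  have h2 (j : t) : ∑ i : t, ∫ y in chartAt E j.1 '' W j.1, r j ((chartAt E j.1).symm y) *
      D (r i) ((chartAt E j.1).symm y) * chartDensity m j.1 y ∂Measure.addHaar =
      ∫ y in chartAt E j.1 '' W j.1, r j ((chartAt E j.1).symm y) * chartDensity m j.1 y
        ∂Measure.addHaar := by
    rw [← integral_finsetSum _ fun i _ => hI3 i j]
    refine setIntegral_congr_fun (himg j).measurableSet fun y _ => ?_
    simp only [← Finset.sum_mul, ← Finset.mul_sum, hDsum, mul_one]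
  have h3 : ∑ j : t, ∫ y in chartAt E j.1 '' W j.1, r j ((chartAt E j.1).symm y) *
      chartDensity m j.1 y ∂Measure.addHaar = 0 := by
    rw [← Finset.sum_congr rfl fun j _ => h2 j, Finset.sum_comm,
      ← Finset.sum_eq_zero fun i _ => h1 i]
    refine Finset.sum_congr rfl fun i _ => Finset.sum_congr rfl fun j _ => ?_
    refine setIntegral_chartDensity_of_support m (fun x => r j x * D (r i) x) (hWo j) (hWo i)
      (hWs j) (hWs i) fun x hx => ?_
    by_cases hxj : x ∈ W j
    · rw [hDr0 fun h => hx ⟨hxj, h⟩, mul_zero]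
    · rw [hr0 hxj, zero_mul]
  have hpos (j : t) {y : E} (hy : y ∈ chartAt E j.1 '' W j.1) : 0 < chartDensity m j.1 y := by
    obtain ⟨x, hx, rfl⟩ := hy
    exact chartDensity_pos hm ((chartAt E j.1).map_source (hWs _ hx))
  have hnn (j : t) {y : E} (hy : y ∈ chartAt E j.1 '' W j.1) :
      0 ≤ r j ((chartAt E j.1).symm y) * chartDensity m j.1 y :=
    mul_nonneg (r.nonneg j _) (hpos j hy).le
  have h4 := (Finset.sum_eq_zero_iff_of_nonneg fun j _ =>
    setIntegral_nonneg (himg j.1).measurableSet fun y hy => hnn j hy).1 h3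
  obtain ⟨x⟩ := ‹Nonempty M›
  obtain ⟨j, hj⟩ : ∃ j, 0 < r j x := by
    by_contra! h
    exact absurd (hsum x) (by
      rw [Finset.sum_eq_zero fun i _ => le_antisymm (h i) (r.nonneg i x)]
      exact zero_ne_one)
  have hxW : x ∈ W j := by
    by_contra h
    exact hj.ne' (hr0 h)
  have hcj : ContinuousOn (fun y => r j ((chartAt E j.1).symm y) * chartDensity m j.1 y)
      (chartAt E j.1 '' W j.1) := by
    refine ((hrc j j).mul (hcont j 1)).congr fun y _ => ?_
    simp only [hD1, Pi.one_apply, one_mul, Pi.mul_apply]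
  have hIj : IntegrableOn (fun y => r j ((chartAt E j.1).symm y) * chartDensity m j.1 y)
      (chartAt E j.1 '' W j.1) Measure.addHaar := by
    refine (hI1 1 j j (r j) ?_ fun x hx => image_eq_zero_of_notMem_tsupport hx)
    simp [hD1]
  refine (h4 j (Finset.mem_univ j)).not_gt ?_
  rw [setIntegral_pos_iff_support_of_nonneg_ae
    (ae_restrict_of_forall_mem (himg j.1).measurableSet fun y hy => hnn j hy) hIj]
  have hopen := hcj.isOpen_inter_preimage (himg j.1) isOpen_compl_singleton (t := {(0 : ℝ)}ᶜ)
  rw [Set.inter_comm] at hopen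
  refine hopen.measure_pos Measure.addHaar ⟨chartAt E j.1 x, ?_, x, hxW, rfl⟩
  refine (mul_pos ?_ (hpos j ⟨x, hxW, rfl⟩)).ne'
  rwa [(chartAt E j.1).left_inv (hWs _ hxW)]

end Divergence

/-! ### Twisted volume forms are not exact -/

section CovectorWedge

variable {E : Type*} [NormedAddCommGroup E] [NormedSpace ℝ E]

/-- The product of a covector and an alternating form, normalized to be the form that appears in
the Leibniz rule for the exterior derivative. -/
def covectorWedge {k : ℕ} (ξ : E →L[ℝ] ℝ) (w : AltForm E k) : AltForm E (k + 1) :=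
  ContinuousAlternatingMap.alternatizeUncurryFin (ξ.smulRight w)

theorem covectorWedge_apply {k : ℕ} (ξ : E →L[ℝ] ℝ) (w : AltForm E k) (v : Fin (k + 1) → E) :
    covectorWedge ξ w v =
      ∑ i : Fin (k + 1), (-1 : ℝ) ^ (i : ℕ) * (ξ (v i) * w (i.removeNth v)) := by
  simp [covectorWedge, ContinuousAlternatingMap.alternatizeUncurryFin_apply]

theorem covectorWedge_comp {k : ℕ} (ξ : E →L[ℝ] ℝ) (w : AltForm E k) (L : E →L[ℝ] E) :
    (covectorWedge ξ w).compContinuousLinearMap L =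
      covectorWedge (ξ.comp L) (w.compContinuousLinearMap L) := by
  ext v
  simp only [ContinuousAlternatingMap.compContinuousLinearMap_apply, covectorWedge_apply]
  rfl

theorem covectorWedge_smul {k : ℕ} (ξ : E →L[ℝ] ℝ) (r : ℝ) (w : AltForm E k) :
    covectorWedge ξ (r • w) = r • covectorWedge ξ w := by
  ext v
  simp only [covectorWedge_apply, ContinuousAlternatingMap.smul_apply, smul_eq_mul, Finset.mul_sum]
  exact Finset.sum_congr rfl fun i _ => by ring

theorem add_covectorWedge {k : ℕ} (ξ ξ' : E →L[ℝ] ℝ) (w : AltForm E k) :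
    covectorWedge (ξ + ξ') w = covectorWedge ξ w + covectorWedge ξ' w := by
  ext v
  simp only [covectorWedge_apply, ContinuousAlternatingMap.add_apply, ← Finset.sum_add_distrib]
  exact Finset.sum_congr rfl fun i _ => by simp; ring

theorem smul_covectorWedge {k : ℕ} (r : ℝ) (ξ : E →L[ℝ] ℝ) (w : AltForm E k) :
    covectorWedge (r • ξ) w = r • covectorWedge ξ w := by
  ext v
  simp only [covectorWedge_apply, ContinuousAlternatingMap.smul_apply, smul_eq_mul, Finset.mul_sum]
  exact Finset.sum_congr rfl fun i _ => by simp; ring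

theorem zero_covectorWedge {k : ℕ} (w : AltForm E k) :
    covectorWedge (0 : E →L[ℝ] ℝ) w = 0 := by
  ext v
  simp [covectorWedge_apply]

theorem extDeriv_fun_smul {k : ℕ} {r : E → ℝ} {w : E → AltForm E k} {y : E}
    (hr : DifferentiableAt ℝ r y) (hw : DifferentiableAt ℝ w y) :
    extDeriv (fun z => r z • w z) y =
      covectorWedge (fderiv ℝ r y) (w y) + r y • extDeriv w y := by
  rw [extDeriv, extDeriv, fderiv_fun_smul hr hw,
    ContinuousAlternatingMap.alternatizeUncurryFin_add,
    ContinuousAlternatingMap.alternatizeUncurryFin_smul]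
  exact add_comm _ _

end CovectorWedge

section TwistedVolume

open MeasureTheory

variable {E : Type*} [NormedAddCommGroup E] [NormedSpace ℝ E]
  {M : Type*} [TopologicalSpace M] [ChartedSpace E M]

/-- The function `d(u w) / μ`, given at every point by the formula `u + (du ∧ w) / μ` that holds
for forms with `d w = μ`. It does not change if `w` and `μ` are multiplied by the same sign. -/
def divergence {N : ℕ} (w : FormField E M ℝ N) (μ : FormField E M ℝ (N + 1))
    (b : Fin (N + 1) → E) (u : M → ℝ) (x : M) : ℝ :=
  u x + covectorWedge (show E →L[ℝ] ℝ from mfderiv 𝓘(ℝ, E) 𝓘(ℝ, ℝ) u x)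
    (show AltForm E N from w x) b / (show AltForm E (N + 1) from μ x) b

theorem divergence_add {N : ℕ} (w : FormField E M ℝ N) (μ : FormField E M ℝ (N + 1))
    (b : Fin (N + 1) → E) {u u' : M → ℝ} {x : M} (hu : MDifferentiableAt 𝓘(ℝ, E) 𝓘(ℝ, ℝ) u x)
    (hu' : MDifferentiableAt 𝓘(ℝ, E) 𝓘(ℝ, ℝ) u' x) :
    divergence w μ b (u + u') x = divergence w μ b u x + divergence w μ b u' x := by
  have h : (show E →L[ℝ] ℝ from mfderiv 𝓘(ℝ, E) 𝓘(ℝ, ℝ) (u + u') x) =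
      (show E →L[ℝ] ℝ from mfderiv 𝓘(ℝ, E) 𝓘(ℝ, ℝ) u x) +
      (show E →L[ℝ] ℝ from mfderiv 𝓘(ℝ, E) 𝓘(ℝ, ℝ) u' x) := mfderiv_add hu hu'
  rw [divergence, h, add_covectorWedge, ContinuousAlternatingMap.add_apply, divergence, divergence,
    Pi.add_apply]
  ring

theorem divergence_smul {N : ℕ} (w : FormField E M ℝ N) (μ : FormField E M ℝ (N + 1))
    (b : Fin (N + 1) → E) (r : ℝ) {u : M → ℝ} {x : M}
    (hu : MDifferentiableAt 𝓘(ℝ, E) 𝓘(ℝ, ℝ) u x) :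
    divergence w μ b (r • u) x = r * divergence w μ b u x := by
  have h : (show E →L[ℝ] ℝ from mfderiv 𝓘(ℝ, E) 𝓘(ℝ, ℝ) (r • u) x) =
      r • (show E →L[ℝ] ℝ from mfderiv 𝓘(ℝ, E) 𝓘(ℝ, ℝ) u x) := const_smul_mfderiv hu r
  rw [divergence, h, smul_covectorWedge, ContinuousAlternatingMap.smul_apply, divergence,
    Pi.smul_apply]
  simp only [smul_eq_mul]
  ring

theorem divergence_one {N : ℕ} (w : FormField E M ℝ N) (μ : FormField E M ℝ (N + 1))
    (b : Fin (N + 1) → E) (x : M) : divergence w μ b (1 : M → ℝ) x = 1 := by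
  have h : (show E →L[ℝ] ℝ from mfderiv 𝓘(ℝ, E) 𝓘(ℝ, ℝ) (1 : M → ℝ) x) = 0 := mfderiv_const
  rw [divergence, h, zero_covectorWedge]
  simp

theorem divergence_eq_zero {N : ℕ} (w : FormField E M ℝ N) (μ : FormField E M ℝ (N + 1))
    (b : Fin (N + 1) → E) {u : M → ℝ} {x : M} (hx : x ∉ tsupport u) :
    divergence w μ b u x = 0 := by
  have hu : u =ᶠ[nhds x] fun _ => 0 := notMem_tsupport_iff_eventuallyEq.1 hx
  have h : (show E →L[ℝ] ℝ from mfderiv 𝓘(ℝ, E) 𝓘(ℝ, ℝ) u x) = 0 := by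
    have h1 := ((hasMFDerivAt_const (I := 𝓘(ℝ, E)) (I' := 𝓘(ℝ, ℝ)) (0 : ℝ) x).congr_of_eventuallyEq
      hu)
    exact h1.mfderiv
  rw [divergence, h, zero_covectorWedge, hu.eq_of_nhds]
  simp

variable [FiniteDimensional ℝ E] [IsManifold 𝓘(ℝ, E) ∞ M]

/-- If `d w = μ`, then `divergence w μ b u • μ = d(u w)`. The identity is stated in a chart, for
forms with this property after multiplication by a common function `ε`. -/
theorem divergence_mul_inChart {N : ℕ} {w : FormField E M ℝ N} {μ : FormField E M ℝ (N + 1)}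
    (b : Module.Basis (Fin (N + 1)) ℝ E) {ε : M → ℝ} {c : M} {y : E}
    (hy : y ∈ (chartAt E c).target) (hμ : μ ((chartAt E c).symm y) ≠ 0)
     (hw : DifferentiableAt ℝ (FormField.inChart (fun x => ε x • w x : FormField E M ℝ N) c) y)
    (hd : extDeriv (FormField.inChart (fun x => ε x • w x : FormField E M ℝ N) c) y =
      FormField.inChart (fun x => ε x • μ x : FormField E M ℝ (N + 1)) c y)
    {u : M → ℝ} (hu : MDifferentiableAt 𝓘(ℝ, E) 𝓘(ℝ, ℝ) u ((chartAt E c).symm y)) :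
    divergence w μ b u ((chartAt E c).symm y) *
        FormField.inChart (fun x => ε x • μ x : FormField E M ℝ (N + 1)) c y b =
      extDeriv (fun z => u ((chartAt E c).symm z) •
        FormField.inChart (fun x => ε x • w x : FormField E M ℝ N) c z) y b := by
  have hE : Module.finrank ℝ E = N + 1 := by simpa using Module.finrank_eq_card_basis b
  set x := (chartAt E c).symm y with hx
  have hsymm : MDifferentiableAt 𝓘(ℝ, E) 𝓘(ℝ, E) (chartAt E c).symm y :=
    (contMDiffOn_chart_symm (I := 𝓘(ℝ, E)) (n := ∞)).contMDiffAt
      ((chartAt E c).open_target.mem_nhds hy) |>.mdifferentiableAt (by simp)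
  have hdu : HasFDerivAt (fun z => u ((chartAt E c).symm z))
      ((show E →L[ℝ] ℝ from mfderiv 𝓘(ℝ, E) 𝓘(ℝ, ℝ) u x).comp
        (show E →L[ℝ] E from chartSymmDeriv c y)) y :=
    hasMFDerivAt_iff_hasFDerivAt.1 (hu.hasMFDerivAt.comp y hsymm.hasMFDerivAt)
  rw [extDeriv_fun_smul hdu.differentiableAt hw, hdu.fderiv, hd]
  have h1 : FormField.inChart (fun x => ε x • w x : FormField E M ℝ N) c y =
      ε x • (show AltForm E N from w x).compContinuousLinearMap
        (show E →L[ℝ] E from chartSymmDeriv c y) := rfl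
  have h2 : FormField.inChart (fun x => ε x • μ x : FormField E M ℝ (N + 1)) c y =
      ε x • (show AltForm E (N + 1) from μ x).compContinuousLinearMap
        (show E →L[ℝ] E from chartSymmDeriv c y) := rfl
  have h3 : (show AltForm E (N + 1) from μ x) b ≠ 0 := apply_basis_ne_zero (V := E) hμ b
  rw [h1, h2, covectorWedge_smul, ← covectorWedge_comp, compContinuousLinearMap_eq_det_smul hE,
    compContinuousLinearMap_eq_det_smul hE, divergence]
  have key (r d e : ℝ) (f f' : AltForm E (N + 1)) (hf' : f' b ≠ 0) :
      (r + f b / f' b) * (e • d • f') b = (e • d • f + r • e • d • f') b := by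
    simp only [ContinuousAlternatingMap.add_apply, ContinuousAlternatingMap.smul_apply, smul_eq_mul]
    field_simp
    ring
  exact key _ _ _ _ _ h3

variable [MeasurableSpace E] [BorelSpace E]

/-- On a non-empty compact manifold, a nowhere vanishing top degree form that is only smooth up to
signs is not exact, where the signs are the same for the form and its primitive: this amounts to
Stokes' theorem for densities. -/
theorem false_of_twisted_extDeriv_eq [CompactSpace M] [T2Space M] [Nonempty M] {N : ℕ}
    (hE : Module.finrank ℝ E = N + 1) (w : FormField E M ℝ N) (μ : FormField E M ℝ (N + 1))
    (hμ : ∀ x, μ x ≠ 0)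
    (hloc : ∀ c : M, ∃ U : Set M, IsOpen U ∧ c ∈ U ∧ ∃ ε : M → ℝ, (∀ x, |ε x| = 1) ∧
      ∀ y ∈ (chartAt E c).target, (chartAt E c).symm y ∈ U →
        ContDiffAt ℝ ∞ (FormField.inChart (fun x => ε x • w x : FormField E M ℝ N) c) y ∧
        extDeriv (FormField.inChart (fun x => ε x • w x : FormField E M ℝ N) c) y =
          FormField.inChart (fun x => ε x • μ x : FormField E M ℝ (N + 1)) c y) : False := by
  let b : Module.Basis (Fin (N + 1)) ℝ E := Module.finBasisOfFinrankEq ℝ E hE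
  have hμb (x : M) : (show AltForm E (N + 1) from μ x) b ≠ 0 :=
    apply_basis_ne_zero (V := E) (hμ x) b
  have hdiff (u : C^∞⟮𝓘(ℝ, E), M; ℝ⟯) (x : M) : MDifferentiableAt 𝓘(ℝ, E) 𝓘(ℝ, ℝ) u x :=
    u.contMDiff.mdifferentiable (by simp) x
  let D : C^∞⟮𝓘(ℝ, E), M; ℝ⟯ →ₗ[ℝ] (M → ℝ) :=
    { toFun := fun u => divergence w μ b u
      map_add' := fun u u' => funext fun x => divergence_add w μ b (hdiff u x) (hdiff u' x)
      map_smul' := fun r u => funext fun x => divergence_smul w μ b r (hdiff u x) }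
  refine false_of_integral_eq_zero (m := fun x => |(show AltForm E (N + 1) from μ x) b|)
    (fun x => abs_pos.2 (hμb x)) D (funext fun x => divergence_one w μ b x)
    (fun u x hx => divergence_eq_zero w μ b hx) fun c => ?_
  obtain ⟨U, hU, hcU, ε, hε, hUε⟩ := hloc c
  set w' := FormField.inChart (fun x => ε x • w x : FormField E M ℝ N) c
  set κ : E → ℝ := fun y => FormField.inChart (fun x => ε x • μ x : FormField E M ℝ (N + 1)) c y b
    with hκ
  have hdens (y : E) : chartDensity (fun x => |(show AltForm E (N + 1) from μ x) b|) c y =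
      |κ y| := by
    have h2 : FormField.inChart (fun x => ε x • μ x : FormField E M ℝ (N + 1)) c y =
        ε ((chartAt E c).symm y) • (show AltForm E (N + 1) from
          μ ((chartAt E c).symm y)).compContinuousLinearMap
            (show E →L[ℝ] E from chartSymmDeriv c y) := rfl
    rw [hκ]
    beta_reduce
    rw [h2, compContinuousLinearMap_eq_det_smul hE, chartDensity,
      ContinuousAlternatingMap.smul_apply, ContinuousAlternatingMap.smul_apply, smul_eq_mul,
      smul_eq_mul, abs_mul, abs_mul, hε, one_mul]
  have hc := mem_chart_source E c
  set O : Set E := (chartAt E c).target ∩ (chartAt E c).symm ⁻¹' U with hO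
  have hOo : IsOpen O := (chartAt E c).isOpen_inter_preimage_symm hU
  have hw' : ContDiffOn ℝ ∞ w' O := fun y hy => (hUε y hy.1 hy.2).1.contDiffWithinAt
  have hκc : ContinuousOn κ O := by
    refine ((ContinuousAlternatingMap.apply ℝ E ℝ b).continuous.comp_continuousOn
      (contDiffOn_extDeriv hOo hw').continuousOn).congr fun y hy => ?_
    exact congrArg (fun f : AltForm E (N + 1) => f b) (hUε y hy.1 hy.2).2.symm
  have hcO : chartAt E c c ∈ O := ⟨(chartAt E c).map_source hc, by
    rwa [Set.mem_preimage, (chartAt E c).left_inv hc]⟩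
  -- `κ` has a constant sign `η` near `c`, so that the density of `|μ|` is given there by `η κ`.
  obtain ⟨η, hη⟩ : ∃ η : ℝ, 0 < η * κ (chartAt E c c) ∧ |η| = 1 := by
    have h : 0 < chartDensity (fun x => |(show AltForm E (N + 1) from μ x) b|) c (chartAt E c c) :=
      chartDensity_pos (fun x => abs_pos.2 (hμb x)) hcO.1
    rw [hdens, abs_pos] at h
    rcases lt_or_gt_of_ne h with h | h
    · exact ⟨-1, by linarith, by simp⟩
    · exact ⟨1, by linarith, by simp⟩
  set O' : Set E := O ∩ {y | 0 < η * κ y} with hO'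
  have hO'o : IsOpen O' :=
    (continuousOn_const.mul hκc).isOpen_inter_preimage hOo isOpen_Ioi
  have hW : chartAt E c '' ((chartAt E c).symm '' O') = O' := by
    rw [Set.image_image]
    refine (Set.image_congr fun y hy => (chartAt E c).right_inv hy.1.1).trans (Set.image_id' _)
  have hdensO {y : E} (hy : y ∈ O') :
      chartDensity (fun x => |(show AltForm E (N + 1) from μ x) b|) c y = η * κ y := by
    have h : |η * κ y| = η * κ y := abs_of_pos hy.2
    rw [hdens, ← h, abs_mul, hη.2, one_mul]
  have hkey (u : C^∞⟮𝓘(ℝ, E), M; ℝ⟯) {y : E} (hy : y ∈ O') :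
      D u ((chartAt E c).symm y) *
        chartDensity (fun x => |(show AltForm E (N + 1) from μ x) b|) c y =
      η * extDeriv (fun z => u ((chartAt E c).symm z) • w' z) y b := by
    have hy' := hUε y hy.1.1 hy.1.2
    rw [hdensO hy, mul_left_comm]
    exact congrArg (η * ·) (divergence_mul_inChart b hy.1.1 (hμ _)
      (hy'.1.differentiableAt (by simp)) hy'.2 (hdiff u _))
  have hsm (u : C^∞⟮𝓘(ℝ, E), M; ℝ⟯) :
      ContDiffOn ℝ ∞ (fun z => u ((chartAt E c).symm z) • w' z) O' := by
    have hu : ContDiffOn ℝ ∞ (fun z => u ((chartAt E c).symm z)) O' :=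
      contMDiffOn_iff_contDiffOn.1 (u.contMDiff.comp_contMDiffOn
        ((contMDiffOn_chart_symm (I := 𝓘(ℝ, E)) (n := ∞)).mono fun y hy => hy.1.1))
    exact hu.smul (hw'.mono Set.inter_subset_left)
  refine ⟨(chartAt E c).symm '' O', ?_, ⟨chartAt E c c, ⟨hcO, hη.1⟩, (chartAt E c).left_inv hc⟩, ?_,
    fun u => ?_, fun u hu => ?_⟩
  · exact (chartAt E c).symm.isOpen_image_of_subset_source hO'o fun y hy => hy.1.1
  · rintro _ ⟨y, hy, rfl⟩
    exact (chartAt E c).map_target hy.1.1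
  · rw [hW]
    have hcont := (ContinuousAlternatingMap.apply ℝ E ℝ b).continuous.comp_continuousOn
      (contDiffOn_extDeriv hO'o (hsm u)).continuousOn
    exact (continuousOn_const.mul hcont).congr fun y hy => hkey u hy
  · rw [hW, setIntegral_congr_fun hO'o.measurableSet fun y hy => hkey u hy, integral_const_mul]
    have hus : tsupport u ⊆ (chartAt E c).source := fun x hx => by
      obtain ⟨y, hy, rfl⟩ := hu hx
      exact (chartAt E c).map_target hy.1.1
    rw [setIntegral_extDeriv_apply_eq_zero hO'o (K := chartAt E c '' tsupport u)
      ((isClosed_tsupport u).isCompact.image_of_continuousOn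
        ((chartAt E c).continuousOn.mono hus)) ?_ (hsm u) ?_, mul_zero]
    · rw [← hW]
      exact Set.image_mono hu
    · rintro y ⟨hy, hyK⟩
      rw [image_eq_zero_of_notMem_tsupport fun h => hyK ⟨_, h, (chartAt E c).right_inv hy.1.1⟩,
        zero_smul]

end TwistedVolume

/-! ### Injectivity in cohomology -/

section Signs

variable {E : Type*} [NormedAddCommGroup E] [NormedSpace ℝ E]
  {M : Type*} [TopologicalSpace M] [ChartedSpace E M]
  {EG : Type*} [NormedAddCommGroup EG] [NormedSpace ℝ EG]
  {G : Type*} [TopologicalSpace G] [ChartedSpace EG G] [Group G]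
  {EP : Type*} [NormedAddCommGroup EP] [NormedSpace ℝ EP]
  {P : Type*} [TopologicalSpace P] [ChartedSpace EP P] [IsManifold 𝓘(ℝ, EP) ∞ P]
  {V : Type*} [NormedAddCommGroup V] [NormedSpace ℝ V]

/-- The forms on `M` obtained from local sections and from the chosen points of the fibres agree up
to a sign, simultaneously for all forms that transform by the determinant. -/
theorem GStructure.exists_sign_localForm [CompactSpace G]
    (S : GStructure E M EG G EP P V) {U : Set M} {s : M → P}
    (hs : S.IsLocalSection U s) {x : M} (hx : x ∈ U) :
    ∃ e : ℝ, |e| = 1 ∧ ∀ (k : ℕ) (f : AltForm V k),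
      (∀ g, f.compContinuousLinearMap (S.rep g : V →L[ℝ] V) = detHom S.rep g • f) →
      S.localForm s f x = e • S.nuForm f x := by
  obtain ⟨g, hg⟩ := S.exists_act_eq ((S.proj_point x).trans (hs.proj_eq x hx).symm)
  refine ⟨detHom S.rep g⁻¹, abs_eq_one_of_compactSpace _
    (continuous_detHom S.contMDiff_rep.continuous) _, fun k f hf => ?_⟩
  rw [S.localForm_apply hs f hx, hg, S.coframe_act]
  ext v
  exact congrArg (fun f : AltForm V k => f fun i => S.coframe (S.point x) (v i)) (hf g⁻¹)

end Signs

section Injectivity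

variable {E : Type*} [NormedAddCommGroup E] [NormedSpace ℝ E] [FiniteDimensional ℝ E]
  {M : Type*} [TopologicalSpace M] [ChartedSpace E M] [IsManifold 𝓘(ℝ, E) ∞ M]
  {EG : Type*} [NormedAddCommGroup EG] [NormedSpace ℝ EG]
  {G : Type*} [TopologicalSpace G] [ChartedSpace EG G] [Group G] [LieGroup 𝓘(ℝ, EG) ∞ G]
  {EP : Type*} [NormedAddCommGroup EP] [NormedSpace ℝ EP]
  {P : Type*} [TopologicalSpace P] [ChartedSpace EP P] [IsManifold 𝓘(ℝ, EP) ∞ P]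
  {V : Type*} [NormedAddCommGroup V] [NormedSpace ℝ V] [FiniteDimensional ℝ V]

namespace GStructure

variable (S : GStructure E M EG G EP P V)

/-- For a torsion-free connection on a compact manifold and a compact structure group, the form on
`M` induced by an invariant form `f ≠ 0` of positive degree is not exact. With a form `f'` such that
`f ∧ f' ≠ 0` has top degree and `f'` transforms by the determinant, a primitive of the induced form
would yield a primitive of the twisted volume form induced by `f ∧ f'`. -/
theorem eq_zero_of_d_eq_nuForm [CompactSpace M] [T2Space M] [Nonempty M] [CompactSpace G]
    {C : S.toPrincipalBundle.Connection} (hC : S.torsion C = 0) {j : ℕ} {f : AltForm V (j + 1)}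
    (hf : ∀ g : G, f.compContinuousLinearMap (S.rep g : V →L[ℝ] V) = f) (a : RForm E M j)
    (ha : ∀ x, (RForm.d a).1 x = S.nuForm f x) : f = 0 := by
  by_contra hf0
  have := topologicalGroup_of_lieGroup 𝓘(ℝ, EG) ∞ (G := G)
  have hrep : Continuous fun g => (S.rep g : V →L[ℝ] V) := S.contMDiff_rep.continuous
  obtain ⟨q, hq⟩ : ∃ q, Module.finrank ℝ V = j + 1 + q := by
    refine Nat.exists_eq_add_of_le ?_
    by_contra h
    refine hf0 (ContinuousAlternatingMap.ext fun v => ?_)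
    refine f.toAlternatingMap.map_linearDependent v fun hv => h ?_
    simpa using hv.fintype_card_le_finrank
  obtain ⟨f', hff', hf'⟩ := exists_semiinvariant_wedge_ne_zero S.rep hrep hq hf0 hf
  have hadd : j + 1 + q = j + q + 1 := Nat.add_right_comm j 1 q
  set m : AltForm V (j + q + 1) := castForm hadd (wedge f f') with hm
  have hm0 : m ≠ 0 := fun h => hff' <| ContinuousAlternatingMap.ext fun v => by
    have h1 := congrArg (fun μ : AltForm V (j + q + 1) => μ (v ∘ Fin.cast hadd.symm)) h
    exact h1
  have hminv (g : G) : m.compContinuousLinearMap (S.rep g : V →L[ℝ] V) = detHom S.rep g • m :=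
    compContinuousLinearMap_eq_det_smul (hq.trans hadd) m _
  have hf'loc : S.LocallyInvariant f' := by
    filter_upwards [eventually_eq_one_of_compactSpace _ (continuous_detHom hrep)] with g hg
    rw [hf', hg, one_smul]
  borelize E
  refine false_of_twisted_extDeriv_eq (M := M) (N := j + q)
    (S.finrank_eq.symm.trans (hq.trans hadd))
    (fun x => GStr.wedge (a.1 x) (S.nuForm f' x)) (S.nuForm m) (fun x hx => hm0 ?_) fun c => ?_
  · exact S.compContinuousLinearMap_coframe_injective (j + q + 1) (S.point x) hx
  obtain ⟨U, s, hcU, hs⟩ := S.exists_isLocalSection c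
  have hex (x : M) : ∃ e : ℝ, |e| = 1 ∧ (x ∈ U → S.localForm s f' x = e • S.nuForm f' x ∧
      S.localForm s m x = e • S.nuForm m x) := by
    by_cases hx : x ∈ U
    · obtain ⟨e, he, h⟩ := S.exists_sign_localForm hs hx
      exact ⟨e, he, fun _ => ⟨h q f' hf', h _ m hminv⟩⟩
    · exact ⟨1, abs_one, fun h => absurd h hx⟩
  choose e he heU using hex
  refine ⟨U, hs.isOpen, hcU, e, he, fun y hy hyU => ?_⟩
  have hW : FormField.inChart (fun x => e x • GStr.wedge (a.1 x) (S.nuForm f' x) :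
      FormField E M ℝ (j + q)) c =ᶠ[nhds y] fun z =>
        wedgeL E j q (FormField.inChart a.1 c z) ((S.localForm s f').inChart c z) := by
    filter_upwards [eventually_chart_symm hy (hs.isOpen.mem_nhds hyU)] with z hz
    have h1 : (e ((chartAt E c).symm z) • GStr.wedge (a.1 ((chartAt E c).symm z))
        (S.nuForm f' ((chartAt E c).symm z))) = GStr.wedge (a.1 ((chartAt E c).symm z))
        (S.localForm s f' ((chartAt E c).symm z)) := by
      rw [(heU _ hz.2).1, wedge_smul]
    refine (congrArg (fun w : TangentSpace 𝓘(ℝ, E) ((chartAt E c).symm z) [⋀^Fin (j + q)]→L[ℝ] ℝ =>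
      w.compContinuousLinearMap (chartSymmDeriv c z)) h1).trans ?_
    exact wedge_comp _ _ _
  have hac : ContDiffAt ℝ ∞ (FormField.inChart a.1 c) y := contDiffAt_inChart a.2 c hy
  have hfc : ContDiffAt ℝ ∞ ((S.localForm s f').inChart c) y :=
    S.contDiffAt_inChart_localForm hs f' hy hyU
  refine ⟨ContDiffAt.congr_of_eventuallyEq ?_ hW, ?_⟩
  · exact ((wedgeL E j q).contDiff.contDiffAt.comp y hac).clm_apply hfc
  refine hW.extDeriv_eq.trans ?_
  have h2 := extDeriv_wedge (hac.differentiableAt (by simp)) (hfc.differentiableAt (by simp))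
  refine h2.trans ?_
  rw [S.extDeriv_localForm_eq_zero hC hs hf'loc hy hyU, wedge_zero, smul_zero, add_zero,
    ← inChart_extD a.2 c hy]
  have h3 : (FormField.extD a.1) ((chartAt E c).symm y) =
      S.localForm s f ((chartAt E c).symm y) :=
    (ha _).trans (S.nuForm_eq_localForm hs hf hyU)
  have h4 : e ((chartAt E c).symm y) • S.nuForm m ((chartAt E c).symm y) =
      S.localForm s m ((chartAt E c).symm y) := ((heU _ hyU).2).symm
  rw [S.localForm_apply hs f hyU] at h3
  rw [S.localForm_apply hs m hyU] at h4
  have h5 : FormField.inChart (fun x => e x • S.nuForm m x : FormField E M ℝ (j + q + 1)) c y =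
      (m.compContinuousLinearMap (S.coframe (s ((chartAt E c).symm y)))).compContinuousLinearMap
        (show E →L[ℝ] E from chartSymmDeriv c y) :=
    congrArg (fun w : AltForm E (j + q + 1) => w.compContinuousLinearMap
      (show E →L[ℝ] E from chartSymmDeriv c y)) h4
  have h6 : FormField.inChart (FormField.extD a.1) c y =
      (f.compContinuousLinearMap (S.coframe (s ((chartAt E c).symm y)))).compContinuousLinearMap
        (show E →L[ℝ] E from chartSymmDeriv c y) :=
    congrArg (fun w : AltForm E (j + 1) => w.compContinuousLinearMap
      (show E →L[ℝ] E from chartSymmDeriv c y)) h3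
  have h7 : (S.localForm s f').inChart c y =
      (f'.compContinuousLinearMap (S.coframe (s ((chartAt E c).symm y)))).compContinuousLinearMap
        (show E →L[ℝ] E from chartSymmDeriv c y) :=
    congrArg (fun w : AltForm E q => w.compContinuousLinearMap
      (show E →L[ℝ] E from chartSymmDeriv c y)) (S.localForm_apply hs f' hyU)
  rw [h5, h6, h7, ← wedge_comp, ← wedge_comp]
  rfl

/-- On a non-empty compact manifold with a torsion-free connection and compact structure group, two
invariant forms whose characteristic forms differ by an exact form are equal. -/
theorem eq_of_d_eq_sub [CompactSpace M] [T2Space M] [Nonempty M] [CompactSpace G]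
    (h : S.OneIntegrable) {f f' : invariantForms S.rep} {a : Omega E M}
    (ha : Omega.d a = S.nu f - S.nu f') : f = f' := by
  obtain ⟨C, hC⟩ := h
  have hk (k : ℕ) (x : M) : (Omega.d a k).1 x = S.nuForm (f.1 k) x - S.nuForm (f'.1 k) x := by
    rw [← S.nu_apply, ← S.nu_apply, ha, DirectSum.sub_apply]
    rfl
  refine Subtype.ext (DFinsupp.ext fun k => ?_)
  rcases k with - | k
  · obtain ⟨x⟩ := ‹Nonempty M›
    refine S.compContinuousLinearMap_coframe_injective 0 (S.point x) ?_
    have h0 := hk 0 x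
    rw [Omega.d_apply_zero] at h0
    exact sub_eq_zero.1 h0.symm
  · refine sub_eq_zero.1 (S.eq_zero_of_d_eq_nuForm hC (f := f.1 (k + 1) - f'.1 (k + 1))
      (fun g => ?_) (a k) fun x => ?_)
    · refine Eq.trans ?_ (congrArg₂ (· - ·) (f.2 g (k + 1)) (f'.2 g (k + 1)))
      rfl
    · rw [← Omega.d_apply_succ, hk]
      rfl

end GStructure

end Injectivity

end GStr

end

theorem corollary2p2
    {E : Type*} [NormedAddCommGroup E] [NormedSpace ℝ E] [FiniteDimensional ℝ E]
    {M : Type*} [TopologicalSpace M] [T2Space M] [ChartedSpace E M] [IsManifold 𝓘(ℝ, E) ∞ M]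
    {EG : Type*} [NormedAddCommGroup EG] [NormedSpace ℝ EG] [FiniteDimensional ℝ EG]
    {G : Type*} [TopologicalSpace G] [ChartedSpace EG G] [Group G] [LieGroup 𝓘(ℝ, EG) ∞ G]
    {EP : Type*} [NormedAddCommGroup EP] [NormedSpace ℝ EP] [FiniteDimensional ℝ EP]
    {P : Type*} [TopologicalSpace P] [ChartedSpace EP P] [IsManifold 𝓘(ℝ, EP) ∞ P]
    {V : Type*} [NormedAddCommGroup V] [NormedSpace ℝ V] [FiniteDimensional ℝ V]
    (S : GStr.GStructure E M EG G EP P V) :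
    ∃ nu : GStr.invariantForms S.rep →ₐ[ℝ] GStr.Omega E M,
      S.IsCharacteristicMap nu ∧
      (∀ nu' : GStr.invariantForms S.rep → GStr.Omega E M,
        S.IsCharacteristicMap nu' → nu' = nu) ∧
      (S.OneIntegrable →
        ∃ closed : ∀ f, nu f ∈ GStr.closedForms E M,
        ∃ nuStar : GStr.invariantForms S.rep →ₐ[ℝ] GStr.DeRham E M,
          (∀ f, nuStar f = Ideal.Quotient.mk (GStr.exactForms E M) ⟨nu f, closed f⟩) ∧
          (Nonempty M → CompactSpace M → CompactSpace G → Function.Injective nuStar)) := by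
  refine ⟨S.nu, S.isCharacteristicMap_nu, fun nu' h => S.isCharacteristicMap_nu.unique S h,
    fun h => ?_⟩
  refine ⟨S.nu_mem_closedForms h, (Ideal.Quotient.mkₐ ℝ (GStr.exactForms E M)).comp
    (S.nu.codRestrict _ (S.nu_mem_closedForms h)), fun f => rfl, fun _ _ _ f f' hff' => ?_⟩
  obtain ⟨a, ha⟩ := Ideal.Quotient.eq.1 hff'
  exact S.eq_of_d_eq_sub h ha
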